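/- Conventions. For $T>0$, $\alpha>0$, $p,q\in(0,\infty]$ and a path $f:[0,T]\to\mathbb R^m$ put $$\Omega_p^f(t)=\sup_{0<h\le t}\Big(\int_0^{T-h}|f(s+h)-f(s)|^p\,ds\Big)^{1/p},\qquad \|f\|_{B^\alpha_{p,q}([0,T])}=\Big(\int_0^T\Big(\frac{\Omega_p^f(t)}{t^\alpha}\Big)^q\frac{dt}{t}\Big)^{1/q},$$ with the usual modification for $p=\infty$ or $q=\infty$. For $\alpha>1/p$, $B^\alpha_{p,q}([0,T])$ is the set of continuous $f$ with finite seminorm (a function with finite seminorm is identified with its continuous representative). For an interval $I$, $V^rf_I=\sup_\pi(\sum_i|f(\pi_{i+1})-f(\pi_i)|^r)^{1/r}$ over finite increasing sequences $\pi$ in $I$. For $\beta\in(0,1]$, $\|\varphi\|_{C^\beta}=\sup_{x\ne y}|\varphi(x)-\varphi(y)|/|x-y|^\beta$; $C^{0,\beta}_b$ is the set of bounded $\varphi$ with $\|\varphi\|_{C^\beta}<\infty$, and $C^{1,\beta}_b$ the set of bounded differentiable $\varphi$ with $D\varphi\in C^{0,\beta}_b$. The Young integral $\int_a^b f\,dX$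 is the limit of the left-point Riemann sums $\sum_j f(\pi_j)(X(\pi_{j+1})-X(\pi_j))$ along the net of partitions of $[a,b]$ directed by refinement. A solution on $[0,\tau]$ of $dY=\varphi(Y)\,dX$, $Y_0=y_0$, is a path with $Y_t=y_0+\int_0^t\varphi(Y_s)\,dX_s$ for all $t\in[0,\tau]$, all these integrals existing. Theorem. Let $T>0$, $\alpha>\frac12$, $\beta\in(0,1]$ with $\frac1\alpha<1+\beta$, $p\in[1,\infty]$ with $\frac1\alpha<p$, and $q\in(0,\infty]$. (1) For all $n,d\in\mathbb N$, $X\in B^\alpha_{p,q}([0,T];\mathbb R^n)$ and $\varphi\in C^{1,\beta}_b(\mathbb R^d;L(\mathbb R^n,\mathbb R^d))$ there is $\tau\in(0,T]$ such that for every $y_0\in\mathbb R^d$ the Young equation $dY_t=\varphi(Y_t)\,dX_t$, $Y_0=y_0$, has a unique solution $Y\in B^\alpha_{p,q}([0,\tau];\mathbb R^d)$. (2) Let $r\in[1,2)$ with $\frac1\alpha<r\le p$ and $r<1+\beta$, and put $\theta=\frac{1+\beta}r$, $\zeta(\theta)=\sum_{k\ge1}k^{-\theta}$, $C_{\mathrm{sew}}=2^{\theta-1}\zeta(\theta)$.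 There is a constant $C$ depending only on $\alpha,\beta,p,q,r,T$ such that the following holds for all $n,d$. Let $X\in B^\alpha_{p,q}([0,T];\mathbb R^n)$, let $\Phi_0,\Phi_\beta,\Phi_1,\Phi_{1,\beta}>0$, let $\varphi\in C^{1,\beta}_b(\mathbb R^d;L(\mathbb R^n,\mathbb R^d))$ with $\|\varphi\|_{\sup}\le\Phi_0$, $\|\varphi\|_{C^\beta}\le\Phi_\beta$, $\|D\varphi\|_{\sup}\le\Phi_1$, $\|D\varphi\|_{C^\beta}\le\Phi_{1,\beta}$, and let $\epsilon>0$ satisfy $$2^\beta C_{\mathrm{sew}}\Phi_\beta\epsilon^\beta\le\Phi_0^{1-\beta},\qquad C_{\mathrm{sew}}\Phi_1\epsilon\le\tfrac18,\qquad C_{\mathrm{sew}}2^\beta\Phi_0^\beta\tfrac{\Phi_{1,\beta}}{1+\beta}\epsilon^{1+\beta}\le\tfrac18 .$$ Then $V^rX_{[0,\tau]}<\epsilon$ for some $\tau\in(0,T]$, and for every $\tau\in(0,T]$ with $V^rX_{[0,\tau]}<\epsilon$: (a) for every $y_0\in\mathbb R^d$ there is a solution $Y\in B^\alpha_{p,q}([0,\tau];\mathbb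 R^d)$ with $V^rY_{[0,\tau]}<\infty$, and it is the only solution among all paths that lie in $B^\alpha_{p,q}([0,\tau];\mathbb R^d)$ or have finite $r$-variation on $[0,\tau]$; (b) let $\tilde X\in B^\alpha_{p,q}([0,T];\mathbb R^n)$ with $V^r\tilde X_{[0,\tau]}<\epsilon$, let $\tilde\varphi\in C^{0,\beta}_b$ with $\|\tilde\varphi\|_{\sup}\le\Phi_0$, $\|\tilde\varphi\|_{C^\beta}\le\Phi_\beta$, let $y_0,\tilde y_0\in\mathbb R^d$, and let $Y,\tilde Y\in B^\alpha_{p,q}([0,\tau];\mathbb R^d)$ be solutions on $[0,\tau]$ for the data $(\varphi,X,y_0)$ and $(\tilde\varphi,\tilde X,\tilde y_0)$. With $\Delta Y=Y-\tilde Y$, $\Delta X=X-\tilde X$, $\Delta\varphi=\varphi-\tilde\varphi$ and all Besov seminorms taken on $[0,\tau]$, $$\|\Delta Y\|_{B^\alpha_{p,q}}\le C\big(\tilde\gamma\,\|X\|_{B^\alpha_{p,q}}+2\Phi_0\|\Delta X\|_{B^\alpha_{p,q}}\big),$$ where $$\tilde\gamma=\Big((C_{\mathrm{sew}}+1)\Phi_1+C_{\mathrm{sew}}2^{\beta+1}\tfrac{\Phi_{1,\beta}}{1+\beta}\Phi_0^\beta\epsilon^\beta\Big)\Phi_0\|\Delta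 X\|_{B^\alpha_{p,q}}+\Big(C_{\mathrm{sew}}2^{\beta+1}\tfrac{\Phi_{1,\beta}}{1+\beta}\Phi_0^\beta\epsilon^\beta+\Phi_1\Big)|y_0-\tilde y_0|+C_{\mathrm{sew}}2^\beta\Phi_0^\beta\epsilon^\beta\|\Delta\varphi\|_{C^\beta}+\|\Delta\varphi\|_{\sup}.$$ In particular $\|\Delta Y\|_{B^\alpha_{p,q}}\lesssim|y_0-\tilde y_0|+\|\Delta\varphi\|_{\sup}+\|\Delta\varphi\|_{C^\beta}+\|\Delta X\|_{B^\alpha_{p,q}}$, with a constant depending only on $C$, $C_{\mathrm{sew}}$, $\beta$, $\epsilon$, the bounds $\Phi_0,\Phi_1,\Phi_{1,\beta}$ and $\|X\|_{B^\alpha_{p,q}}$. -/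

import Mathlib

open MeasureTheory Set Filter Topology
open scoped NNReal ENNReal

noncomputable section

/-! ### Besov seminorms -/

/-- The modulus `Ω_p^χ(t) = sup_{0 < h ≤ t} ‖s ↦ χ(s, s + h)‖_{L^p(0, T - h)}` of a two-parameter
function `χ` on `{(s, t) : 0 ≤ s ≤ t ≤ T}`. -/
def besovModulus (p : ℝ≥0∞) (T : ℝ) (χ : ℝ → ℝ → ℝ≥0∞) (t : ℝ) : ℝ≥0∞ :=
  ⨆ h ∈ Ioc (0 : ℝ) t, eLpNorm (fun s => χ s (s + h)) p (volume.restrict (Ioc 0 (T - h)))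

/-- The measure `dt / t` on `(0, T]`. -/
def dtOverT (T : ℝ) : Measure ℝ :=
  (volume.restrict (Ioc 0 T)).withDensity fun t => ENNReal.ofReal t⁻¹

/-- The Besov norm `‖χ‖_{B^α_{p,q}} = ‖t ↦ t^{-α} Ω_p^χ(t)‖_{L^q((0, T]; dt / t)}` of a
two-parameter function. -/
def besovNorm₂ (α : ℝ) (p q : ℝ≥0∞) (T : ℝ) (χ : ℝ → ℝ → ℝ≥0∞) : ℝ≥0∞ :=
  eLpNorm (fun t => besovModulus p T χ t / ENNReal.ofReal (t ^ α)) q (dtOverT T)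

/-- The Besov (semi)norm on `[0, T]` of a path `f`, i.e. that of `(s, t) ↦ d(f(s), f(t))`. -/
def besovNorm {E : Type*} [PseudoEMetricSpace E]
    (α : ℝ) (p q : ℝ≥0∞) (T : ℝ) (f : ℝ → E) : ℝ≥0∞ :=
  besovNorm₂ α p q T fun s t => edist (f s) (f t)

/-- The path `f` belongs to `B^α_{p,q}([0, T])`. Since `α > 1 / p` throughout, every class of
a.e. equal functions with finite Besov seminorm has a unique continuous representative, with
which it is identified. -/
structure MemBesov {E : Type*} [PseudoEMetricSpace E]
    (α : ℝ) (p q : ℝ≥0∞) (T : ℝ) (f : ℝ → E) : Prop where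
  continuousOn : ContinuousOn f (Icc 0 T)
  besovNorm_lt_top : besovNorm α p q T f < ∞

/-! ### Variation -/

/-- The `r`-variation `V^r f_I = sup_π (∑_i d(f(π_i), f(π_{i+1}))^r)^{1/r}`, the supremum being over
finite increasing sequences in `I` (repeated points contribute nothing to the sum, as `r > 0`). -/
def rVariation {E : Type*} [PseudoEMetricSpace E] (r : ℝ) (f : ℝ → E) (I : Set ℝ) : ℝ≥0∞ :=
  ⨆ π : ℕ × {u : ℕ → ℝ // Monotone u ∧ ∀ i, u i ∈ I},
    (∑ i ∈ Finset.range π.1, edist (f (π.2.1 i)) (f (π.2.1 (i + 1))) ^ r) ^ (1 / r)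

/-! ### Young integral and Young differential equations -/

/-- Partitions of `[a, b]`, ordered by refinement (that is, by inclusion). -/
abbrev IntervalPartition (a b : ℝ) : Type :=
  {π : Finset ℝ // ↑π ⊆ Icc a b ∧ a ∈ π ∧ b ∈ π}

/-- The left-point Riemann sum `∑_j f(π_j) (X(π_{j+1}) - X(π_j))` along the points
`π_1 < π_2 < ⋯` of a finite set `π`. -/
def riemannSum {E F : Type*} [NormedAddCommGroup E] [NormedSpace ℝ E]
    [NormedAddCommGroup F] [NormedSpace ℝ F]
    (f : ℝ → E →L[ℝ] F) (X : ℝ → E) (π : Finset ℝ) : F :=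
  (List.zipWith (fun s t => f s (X t - X s)) π.sort π.sort.tail).sum

/-- `I = ∫_a^b f dX` as a Young integral: the Riemann sums converge to `I` as a net indexed by the
partitions of `[a, b]` directed by refinement. -/
def HasYoungIntegral {E F : Type*} [NormedAddCommGroup E] [NormedSpace ℝ E]
    [NormedAddCommGroup F] [NormedSpace ℝ F]
    (f : ℝ → E →L[ℝ] F) (X : ℝ → E) (a b : ℝ) (I : F) : Prop :=
  Tendsto (fun π : IntervalPartition a b => riemannSum f X π.1) atTop (𝓝 I)

/-- `Y_t = y₀ + ∫_0^t φ(Y_s) dX_s` for all `t ∈ [0, T]`, with existence of the integrals. -/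
def IsYoungSolution {E F : Type*} [NormedAddCommGroup E] [NormedSpace ℝ E]
    [NormedAddCommGroup F] [NormedSpace ℝ F]
    (φ : F → E →L[ℝ] F) (X : ℝ → E) (y₀ : F) (T : ℝ) (Y : ℝ → F) : Prop :=
  ∀ t ∈ Icc 0 T, HasYoungIntegral (fun s => φ (Y s)) X 0 t (Y t - y₀)

/-! ### Hölder classes -/

/-- `‖φ‖_sup`. -/
def eSupNorm {F G : Type*} [NormedAddCommGroup G] (φ : F → G) : ℝ≥0∞ := ⨆ x, ‖φ x‖ₑ

/-- `φ ∈ C^{0,β}_b` with `‖φ‖_sup ≤ Φ₀` and `‖φ‖_{C^β} ≤ Φβ`. -/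
structure HolderBound₀ {F G : Type*} [NormedAddCommGroup F] [NormedAddCommGroup G]
    (β Φ₀ Φβ : ℝ≥0) (φ : F → G) : Prop where
  sup_le : ∀ x, ‖φ x‖ ≤ Φ₀
  holder : HolderWith Φβ β φ

/-- `φ ∈ C^{1,β}_b` with `‖φ‖_sup ≤ Φ₀`, `‖φ‖_{C^β} ≤ Φβ`, `‖Dφ‖_sup ≤ Φ₁` and
`‖Dφ‖_{C^β} ≤ Φ₁β`. -/
structure HolderBound₁ {F G : Type*} [NormedAddCommGroup F] [NormedSpace ℝ F]
    [NormedAddCommGroup G] [NormedSpace ℝ G]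
    (β Φ₀ Φβ Φ₁ Φ₁β : ℝ≥0) (φ : F → G) : Prop extends HolderBound₀ β Φ₀ Φβ φ where
  differentiable : Differentiable ℝ φ
  fderiv_sup_le : ∀ x, ‖fderiv ℝ φ x‖ ≤ Φ₁
  fderiv_holder : HolderWith Φ₁β β (fderiv ℝ φ)

/-- `φ ∈ C^{1,β}_b`: `φ` is bounded and differentiable, and `Dφ` is bounded and `β`-Hölder. -/
def MemC1Holder {F G : Type*} [NormedAddCommGroup F] [NormedSpace ℝ F]
    [NormedAddCommGroup G] [NormedSpace ℝ G] (β : ℝ≥0) (φ : F → G) : Prop :=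
  Differentiable ℝ φ ∧ (∃ M : ℝ, ∀ x, ‖φ x‖ ≤ M) ∧ (∃ M : ℝ, ∀ x, ‖fderiv ℝ φ x‖ ≤ M) ∧
    ∃ M : ℝ≥0, HolderWith M β (fderiv ℝ φ)

/-! ### Constants -/

/-- `ζ(θ) = ∑_{k ≥ 1} k^{-θ}`. -/
def zetaSum (θ : ℝ) : ℝ≥0 := ∑' k : ℕ, ((k : ℝ≥0) + 1) ^ (-θ)

/-- The sewing constant `C_sew = 2^{θ - 1} ζ(θ)` with `θ = (1 + β) / r`. -/
def sewConst (β : ℝ≥0) (r : ℝ) : ℝ≥0 :=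
  2 ^ ((1 + β) / r - 1) * zetaSum ((1 + β) / r)

/-- The smallness conditions on `ε`. -/
structure IsSmall (β : ℝ≥0) (r : ℝ) (Φ₀ Φβ Φ₁ Φ₁β ε : ℝ≥0) : Prop where
  pos : 0 < ε
  apriori : 2 ^ (β : ℝ) * sewConst β r * Φβ * ε ^ (β : ℝ) ≤ Φ₀ ^ (1 - (β : ℝ))
  picard₁ : sewConst β r * Φ₁ * ε ≤ 1 / 8
  picard₂ : sewConst β r * 2 ^ (β : ℝ) * Φ₀ ^ (β : ℝ) * (Φ₁β / (1 + β)) * ε ^ (1 + (β : ℝ)) ≤ 1 / 8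

/-- The quantity `γ̃`, in terms of `x = ‖ΔX‖_{B^α_{p,q}}`, `y = |Δy₀|`, `a = ‖Δφ‖_{C^β}`
and `b = ‖Δφ‖_sup`. -/
def gammaTilde (β : ℝ≥0) (r : ℝ) (Φ₀ Φ₁ Φ₁β ε : ℝ≥0) (x y a b : ℝ≥0∞) : ℝ≥0∞ :=
  let Cs : ℝ≥0 := sewConst β r
  let K : ℝ≥0 := Cs * 2 ^ ((β : ℝ) + 1) * (Φ₁β / (1 + β)) * Φ₀ ^ (β : ℝ) * ε ^ (β : ℝ)
  let L : ℝ≥0 := Cs * 2 ^ (β : ℝ) * Φ₀ ^ (β : ℝ) * ε ^ (β : ℝ)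
  ((Cs + 1) * Φ₁ + K : ℝ≥0) * Φ₀ * x + (K + Φ₁ : ℝ≥0) * y + L * a + b

end

/-!
A Young equation is solved in two steps. The first is the theory in `r`-variation. The second
transfers it to the Besov scale, and rests on two comparisons between variations and Besov norms.

*Variation.* Young's inequality (`enorm_riemannSum_sub_le`) bounds a Riemann sum by successively
omitting the point whose removal changes it least. It gives existence of Young integrals
(`exists_hasYoungIntegral`) and the bound `IsYoungPrimitive.edist_sub_le` for the increments over
`[s, t]` of a difference of two indefinite integrals. The latter is *local*: it is a constant times
`V^r X_{[s, t]}` plus a constant times `V^r (X - X')_{[s, t]}`. The variation of `φ ∘ Y - φ ∘ Z` that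
enters the constant is controlled by a bound on the second differences of `φ ∈ C^{1,β}_b`. Under the
smallness conditions on `ε`, the Picard map sends the paths with `r`-variation at most `2 Φ₀ ε` to
themselves and halves distances, which gives existence (`exists_isYoungSolution`), uniqueness
(`IsYoungSolution.eqOn`) and stability (`IsYoungSolution.edist_sub_le`) in `r`-variation.

*From variation to Besov norms.* Since all the bounds are local, it suffices that the two-parameter
function `(s, t) ↦ V^r X_{[s, t]}` has Besov norm at most a constant times that of `X`
(`besovNorm₂_le`). The path `X` on `[s, s + h]` is the limit of its dyadic step functions, so
`V^r X_{[s, s + h]}` is at most the sum over `j` of the `ℓ^r` norms of the increments of `X` between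
the points of level `j` (`rVariation_le_tsum_dyadicSum`). As `r ≤ p`, the `L^p` norm in `s` of the
`j`-th term is at most `2^{j / r} Ω_p^X(h / 2^j)` (`eLpNorm_dyadicSum_le`). Since `1 / r < α`, the
sum over `j` is handled by a Hardy inequality for `dt / t` (`eLpNorm_tsum_dyadic_le`).

*Embedding.* The same pointwise bound of the modulus of `(s, t) ↦ V^r X_{[s, t]}` controls the
variation on an interval of length `l` with distance at least `l / 2` to the end points, by averaging
over larger intervals. A Whitney decomposition then yields
`V^r X_{[u, v]} ≤ C |v - u|^{α - 1 / p} ‖X‖_{B^α_{p,q}}` (`rVariation_le_besovNorm`). In particular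
Besov paths have finite `r`-variation, which is small on short intervals.
-/

noncomputable section

/-! ### Variation of two-parameter functions -/

/-- The `r`-variation on `I` of a two-parameter function `χ`, so that `rVariation r f I` is the case
`χ s t = edist (f s) (f t)`. The additional generality makes it possible to take the variation of
`(s, t) ↦ edist (f s) (f t) ^ β` and of `(s, t) ↦ rVariation r f (Icc s t)`. -/
def incVariation (r : ℝ) (χ : ℝ → ℝ → ℝ≥0∞) (I : Set ℝ) : ℝ≥0∞ :=
  ⨆ π : ℕ × {u : ℕ → ℝ // Monotone u ∧ ∀ i, u i ∈ I},
    (∑ i ∈ Finset.range π.1, χ (π.2.1 i) (π.2.1 (i + 1)) ^ r) ^ (1 / r)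

section Inc

variable {r a a' : ℝ} {χ χ' : ℝ → ℝ → ℝ≥0∞} {I J : Set ℝ}

theorem incVariation_le_iff (hr : 0 < r) {C : ℝ≥0∞} :
    incVariation r χ I ≤ C ↔ ∀ (n : ℕ) (u : ℕ → ℝ), Monotone u → (∀ i, u i ∈ I) →
      ∑ i ∈ Finset.range n, χ (u i) (u (i + 1)) ^ r ≤ C ^ r := by
  unfold incVariation
  rw [iSup_le_iff]
  constructor
  · intro h n u hu hI
    have := h ⟨n, u, hu, hI⟩
    rwa [one_div, ENNReal.rpow_inv_le_iff hr] at this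
  · rintro h ⟨n, u, hu, hI⟩
    rw [one_div, ENNReal.rpow_inv_le_iff hr]
    exact h n u hu hI

theorem sum_rpow_le_incVariation (hr : 0 < r) {u : ℕ → ℝ} (hu : Monotone u) (hI : ∀ i, u i ∈ I)
    (n : ℕ) : ∑ i ∈ Finset.range n, χ (u i) (u (i + 1)) ^ r ≤ incVariation r χ I ^ r :=
  (incVariation_le_iff hr).1 le_rfl n u hu hI

theorem le_incVariation (hr : 0 < r) {s t : ℝ} (hs : s ∈ I) (ht : t ∈ I) (hst : s ≤ t) :
    χ s t ≤ incVariation r χ I := by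
  have := sum_rpow_le_incVariation (χ := χ) (I := I) hr (u := fun i => if i = 0 then s else t)
    (by
      intro i j hij
      by_cases hi : i = 0 <;> by_cases hj : j = 0 <;> simp_all)
    (by intro i; by_cases hi : i = 0 <;> simp [hi, hs, ht]) 1
  simp only [Finset.range_one, Finset.sum_singleton, if_true, zero_add, one_ne_zero, if_false]
    at this
  exact (ENNReal.rpow_le_rpow_iff hr).1 this

theorem incVariation_mono (hr : 0 < r) (hIJ : I ⊆ J)
    (h : ∀ s ∈ I, ∀ t ∈ I, s ≤ t → χ s t ≤ χ' s t) : incVariation r χ I ≤ incVariation r χ' J := by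
  rw [incVariation_le_iff hr]
  intro n u hu hI
  refine le_trans ?_ (sum_rpow_le_incVariation hr hu (fun i => hIJ (hI i)) n)
  gcongr with i _
  exact h _ (hI i) _ (hI _) (hu (Nat.le_succ i))

theorem incVariation_add_le (hr : 1 ≤ r) :
    incVariation r (fun s t => χ s t + χ' s t) I ≤ incVariation r χ I + incVariation r χ' I := by
  refine iSup_le fun π => ?_
  refine (ENNReal.Lp_add_le _ _ _ hr).trans ?_
  exact add_le_add (le_iSup (fun π : ℕ × {u : ℕ → ℝ // Monotone u ∧ ∀ i, u i ∈ I} =>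
    (∑ i ∈ Finset.range π.1, χ (π.2.1 i) (π.2.1 (i + 1)) ^ r) ^ (1 / r)) π)
    (le_iSup (fun π : ℕ × {u : ℕ → ℝ // Monotone u ∧ ∀ i, u i ∈ I} =>
    (∑ i ∈ Finset.range π.1, χ' (π.2.1 i) (π.2.1 (i + 1)) ^ r) ^ (1 / r)) π)

theorem incVariation_const_mul_le (hr : 0 < r) (c : ℝ≥0∞) :
    incVariation r (fun s t => c * χ s t) I ≤ c * incVariation r χ I := by
  rw [incVariation_le_iff hr]
  intro n u hu hI
  simp_rw [ENNReal.mul_rpow_of_nonneg _ _ hr.le]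
  rw [← Finset.mul_sum]
  gcongr
  exact sum_rpow_le_incVariation hr hu hI n

theorem incVariation_rpow_le (hr : 0 < r) {b : ℝ} (hb : 0 < b) :
    incVariation (r / b) (fun s t => χ s t ^ b) I ≤ incVariation r χ I ^ b := by
  rw [incVariation_le_iff (by positivity)]
  intro n u hu hI
  simp_rw [← ENNReal.rpow_mul, mul_div_cancel₀ r hb.ne']
  exact sum_rpow_le_incVariation hr hu hI n

/-- Interpolation between the `a`-variation and a bound on the increments. -/
theorem incVariation_le_of_bounded (ha : 0 < a) (haa : a ≤ a') {M : ℝ≥0∞}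
    (hM : ∀ s ∈ I, ∀ t ∈ I, s ≤ t → χ s t ≤ M) :
    incVariation a' χ I ≤ M ^ (1 - a / a') * incVariation a χ I ^ (a / a') := by
  have ha' : 0 < a' := ha.trans_le haa
  rw [incVariation_le_iff ha']
  intro n u hu hI
  rw [ENNReal.mul_rpow_of_nonneg _ _ ha'.le, ← ENNReal.rpow_mul, ← ENNReal.rpow_mul,
    div_mul_cancel₀ _ ha'.ne', sub_mul, one_mul, div_mul_cancel₀ _ ha'.ne']
  calc ∑ i ∈ Finset.range n, χ (u i) (u (i + 1)) ^ a'
      ≤ ∑ i ∈ Finset.range n, M ^ (a' - a) * χ (u i) (u (i + 1)) ^ a := by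
        gcongr with i _
        rw [show a' = (a' - a) + a by ring, ENNReal.rpow_add_of_nonneg _ _ (by linarith) ha.le,
          show (a' - a) + a - a = a' - a by ring]
        gcongr
        exact hM _ (hI i) _ (hI _) (hu (Nat.le_succ i))
    _ ≤ _ := by
        rw [← Finset.mul_sum]
        gcongr
        exact sum_rpow_le_incVariation ha hu hI n

theorem incVariation_anti (ha : 0 < a) (haa : a ≤ a') :
    incVariation a' χ I ≤ incVariation a χ I := by
  refine (incVariation_le_of_bounded ha haa
    (fun s hs t ht hst => le_incVariation ha hs ht hst)).trans ?_
  have ha' : 0 < a' := ha.trans_le haa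
  rw [← ENNReal.rpow_add_of_nonneg _ _ (sub_nonneg.2 ((div_le_one ha').2 haa)) (by positivity)]
  simp

theorem incVariation_rpow_eq (hr : 0 < r) :
    incVariation r χ I ^ r = ⨆ π : ℕ × {u : ℕ → ℝ // Monotone u ∧ ∀ i, u i ∈ I},
      ∑ i ∈ Finset.range π.1, χ (π.2.1 i) (π.2.1 (i + 1)) ^ r := by
  unfold incVariation
  have := (ENNReal.orderIsoRpow r hr).map_iSup (fun π : ℕ × {u : ℕ → ℝ // Monotone u ∧ ∀ i, u i ∈ I}
    => (∑ i ∈ Finset.range π.1, χ (π.2.1 i) (π.2.1 (i + 1)) ^ r) ^ (1 / r))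
  simp only [ENNReal.orderIsoRpow_apply] at this
  rw [this]
  refine iSup_congr fun π => ?_
  rw [← ENNReal.rpow_mul, one_div_mul_cancel hr.ne', ENNReal.rpow_one]

/-- Superadditivity in the interval, by concatenating sequences in the two intervals. -/
theorem incVariation_superadd (hr : 0 < r) {x y z : ℝ} (hxy : x ≤ y) (hyz : y ≤ z) :
    incVariation r χ (Icc x y) ^ r + incVariation r χ (Icc y z) ^ r ≤
      incVariation r χ (Icc x z) ^ r := by
  rw [incVariation_rpow_eq (I := Icc x y) hr, incVariation_rpow_eq (I := Icc y z) hr]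
  have hne : ∀ v w : ℝ, v ≤ w →
      Nonempty (ℕ × {u : ℕ → ℝ // Monotone u ∧ ∀ i, u i ∈ Icc v w}) := fun v w h =>
    ⟨⟨0, fun _ => v, monotone_const, fun _ => ⟨le_rfl, h⟩⟩⟩
  have := hne x y hxy
  have := hne y z hyz
  refine ENNReal.iSup_add_iSup_le ?_
  rintro ⟨n, u, hu, huI⟩ ⟨m, v, hv, hvI⟩
  set w : ℕ → ℝ := fun i => if i ≤ n then u i else v (i - (n + 1)) with hw
  have hwm : Monotone w := by
    intro i j hij
    simp only [hw]
    split_ifs with h1 h2 h2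
    · exact hu hij
    · exact (huI i).2.trans (hvI _).1
    · omega
    · exact hv (by omega)
  have hwI : ∀ i, w i ∈ Icc x z := by
    intro i
    simp only [hw]
    split_ifs
    · exact ⟨(huI i).1, (huI i).2.trans hyz⟩
    · exact ⟨hxy.trans (hvI _).1, (hvI _).2⟩
  refine le_trans ?_ (sum_rpow_le_incVariation hr hwm hwI (n + 1 + m))
  rw [Finset.sum_range_add, Finset.sum_range_succ]
  refine add_le_add (le_trans (le_of_eq ?_) le_self_add) (le_of_eq ?_)
  · refine Finset.sum_congr rfl fun i hi => ?_
    have := Finset.mem_range.1 hi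
    simp only [hw]
    rw [if_pos (by omega), if_pos (by omega)]
  · refine Finset.sum_congr rfl fun i hi => ?_
    simp only [hw]
    rw [if_neg (by omega), if_neg (by omega)]
    congr 3 <;> omega

/-- Superadditivity of `(s, t) ↦ V^r_{[s, t]}^r`: the `r`-variation of `(s, t) ↦ V^r_{[s, t]}` is
the one of the original function. -/
theorem incVariation_incVariation_le (hr : 0 < r) [hI : OrdConnected I] :
    incVariation r (fun s t => incVariation r χ (Icc s t)) I ≤ incVariation r χ I := by
  rw [incVariation_le_iff hr]
  intro n u hu hu'
  have key : ∀ n, ∑ i ∈ Finset.range n, incVariation r χ (Icc (u i) (u (i + 1))) ^ r ≤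
      incVariation r χ (Icc (u 0) (u n)) ^ r := by
    intro n
    induction n with
    | zero => simp
    | succ n ih =>
      rw [Finset.sum_range_succ]
      exact (add_le_add_left ih _).trans
        (incVariation_superadd hr (hu (Nat.zero_le n)) (hu (Nat.le_succ n)))
  refine (key n).trans ?_
  gcongr
  exact incVariation_mono hr (hI.out (hu' 0) (hu' n)) fun _ _ _ _ _ => le_rfl

end Inc

/-! ### Variation of paths -/

section Path

variable {E : Type*} {r : ℝ} {I J : Set ℝ}

theorem rVariation_eq_incVariation [PseudoEMetricSpace E] (f : ℝ → E) :
    rVariation r f I = incVariation r (fun s t => edist (f s) (f t)) I := rfl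

theorem edist_le_rVariation [PseudoEMetricSpace E] {f : ℝ → E} (hr : 0 < r) {s t : ℝ}
    (hs : s ∈ I) (ht : t ∈ I) : edist (f s) (f t) ≤ rVariation r f I := by
  rw [rVariation_eq_incVariation]
  rcases le_total s t with h | h
  · exact le_incVariation (χ := fun s t => edist (f s) (f t)) hr hs ht h
  · rw [edist_comm]
    exact le_incVariation (χ := fun s t => edist (f s) (f t)) hr ht hs h

theorem rVariation_mono [PseudoEMetricSpace E] {f : ℝ → E} (hr : 0 < r) (h : I ⊆ J) :
    rVariation r f I ≤ rVariation r f J := by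
  simp only [rVariation_eq_incVariation]
  exact incVariation_mono hr h fun _ _ _ _ _ => le_rfl

theorem rVariation_congr [PseudoEMetricSpace E] {f g : ℝ → E} (h : EqOn f g I) :
    rVariation r f I = rVariation r g I := by
  unfold rVariation
  refine iSup_congr fun π => ?_
  congr 1
  refine Finset.sum_congr rfl fun i _ => ?_
  rw [h (π.2.2.2 i), h (π.2.2.2 (i + 1))]

theorem rVariation_comp_le [PseudoEMetricSpace E] {f : ℝ → E} {m : ℝ → ℝ} (hr : 0 < r)
    (hm : MonotoneOn m I) (hmJ : MapsTo m I J) : rVariation r (f ∘ m) I ≤ rVariation r f J := by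
  rw [rVariation_eq_incVariation, incVariation_le_iff hr]
  intro n u hu hI
  exact sum_rpow_le_incVariation (χ := fun s t => edist (f s) (f t)) (u := m ∘ u) hr
    (fun i j hij => hm (hI i) (hI j) (hu hij)) (fun i => hmJ (hI i)) n

theorem rVariation_add_le [SeminormedAddCommGroup E] {f g : ℝ → E} (hr : 1 ≤ r) :
    rVariation r (f + g) I ≤ rVariation r f I + rVariation r g I := by
  simp only [rVariation_eq_incVariation]
  refine le_trans ?_ (incVariation_add_le hr)
  refine incVariation_mono (by linarith) Subset.rfl fun s _ t _ _ => ?_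
  exact edist_add_add_le _ _ _ _

theorem rVariation_sub_le [SeminormedAddCommGroup E] {f g : ℝ → E} (hr : 1 ≤ r) :
    rVariation r (f - g) I ≤ rVariation r f I + rVariation r g I := by
  rw [sub_eq_add_neg]
  refine (rVariation_add_le hr).trans (le_of_eq ?_)
  simp [rVariation_eq_incVariation]

theorem rVariation_sum_le [SeminormedAddCommGroup E] {f : ℕ → ℝ → E} (hr : 1 ≤ r) (n : ℕ) :
    rVariation r (∑ j ∈ Finset.range n, f j) I ≤ ∑ j ∈ Finset.range n, rVariation r (f j) I := by
  induction n with
  | zero =>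
    have hr0 : 0 < r := by linarith
    rw [rVariation_eq_incVariation, incVariation_le_iff hr0]
    simp [hr0]
  | succ n ih =>
    rw [Finset.sum_range_succ, Finset.sum_range_succ]
    exact (rVariation_add_le hr).trans (add_le_add_left ih _)

/-- Lower semicontinuity of the variation under pointwise convergence. -/
theorem rVariation_le_of_tendsto [PseudoEMetricSpace E] {ι : Type*} {l : Filter ι} [l.NeBot]
    {f : ι → ℝ → E} {g : ℝ → E} {C : ℝ≥0∞} (hr : 0 < r)
    (h : ∀ t ∈ I, Tendsto (fun i => f i t) l (𝓝 (g t)))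
    (hC : ∀ᶠ i in l, rVariation r (f i) I ≤ C) : rVariation r g I ≤ C := by
  rw [rVariation_eq_incVariation, incVariation_le_iff hr]
  intro n u hu hI
  have : Tendsto (fun j => ∑ i ∈ Finset.range n, edist (f j (u i)) (f j (u (i + 1))) ^ r) l
      (𝓝 (∑ i ∈ Finset.range n, edist (g (u i)) (g (u (i + 1))) ^ r)) := by
    refine tendsto_finsetSum _ fun i _ => ?_
    exact ((h _ (hI i)).edist (h _ (hI _))).ennrpow_const r
  refine le_of_tendsto this (hC.mono fun j hj => ?_)
  rw [rVariation_eq_incVariation, incVariation_le_iff hr] at hj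
  exact hj n u hu hI

theorem rVariation_holder_comp_le {F : Type*} [PseudoEMetricSpace E] [PseudoEMetricSpace F]
    {φ : E → F} {C β : ℝ≥0} (hφ : HolderWith C β φ) (hβ : 0 < β) (hr : 0 < r) {f : ℝ → E} :
    rVariation (r / β) (φ ∘ f) I ≤ C * rVariation r f I ^ (β : ℝ) := by
  have hβ' : (0 : ℝ) < β := by exact_mod_cast hβ
  have hrβ : 0 < r / β := by positivity
  simp only [rVariation_eq_incVariation]
  refine le_trans (incVariation_mono (χ' := fun s t => C * edist (f s) (f t) ^ (β : ℝ)) hrβ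
    Subset.rfl fun s _ t _ _ => hφ _ _) ((incVariation_const_mul_le hrβ C).trans ?_)
  gcongr
  exact incVariation_rpow_le (χ := fun s t => edist (f s) (f t)) hr hβ'

/-- A path whose increments are dominated by the variations of two paths on the same interval
is dominated in variation. -/
theorem rVariation_le_of_edist_le {E₁ E₂ : Type*} [PseudoEMetricSpace E] [PseudoEMetricSpace E₁]
    [PseudoEMetricSpace E₂] {Y : ℝ → E} {f : ℝ → E₁} {g : ℝ → E₂} (hr : 1 ≤ r)
    [OrdConnected I] {c d : ℝ≥0∞}
    (h : ∀ s ∈ I, ∀ t ∈ I, s ≤ t →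
      edist (Y s) (Y t) ≤ c * rVariation r f (Icc s t) + d * rVariation r g (Icc s t)) :
    rVariation r Y I ≤ c * rVariation r f I + d * rVariation r g I := by
  have hr0 : 0 < r := by linarith
  simp only [rVariation_eq_incVariation] at h ⊢
  refine (incVariation_mono hr0 Subset.rfl h).trans ((incVariation_add_le hr).trans ?_)
  refine add_le_add ?_ ?_
  · refine (incVariation_const_mul_le hr0 c).trans ?_
    gcongr
    exact incVariation_incVariation_le hr0
  · refine (incVariation_const_mul_le hr0 d).trans ?_
    gcongr
    exact incVariation_incVariation_le hr0

/-- Subadditivity of the variation in the interval, from the decomposition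
`f = f (min · y) + f (max · y) - f y`. -/
theorem rVariation_Icc_le_add [SeminormedAddCommGroup E] {f : ℝ → E} (hr : 1 ≤ r) {x y z : ℝ}
    (hxy : x ≤ y) (hyz : y ≤ z) :
    rVariation r f (Icc x z) ≤ rVariation r f (Icc x y) + rVariation r f (Icc y z) := by
  have hr0 : 0 < r := by linarith
  set g : ℝ → E := f ∘ (fun t => min t y) with hg
  set h : ℝ → E := (fun t => f t - f y) ∘ (fun t => max t y) with hh
  have hfg : f = g + h := by
    ext t
    simp only [hg, hh, Pi.add_apply, Function.comp]
    rcases le_total t y with h | h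
    · simp [h]
    · simp [h]
  have h1 : rVariation r g (Icc x z) ≤ rVariation r f (Icc x y) :=
    rVariation_comp_le hr0 (fun s _ t _ hst => min_le_min_right y hst)
      fun t ht => ⟨le_min ht.1 hxy, min_le_right _ _⟩
  have h2 : rVariation r h (Icc x z) ≤ rVariation r f (Icc y z) := by
    refine (rVariation_comp_le hr0 (fun s _ t _ hst => max_le_max_right y hst)
      (J := Icc y z) fun t ht => ⟨le_max_right _ _, max_le ht.2 hyz⟩).trans (le_of_eq ?_)
    simp [rVariation_eq_incVariation]
  calc rVariation r f (Icc x z) = rVariation r (g + h) (Icc x z) := by rw [← hfg]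
    _ ≤ _ := (rVariation_add_le hr).trans (add_le_add h1 h2)

end Path

/-! ### Young's inequality for finite sums -/

/-- The minimum of finitely many products is at most their geometric mean, which Hölder's
inequality bounds in terms of the two power sums. -/
theorem exists_mul_le_of_sum_rpow_le {a b : ℝ} (ha : 0 < a) (hb : 0 < b) {N : ℕ} (hN : 0 < N)
    {x y : ℕ → ℝ≥0∞} {A B : ℝ≥0∞} (hx : ∑ i ∈ Finset.range N, x i ^ a ≤ A ^ a)
    (hy : ∑ i ∈ Finset.range N, y i ^ b ≤ B ^ b) :
    ∃ i < N, x i * y i ≤ (N : ℝ≥0∞) ^ (-(1 / a + 1 / b)) * (A * B) := by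
  set θ : ℝ := 1 / a + 1 / b with hθ
  have hθ0 : 0 < θ := by positivity
  have hconj : (a * θ).HolderConjugate (b * θ) := by
    rw [Real.holderConjugate_iff]
    constructor
    · rw [hθ, mul_add, mul_one_div_cancel ha.ne']
      have : 0 < a * (1 / b) := by positivity
      linarith
    · rw [hθ]; field_simp
  have hN0 : (N : ℝ≥0∞) ≠ 0 := by exact_mod_cast hN.ne'
  have hNt : (N : ℝ≥0∞) ≠ ∞ := ENNReal.natCast_ne_top N
  have hsum : ∑ i ∈ Finset.range N, (x i * y i) ^ (1 / θ) ≤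
      ∑ _i ∈ Finset.range N, (N : ℝ≥0∞)⁻¹ * (A * B) ^ (1 / θ) := by
    rw [Finset.sum_const, Finset.card_range, nsmul_eq_mul, ← mul_assoc,
      ENNReal.mul_inv_cancel hN0 hNt, one_mul]
    simp_rw [ENNReal.mul_rpow_of_nonneg _ _ (one_div_pos.2 hθ0).le]
    refine (ENNReal.inner_le_Lp_mul_Lq _ _ _ hconj).trans ?_
    simp_rw [← ENNReal.rpow_mul]
    have e1 : 1 / θ * (a * θ) = a := by field_simp
    have e2 : 1 / θ * (b * θ) = b := by field_simp
    rw [e1, e2]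
    refine mul_le_mul' ?_ ?_
    · refine (ENNReal.rpow_le_rpow hx (by positivity)).trans (le_of_eq ?_)
      rw [← ENNReal.rpow_mul]
      congr 1
      field_simp
    · refine (ENNReal.rpow_le_rpow hy (by positivity)).trans (le_of_eq ?_)
      rw [← ENNReal.rpow_mul]
      congr 1
      field_simp
  obtain ⟨i, hi, h⟩ := ENNReal.exists_le_of_sum_le (Finset.nonempty_range_iff.2 hN.ne') hsum
  refine ⟨i, Finset.mem_range.1 hi, ?_⟩
  rw [one_div, ENNReal.rpow_inv_le_iff hθ0, ENNReal.mul_rpow_of_nonneg _ _ hθ0.le,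
    ← ENNReal.rpow_mul, inv_mul_cancel₀ hθ0.ne', ENNReal.rpow_one, ← ENNReal.rpow_neg_one,
    ← ENNReal.rpow_mul] at h
  simpa using h

variable {E F : Type*} [NormedAddCommGroup E] [NormedSpace ℝ E] [NormedAddCommGroup F]
  [NormedSpace ℝ F]

/-- The effect on a left-point sum of omitting the point with index `i + 1`. -/
theorem leftSum_remove (f : ℝ → E →L[ℝ] F) (X : ℝ → E) (u : ℕ → ℝ) {n i : ℕ} (hi : i < n + 1) :
    ∑ k ∈ Finset.range (n + 2), f (u k) (X (u (k + 1)) - X (u k)) =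
      ∑ k ∈ Finset.range (n + 1), f (u (if k ≤ i then k else k + 1))
        (X (u (if k + 1 ≤ i then k + 1 else k + 1 + 1)) - X (u (if k ≤ i then k else k + 1))) +
      (f (u (i + 1)) - f (u i)) (X (u (i + 2)) - X (u (i + 1))) := by
  obtain ⟨m, rfl⟩ : ∃ m, n = i + m := ⟨n - i, by omega⟩
  rw [show i + m + 2 = i + (1 + (1 + m)) by ring, show i + m + 1 = i + (1 + m) by ring]
  simp only [Finset.sum_range_add, Finset.sum_range_one, add_zero]
  have h1 : ∑ k ∈ Finset.range i, f (u (if k ≤ i then k else k + 1))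
        (X (u (if k + 1 ≤ i then k + 1 else k + 1 + 1)) - X (u (if k ≤ i then k else k + 1))) =
      ∑ k ∈ Finset.range i, f (u k) (X (u (k + 1)) - X (u k)) := by
    refine Finset.sum_congr rfl fun k hk => ?_
    have := Finset.mem_range.1 hk
    rw [if_pos (by omega), if_pos (by omega)]
  have h2 : ∑ k ∈ Finset.range m, f (u (if i + (1 + k) ≤ i then i + (1 + k) else i + (1 + k) + 1))
        (X (u (if i + (1 + k) + 1 ≤ i then i + (1 + k) + 1 else i + (1 + k) + 1 + 1)) -
          X (u (if i + (1 + k) ≤ i then i + (1 + k) else i + (1 + k) + 1))) =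
      ∑ k ∈ Finset.range m, f (u (i + (1 + (1 + k))))
        (X (u (i + (1 + (1 + k)) + 1)) - X (u (i + (1 + (1 + k))))) := by
    refine Finset.sum_congr rfl fun k hk => ?_
    rw [if_neg (by omega), if_neg (by omega),
      show i + (1 + k) + 1 = i + (1 + (1 + k)) by ring]
  rw [h1, h2, if_pos le_rfl, if_neg (by omega), sub_apply]
  have h3 : X (u (i + 1 + 1)) - X (u i) =
    (X (u (i + 1 + 1)) - X (u (i + 1))) + (X (u (i + 1)) - X (u i)) := by abel
  rw [h3, map_add]
  abel

/-- Young's inequality for left-point sums, by successive omission of the point whose removal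
changes the sum least. -/
theorem enorm_leftSum_sub_le {a b : ℝ} (ha : 0 < a) (hb : 0 < b) {f : ℝ → E →L[ℝ] F} {X : ℝ → E}
    {I : Set ℝ} (n : ℕ) (u : ℕ → ℝ) (hu : Monotone u) (hI : ∀ i, u i ∈ I) :
    ‖∑ k ∈ Finset.range n, f (u k) (X (u (k + 1)) - X (u k)) - f (u 0) (X (u n) - X (u 0))‖ₑ ≤
      (∑ k ∈ Finset.range (n - 1), ((k : ℝ≥0∞) + 1) ^ (-(1 / a + 1 / b))) *
        (rVariation a f I * rVariation b X I) := by
  induction n generalizing u with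
  | zero => simp
  | succ n ih =>
    cases n with
    | zero => simp
    | succ n =>
      obtain ⟨i, hi, hle⟩ := exists_mul_le_of_sum_rpow_le ha hb (Nat.succ_pos n)
        (x := fun i => edist (f (u i)) (f (u (i + 1))))
        (y := fun i => edist (X (u (i + 1))) (X (u (i + 1 + 1))))
        (sum_rpow_le_incVariation (χ := fun s t => edist (f s) (f t)) ha hu hI (n + 1))
        (sum_rpow_le_incVariation (χ := fun s t => edist (X s) (X t)) hb
          (u := fun i => u (i + 1)) (fun i j hij => hu (by omega)) (fun i => hI _) (n + 1))
      have hσ : Monotone fun k : ℕ => if k ≤ i then k else k + 1 := by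
        intro k l hkl
        dsimp only
        split_ifs <;> omega
      have h1 := ih (fun k => u (if k ≤ i then k else k + 1)) (fun k l hkl => hu (hσ hkl))
        (fun k => hI _)
      simp only [Nat.zero_le, if_true] at h1
      rw [if_neg (show ¬ n + 1 ≤ i by omega)] at h1
      rw [leftSum_remove f X u hi, add_sub_right_comm]
      refine (enorm_add_le _ _).trans ?_
      simp only [Nat.add_sub_cancel] at h1 ⊢
      rw [Finset.sum_range_succ (fun k : ℕ => ((k : ℝ≥0∞) + 1) ^ (-(1 / a + 1 / b))), add_mul]
      refine add_le_add h1 ?_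
      refine le_trans ?_ (le_trans hle (le_of_eq ?_))
      · refine (ContinuousLinearMap.le_opENorm _ _).trans (le_of_eq ?_)
        rw [edist_comm, edist_eq_enorm_sub, edist_comm, edist_eq_enorm_sub]
      · push_cast; rfl

/-! ### Riemann sums -/

/-- The value of `riemannSum` in terms of the list of points. -/
def listSum (f : ℝ → E →L[ℝ] F) (X : ℝ → E) (l : List ℝ) : F :=
  (List.zipWith (fun s t => f s (X t - X s)) l l.tail).sum

theorem riemannSum_eq_listSum (f : ℝ → E →L[ℝ] F) (X : ℝ → E) (π : Finset ℝ) :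
    riemannSum f X π = listSum f X π.sort := rfl

theorem listSum_cons_cons (f : ℝ → E →L[ℝ] F) (X : ℝ → E) (x y : ℝ) (l : List ℝ) :
    listSum f X (x :: y :: l) = f x (X y - X x) + listSum f X (y :: l) := by
  simp [listSum]

theorem listSum_singleton (f : ℝ → E →L[ℝ] F) (X : ℝ → E) (x : ℝ) : listSum f X [x] = 0 := by
  simp [listSum]

theorem listSum_append (f : ℝ → E →L[ℝ] F) (X : ℝ → E) (l₁ : List ℝ) (x : ℝ) (l₂ : List ℝ) :
    listSum f X (l₁ ++ x :: l₂) = listSum f X (l₁ ++ [x]) + listSum f X (x :: l₂) := by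
  induction l₁ with
  | nil => simp [listSum_singleton]
  | cons y l ih =>
    cases l with
    | nil => simp [listSum_cons_cons, listSum_singleton]
    | cons z l =>
      simp only [List.cons_append, listSum_cons_cons] at ih ⊢
      rw [ih, add_assoc]

theorem listSum_congr {f g : ℝ → E →L[ℝ] F} {X Z : ℝ → E} {l : List ℝ} (h : ∀ x ∈ l, f x = g x)
    (hX : ∀ x ∈ l, X x = Z x) : listSum f X l = listSum g Z l := by
  induction l with
  | nil => rfl
  | cons x l ih =>
    cases l with
    | nil => simp [listSum_singleton]
    | cons y l =>
      rw [listSum_cons_cons, listSum_cons_cons,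
        ih (fun x hx => h x (by simp_all)) (fun x hx => hX x (by simp_all)), h x (by simp),
        hX x (by simp), hX y (by simp)]

theorem listSum_eq_sum_range (f : ℝ → E →L[ℝ] F) (X : ℝ → E) (l : List ℝ) (d : ℝ) :
    listSum f X l = ∑ k ∈ Finset.range (l.length - 1),
      f (l.getD k d) (X (l.getD (k + 1) d) - X (l.getD k d)) := by
  induction l with
  | nil => simp [listSum]
  | cons x l ih =>
    cases l with
    | nil => simp [listSum_singleton]
    | cons y l =>
      rw [listSum_cons_cons, ih]
      simp only [List.length_cons, Nat.add_sub_cancel]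
      rw [Finset.sum_range_succ', add_comm]
      simp

theorem riemannSum_congr {f g : ℝ → E →L[ℝ] F} {X Z : ℝ → E} {π : Finset ℝ}
    (h : ∀ x ∈ π, f x = g x) (hX : ∀ x ∈ π, X x = Z x) : riemannSum f X π = riemannSum g Z π :=
  listSum_congr (fun x hx => h x (by simpa using hx)) (fun x hx => hX x (by simpa using hx))

theorem riemannSum_sub_left (f g : ℝ → E →L[ℝ] F) (X : ℝ → E) (π : Finset ℝ) :
    riemannSum (f - g) X π = riemannSum f X π - riemannSum g X π := by
  simp_rw [riemannSum_eq_listSum, listSum_eq_sum_range _ _ _ 0, ← Finset.sum_sub_distrib]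
  simp

theorem riemannSum_sub_right (f : ℝ → E →L[ℝ] F) (X Z : ℝ → E) (π : Finset ℝ) :
    riemannSum f (X - Z) π = riemannSum f X π - riemannSum f Z π := by
  simp_rw [riemannSum_eq_listSum, listSum_eq_sum_range _ _ _ 0, ← Finset.sum_sub_distrib,
    ← map_sub]
  refine Finset.sum_congr rfl fun k _ => ?_
  congr 1
  simp only [Pi.sub_apply]
  abel

theorem riemannSum_singleton (f : ℝ → E →L[ℝ] F) (X : ℝ → E) (x : ℝ) :
    riemannSum f X {x} = 0 := by
  simp [riemannSum]

/-- Additivity of Riemann sums in the interval. -/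
theorem riemannSum_split (f : ℝ → E →L[ℝ] F) (X : ℝ → E) {π : Finset ℝ} {s : ℝ} (hs : s ∈ π) :
    riemannSum f X π = riemannSum f X (π.filter (· ≤ s)) + riemannSum f X (π.filter (s ≤ ·)) := by
  have aux : ∀ (σ : Finset ℝ) (l : List ℝ), l.Pairwise (· < ·) → (∀ x, x ∈ l ↔ x ∈ σ) →
      σ.sort = l := by
    intro σ l hl h
    have : l.toFinset = σ := by ext x; simp [h]
    rw [← this]
    exact (List.toFinset_sort (· ≤ ·) (hl.imp (fun h => h.ne))).2 (hl.imp fun h => h.le)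
  set l₁ := (π.filter (· < s)).sort
  set l₂ := (π.filter (s < ·)).sort
  have m₁ : ∀ x, x ∈ l₁ ↔ x ∈ π ∧ x < s := by simp [l₁]
  have m₂ : ∀ x, x ∈ l₂ ↔ x ∈ π ∧ s < x := by simp [l₂]
  have p₁ : l₁.Pairwise (· < ·) := (Finset.sortedLT_sort _).pairwise
  have p₂ : l₂.Pairwise (· < ·) := (Finset.sortedLT_sort _).pairwise
  simp only [riemannSum_eq_listSum]
  rw [aux π (l₁ ++ s :: l₂), aux (π.filter (· ≤ s)) (l₁ ++ [s]), aux (π.filter (s ≤ ·)) (s :: l₂),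
    listSum_append]
  · rw [List.pairwise_cons]
    exact ⟨fun x hx => ((m₂ x).1 hx).2, p₂⟩
  · intro x
    simp only [List.mem_cons, m₂, Finset.mem_filter, le_iff_eq_or_lt]
    grind
  · rw [List.pairwise_append]
    exact ⟨p₁, by simp, fun x hx y hy => by simp_all⟩
  · intro x
    simp only [List.mem_append, List.mem_singleton, m₁, Finset.mem_filter, le_iff_eq_or_lt]
    grind
  · rw [List.pairwise_append, List.pairwise_cons]
    refine ⟨p₁, ⟨fun x hx => ((m₂ x).1 hx).2, p₂⟩, fun x hx y hy => ?_⟩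
    have := ((m₁ x).1 hx).2
    rcases List.mem_cons.1 hy with rfl | hy
    · exact this
    · exact this.trans ((m₂ y).1 hy).2
  · intro x
    simp only [List.mem_append, List.mem_cons, m₁, m₂]
    grind

theorem riemannSum_pair (f : ℝ → E →L[ℝ] F) (X : ℝ → E) {x y : ℝ} (h : x < y) :
    riemannSum f X {x, y} = f x (X y - X x) := by
  have : Finset.sort {x, y} = [x, y] := by
    have h1 : ({x, y} : Finset ℝ) = [x, y].toFinset := by ext; simp
    rw [h1]
    exact (List.toFinset_sort (· ≤ ·) (by simp [h.ne])).2 (by simp [h.le])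
  simp [riemannSum_eq_listSum, this, listSum_cons_cons, listSum_singleton]

/-- The effect on a Riemann sum of a new point `x` between adjacent points `y` and `z`. -/
theorem riemannSum_insert (f : ℝ → E →L[ℝ] F) (X : ℝ → E) {π : Finset ℝ} {x y z : ℝ}
    (hy : y ∈ π) (hz : z ∈ π) (hyx : y < x) (hxz : x < z) (h : ∀ w ∈ π, w ≤ y ∨ z ≤ w) :
    riemannSum f X (insert x π) = riemannSum f X π + (f x - f y) (X z - X x) := by
  rw [riemannSum_split f X (Finset.mem_insert_of_mem (b := x) hy), riemannSum_split f X hy,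
    riemannSum_split f X (π := (insert x π).filter (y ≤ ·)) (s := x) (by simp [hyx.le]),
    riemannSum_split f X (π := ((insert x π).filter (y ≤ ·)).filter (x ≤ ·)) (s := z)
      (by simp [hz, hxz.le, (hyx.trans hxz).le]),
    riemannSum_split f X (π := π.filter (y ≤ ·)) (s := z) (by simp [hz, (hyx.trans hxz).le])]
  have e1 : (insert x π).filter (· ≤ y) = π.filter (· ≤ y) := by
    ext w; simp only [Finset.mem_filter, Finset.mem_insert]; grind
  have e2 : ((insert x π).filter (y ≤ ·)).filter (· ≤ x) = {y, x} := by
    ext w; simp only [Finset.mem_filter, Finset.mem_insert, Finset.mem_singleton]; grind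
  have e3 : (((insert x π).filter (y ≤ ·)).filter (x ≤ ·)).filter (· ≤ z) = {x, z} := by
    ext w; simp only [Finset.mem_filter, Finset.mem_insert, Finset.mem_singleton]; grind
  have e4 : (((insert x π).filter (y ≤ ·)).filter (x ≤ ·)).filter (z ≤ ·) =
      (π.filter (y ≤ ·)).filter (z ≤ ·) := by
    ext w; simp only [Finset.mem_filter, Finset.mem_insert]; grind
  have e5 : (π.filter (y ≤ ·)).filter (· ≤ z) = {y, z} := by
    ext w; simp only [Finset.mem_filter, Finset.mem_insert, Finset.mem_singleton]; grind
  rw [e1, e2, e3, e4, e5, riemannSum_pair f X hyx, riemannSum_pair f X hxz,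
    riemannSum_pair f X (hyx.trans hxz), sub_apply]
  have h3 : X z - X y = (X z - X x) + (X x - X y) := by abel
  rw [h3, map_add]
  abel

/-! ### Young's inequality -/

theorem summable_zetaSum {θ : ℝ} (hθ : 1 < θ) :
    Summable fun k : ℕ => ((k : ℝ≥0) + 1) ^ (-θ) := by
  have := (NNReal.summable_rpow (p := -θ)).2 (by linarith)
  have := (NNReal.summable_nat_add_iff 1).2 this
  simpa using this

theorem sum_le_zetaSum {θ : ℝ} (hθ : 1 < θ) (n : ℕ) :
    ∑ k ∈ Finset.range n, ((k : ℝ≥0∞) + 1) ^ (-θ) ≤ zetaSum θ := by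
  have h : ∑ k ∈ Finset.range n, ((k : ℝ≥0∞) + 1) ^ (-θ) =
      ((∑ k ∈ Finset.range n, ((k : ℝ≥0) + 1) ^ (-θ) : ℝ≥0) : ℝ≥0∞) := by
    push_cast
    refine Finset.sum_congr rfl fun k _ => ?_
    rw [ENNReal.coe_rpow_of_ne_zero (by positivity)]
    push_cast; rfl
  rw [h, ENNReal.coe_le_coe]
  exact (summable_zetaSum hθ).sum_le_tsum _ fun _ _ => zero_le

/-- **Young's inequality**: the deviation of a Riemann sum from its one-interval approximation. -/
theorem enorm_riemannSum_sub_le {a b : ℝ} (ha : 0 < a) (hb : 0 < b) (hab : 1 < 1 / a + 1 / b)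
    (f : ℝ → E →L[ℝ] F) (X : ℝ → E) {s t : ℝ} (π : IntervalPartition s t) :
    ‖riemannSum f X π.1 - f s (X t - X s)‖ₑ ≤
      zetaSum (1 / a + 1 / b) * (rVariation a f (Icc s t) * rVariation b X (Icc s t)) := by
  obtain ⟨π, hπ, hsπ, htπ⟩ := π
  set l := π.sort with hl
  have hmem : ∀ x, x ∈ l ↔ x ∈ π := by simp [hl]
  have hsort : l.SortedLT := Finset.sortedLT_sort _
  have hst : s ≤ t := (hπ hsπ).2
  set u : ℕ → ℝ := fun k => l.getD k t with hu
  have huI : ∀ k, u k ∈ Icc s t := by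
    intro k
    by_cases hk : k < l.length
    · have : u k = l[k] := (List.getElem_eq_getD _).symm
      rw [this]
      exact hπ ((hmem _).1 (List.getElem_mem hk))
    · have : u k = t := List.getD_eq_default _ _ (not_lt.1 hk)
      rw [this]
      exact ⟨hst, le_rfl⟩
  have hmono : Monotone u := by
    intro i j hij
    by_cases hj : j < l.length
    · have e1 : u i = l[i]'(by omega) := (List.getElem_eq_getD _).symm
      have e2 : u j = l[j] := (List.getElem_eq_getD _).symm
      rw [e1, e2]
      exact hsort.sortedLE.monotone_get (a := ⟨i, by omega⟩) (b := ⟨j, hj⟩) hij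
    · have : u j = t := List.getD_eq_default _ _ (not_lt.1 hj)
      rw [this]
      exact (huI i).2
  have hpos : 0 < l.length := List.length_pos_of_mem ((hmem s).2 hsπ)
  have h0 : u 0 = s := by
    refine le_antisymm ?_ (huI 0).1
    obtain ⟨k, hk, hks⟩ := List.getElem_of_mem ((hmem s).2 hsπ)
    have : u k = s := by rw [← hks]; exact (List.getElem_eq_getD _).symm
    rw [← this]
    exact hmono (Nat.zero_le k)
  have hlast : u (l.length - 1) = t := by
    refine le_antisymm (huI _).2 ?_
    obtain ⟨k, hk, hks⟩ := List.getElem_of_mem ((hmem t).2 htπ)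
    have : u k = t := by rw [← hks]; exact (List.getElem_eq_getD _).symm
    rw [← this]
    exact hmono (by omega)
  rw [riemannSum_eq_listSum, listSum_eq_sum_range _ _ _ t]
  have := enorm_leftSum_sub_le ha hb (f := f) (X := X) (l.length - 1) u hmono huI
  rw [h0, hlast] at this
  refine this.trans ?_
  gcongr
  exact sum_le_zetaSum hab _

theorem enorm_riemannSum_le {a b : ℝ} (ha : 0 < a) (hb : 0 < b) (hab : 1 < 1 / a + 1 / b)
    (f : ℝ → E →L[ℝ] F) (X : ℝ → E) {s t : ℝ} (π : IntervalPartition s t) :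
    ‖riemannSum f X π.1‖ₑ ≤ (‖f s‖ₑ + zetaSum (1 / a + 1 / b) * rVariation a f (Icc s t)) *
      rVariation b X (Icc s t) := by
  have hst : s ≤ t := (π.2.1 π.2.2.1).2
  have h1 : riemannSum f X π.1 = f s (X t - X s) + (riemannSum f X π.1 - f s (X t - X s)) := by
    abel
  rw [h1, add_mul, mul_assoc]
  refine (enorm_add_le _ _).trans (add_le_add ?_ (enorm_riemannSum_sub_le ha hb hab f X π))
  refine (ContinuousLinearMap.le_opENorm _ _).trans ?_
  gcongr
  rw [← edist_eq_enorm_sub]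
  exact edist_le_rVariation hb ⟨hst, le_rfl⟩ ⟨le_rfl, hst⟩

/-! ### Existence and increments of Young integrals -/

instance (a b : ℝ) : SemilatticeSup (IntervalPartition a b) :=
  Subtype.semilatticeSup fun {π σ} hπ hσ => by
    refine ⟨?_, Finset.mem_union_left _ hπ.2.1, Finset.mem_union_left _ hπ.2.2⟩
    rw [Finset.sup_eq_union, Finset.coe_union]
    exact union_subset hπ.1 hσ.1

/-- The partition of `[a, b]` with no interior points. -/
def IntervalPartition.trivial {a b : ℝ} (h : a ≤ b) : IntervalPartition a b :=
  ⟨{a, b}, by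
    intro x hx
    simp only [Finset.coe_insert, Finset.coe_singleton, mem_insert_iff, mem_singleton_iff] at hx
    rcases hx with rfl | rfl
    · exact ⟨le_rfl, h⟩
    · exact ⟨h, le_rfl⟩, by simp, by simp⟩

section Integral

variable {E F : Type*} [NormedAddCommGroup E] [NormedSpace ℝ E] [NormedAddCommGroup F]
  [NormedSpace ℝ F] {f g : ℝ → E →L[ℝ] F} {X Z : ℝ → E}

theorem hasYoungIntegral_self_iff {a : ℝ} {I : F} : HasYoungIntegral f X a a I ↔ I = 0 := by
  have h : (fun π : IntervalPartition a a => riemannSum f X π.1) = fun _ => (0 : F) := by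
    ext π
    have : π.1 = {a} := by
      refine Finset.eq_singleton_iff_unique_mem.2 ⟨π.2.2.1, fun x hx => ?_⟩
      exact le_antisymm (π.2.1 hx).2 (π.2.1 hx).1
    rw [this, riemannSum_singleton]
  have : Nonempty (IntervalPartition a a) := ⟨IntervalPartition.trivial le_rfl⟩
  unfold HasYoungIntegral
  rw [h]
  constructor
  · intro h
    exact (tendsto_nhds_unique h tendsto_const_nhds)
  · rintro rfl
    exact tendsto_const_nhds

/-- The increments of Young integrals are limits of the Riemann sums over the subinterval. -/
theorem HasYoungIntegral.tendsto_filter {a s t : ℝ} (has : a ≤ s) (hst : s ≤ t) {I J : F}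
    (hI : HasYoungIntegral f X a s I) (hJ : HasYoungIntegral f X a t J) :
    Tendsto (fun π : IntervalPartition a t => riemannSum f X (π.1.filter (s ≤ ·))) atTop
      (𝓝 (J - I)) := by
  let R : IntervalPartition a t → IntervalPartition a s := fun π =>
    ⟨insert s (π.1.filter (· ≤ s)), by
      intro x hx
      simp only [Finset.coe_insert, Finset.coe_filter, mem_insert_iff, mem_ofPred_eq] at hx
      rcases hx with rfl | hx
      · exact ⟨has, le_rfl⟩
      · exact ⟨(π.2.1 hx.1).1, hx.2⟩,
      Finset.mem_insert_of_mem (by simp [π.2.2.1, has]), Finset.mem_insert_self _ _⟩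
  have hR : Tendsto R atTop atTop := by
    refine tendsto_atTop_atTop_of_monotone ?_ ?_
    · intro π σ h
      exact Finset.insert_subset_insert _ (Finset.filter_subset_filter _ h)
    · intro σ
      refine ⟨⟨insert t σ.1, ?_, Finset.mem_insert_of_mem σ.2.2.1, Finset.mem_insert_self _ _⟩, ?_⟩
      · intro x hx
        rw [Finset.coe_insert, mem_insert_iff] at hx
        rcases hx with rfl | hx
        · exact ⟨has.trans hst, le_rfl⟩
        · exact ⟨(σ.2.1 hx).1, (σ.2.1 hx).2.trans hst⟩
      · intro x hx
        simp only [R, Finset.mem_insert, Finset.mem_filter]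
        exact Or.inr ⟨Or.inr hx, (σ.2.1 hx).2⟩
  refine (hJ.sub (hI.comp hR)).congr' ?_
  let π₀ : IntervalPartition a t := ⟨insert s (IntervalPartition.trivial (has.trans hst)).1, by
    intro x hx
    rw [Finset.coe_insert, mem_insert_iff] at hx
    rcases hx with rfl | hx
    · exact ⟨has, hst⟩
    · exact (IntervalPartition.trivial (has.trans hst)).2.1 hx,
    Finset.mem_insert_of_mem (IntervalPartition.trivial (has.trans hst)).2.2.1,
    Finset.mem_insert_of_mem (IntervalPartition.trivial (has.trans hst)).2.2.2⟩
  filter_upwards [eventually_ge_atTop π₀] with π hπ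
  have hs : s ∈ π.1 := hπ (Finset.mem_insert_self _ _)
  have : insert s (π.1.filter (· ≤ s)) = π.1.filter (· ≤ s) :=
    Finset.insert_eq_of_mem (by simp [hs])
  simp only [Function.comp, R, this]
  rw [riemannSum_split f X hs]
  abel

/-- Bound of the increments of the difference of two Young integrals. -/
theorem HasYoungIntegral.enorm_sub_sub_le {a b : ℝ} (ha : 0 < a) (hb : 0 < b)
    (hab : 1 < 1 / a + 1 / b) {x s t : ℝ} (hxs : x ≤ s) (hst : s ≤ t) {I I' J J' : F}
    (hI : HasYoungIntegral f X x s I) (hJ : HasYoungIntegral f X x t J)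
    (hI' : HasYoungIntegral g Z x s I') (hJ' : HasYoungIntegral g Z x t J') :
    ‖(J - I) - (J' - I')‖ₑ ≤
      (‖f s - g s‖ₑ + zetaSum (1 / a + 1 / b) * rVariation a (f - g) (Icc s t)) *
        rVariation b X (Icc s t) +
      (‖g s‖ₑ + zetaSum (1 / a + 1 / b) * rVariation a g (Icc s t)) *
        rVariation b (X - Z) (Icc s t) := by
  have : Nonempty (IntervalPartition x t) := ⟨IntervalPartition.trivial (hxs.trans hst)⟩
  have h := (hI.tendsto_filter hxs hst hJ).sub (hI'.tendsto_filter hxs hst hJ')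
  refine le_of_tendsto h.enorm ?_
  let π₀ : IntervalPartition x t := ⟨insert s (IntervalPartition.trivial (hxs.trans hst)).1, by
    intro y hy
    rw [Finset.coe_insert, mem_insert_iff] at hy
    rcases hy with rfl | hy
    · exact ⟨hxs, hst⟩
    · exact (IntervalPartition.trivial (hxs.trans hst)).2.1 hy,
    Finset.mem_insert_of_mem (IntervalPartition.trivial (hxs.trans hst)).2.2.1,
    Finset.mem_insert_of_mem (IntervalPartition.trivial (hxs.trans hst)).2.2.2⟩
  filter_upwards [eventually_ge_atTop π₀] with π hπ
  have hs : s ∈ π.1 := hπ (Finset.mem_insert_self _ _)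
  let σ : IntervalPartition s t := ⟨π.1.filter (s ≤ ·), by
    intro y hy
    have hy' := Finset.mem_filter.1 (Finset.mem_coe.1 hy)
    exact ⟨hy'.2, (π.2.1 hy'.1).2⟩, by simp [hs], by simp [π.2.2.2, hst]⟩
  have e : riemannSum f X σ.1 - riemannSum g Z σ.1 =
      riemannSum (f - g) X σ.1 + riemannSum g (X - Z) σ.1 := by
    rw [riemannSum_sub_left, riemannSum_sub_right]
    abel
  change ‖riemannSum f X σ.1 - riemannSum g Z σ.1‖ₑ ≤ _
  rw [e]
  exact (enorm_add_le _ _).trans (add_le_add (enorm_riemannSum_le ha hb hab _ _ σ)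
    (enorm_riemannSum_le ha hb hab _ _ σ))

theorem HasYoungIntegral.enorm_sub_le {a b : ℝ} (ha : 0 < a) (hb : 0 < b)
    (hab : 1 < 1 / a + 1 / b) {x s t : ℝ} (hxs : x ≤ s) (hst : s ≤ t) {I J : F}
    (hI : HasYoungIntegral f X x s I) (hJ : HasYoungIntegral f X x t J) :
    ‖J - I‖ₑ ≤ (‖f s‖ₑ + zetaSum (1 / a + 1 / b) * rVariation a f (Icc s t)) *
      rVariation b X (Icc s t) := by
  have h0 : ∀ y, HasYoungIntegral (0 : ℝ → E →L[ℝ] F) X x y 0 := by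
    intro y
    have : (fun π : IntervalPartition x y => riemannSum (0 : ℝ → E →L[ℝ] F) X π.1) =
        fun _ => (0 : F) := by
      ext π
      rw [← sub_self (0 : ℝ → E →L[ℝ] F), riemannSum_sub_left, sub_self]
    unfold HasYoungIntegral
    rw [this]
    exact tendsto_const_nhds
  have h := hI.enorm_sub_sub_le ha hb hab hxs hst hJ (h0 s) (h0 t)
  have hz : rVariation a (0 : ℝ → E →L[ℝ] F) (Icc s t) = 0 := by
    rw [rVariation_eq_incVariation, ← nonpos_iff_eq_zero, incVariation_le_iff ha]
    simp [ha]
  have hz' : ‖(0 : E →L[ℝ] F)‖ₑ = 0 := by simp [enorm]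
  simpa [hz, hz'] using h

/-- The last point of `π` before `x`. -/
def leftPoint (π : Finset ℝ) (x : ℝ) : ℝ :=
  if h : (π.filter (· ≤ x)).Nonempty then (π.filter (· ≤ x)).max' h else x

theorem leftPoint_spec {π : Finset ℝ} {a x : ℝ} (ha : a ∈ π) (hax : a ≤ x) :
    leftPoint π x ∈ π ∧ leftPoint π x ≤ x ∧ ∀ w ∈ π, w ≤ x → w ≤ leftPoint π x := by
  have h : (π.filter (· ≤ x)).Nonempty := ⟨a, by simp [ha, hax]⟩
  rw [leftPoint, dif_pos h]
  have := Finset.mem_filter.1 (Finset.max'_mem _ h)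
  exact ⟨this.1, this.2, fun w hw hwx => Finset.le_max' _ _ (by simp [hw, hwx])⟩

theorem leftPoint_eq_self {π : Finset ℝ} {x : ℝ} (hx : x ∈ π) : leftPoint π x = x :=
  le_antisymm (leftPoint_spec hx le_rfl).2.1 ((leftPoint_spec hx le_rfl).2.2 x hx le_rfl)

theorem monotoneOn_leftPoint {π : Finset ℝ} {a b : ℝ} (ha : a ∈ π) :
    MonotoneOn (leftPoint π) (Icc a b) := fun _ hx _ hy hxy =>
  (leftPoint_spec ha hy.1).2.2 _ (leftPoint_spec ha hx.1).1
    ((leftPoint_spec ha hx.1).2.1.trans hxy)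

/-- Refining a partition does not change the Riemann sums of a function that is constant between
the points of the partition. -/
theorem riemannSum_comp_leftPoint {a b : ℝ} (π : IntervalPartition a b) (σ : Finset ℝ)
    (hσ : ↑σ ⊆ Icc a b) :
    riemannSum (f ∘ leftPoint π.1) X (π.1 ∪ σ) = riemannSum f X π.1 := by
  induction σ using Finset.induction_on with
  | empty =>
    rw [Finset.union_empty]
    exact riemannSum_congr (fun x hx => by simp [leftPoint_eq_self hx]) fun _ _ => rfl
  | insert x σ _ ih =>
    rw [Finset.coe_insert, insert_subset_iff] at hσ
    rw [← ih hσ.2, Finset.union_insert]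
    by_cases hx : x ∈ π.1 ∪ σ
    · rw [Finset.insert_eq_of_mem hx]
    have haU : a ∈ π.1 ∪ σ := Finset.mem_union_left _ π.2.2.1
    have hbU : b ∈ π.1 ∪ σ := Finset.mem_union_left _ π.2.2.2
    have hy := leftPoint_spec haU hσ.1.1
    set y := leftPoint (π.1 ∪ σ) x with hydef
    have hne : ((π.1 ∪ σ).filter (x ≤ ·)).Nonempty := ⟨b, by simp [hσ.1.2, π.2.2.2]⟩
    have hz := Finset.mem_filter.1 (Finset.min'_mem _ hne)
    set z := ((π.1 ∪ σ).filter (x ≤ ·)).min' hne with hzdef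
    have hyx : y < x := lt_of_le_of_ne hy.2.1 fun h => hx (h ▸ hy.1)
    have hxz : x < z := lt_of_le_of_ne hz.2 fun h => hx (h ▸ hz.1)
    rw [riemannSum_insert _ X hy.1 hz.1 hyx hxz]
    · have hay : a ≤ y := hy.2.2 a haU hσ.1.1
      have hlx := leftPoint_spec π.2.2.1 hσ.1.1
      have hly := leftPoint_spec π.2.2.1 hay
      have : leftPoint π.1 x = leftPoint π.1 y := by
        refine le_antisymm (hly.2.2 _ hlx.1 (hy.2.2 _ (Finset.mem_union_left _ hlx.1) hlx.2.1)) ?_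
        exact hlx.2.2 _ hly.1 (hly.2.1.trans hyx.le)
      simp [this]
    · intro w hw
      rcases le_total w x with h | h
      · exact Or.inl (hy.2.2 w hw h)
      · exact Or.inr (Finset.min'_le _ _ (by simpa [h] using hw))

/-- Partitions of arbitrarily small mesh. -/
theorem exists_partition_leftPoint {a b η : ℝ} (hab : a ≤ b) (hη : 0 < η) :
    ∃ π₀ : IntervalPartition a b, ∀ π ≥ π₀, ∀ x ∈ Icc a b, x - leftPoint π.1 x ≤ η := by
  let N := ⌈(b - a) / η⌉₊
  let σ : Finset ℝ := (Finset.range (N + 1)).image fun i : ℕ => min (a + i * η) b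
  have hσ : ↑σ ⊆ Icc a b := by
    intro x hx
    simp only [σ, Finset.coe_image, mem_image] at hx
    obtain ⟨i, -, rfl⟩ := hx
    have : 0 ≤ (i : ℝ) * η := by positivity
    exact ⟨le_min (by linarith) hab, min_le_right _ _⟩
  refine ⟨⟨(IntervalPartition.trivial hab).1 ∪ σ, ?_, ?_, ?_⟩, ?_⟩
  · rw [Finset.coe_union]
    exact union_subset (IntervalPartition.trivial hab).2.1 hσ
  · exact Finset.mem_union_left _ (IntervalPartition.trivial hab).2.2.1
  · exact Finset.mem_union_left _ (IntervalPartition.trivial hab).2.2.2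
  intro π hπ x hx
  set i := ⌊(x - a) / η⌋₊
  have hxa : 0 ≤ (x - a) / η := div_nonneg (by linarith [hx.1]) hη.le
  have h1 : (i : ℝ) ≤ (x - a) / η := Nat.floor_le hxa
  have h2 : (x - a) / η < i + 1 := Nat.lt_floor_add_one _
  rw [le_div_iff₀ hη] at h1
  rw [div_lt_iff₀ hη] at h2
  have hi : i < N + 1 := by
    refine Nat.lt_succ_of_le (Nat.floor_le_ceil _ |>.trans (Nat.ceil_le_ceil ?_))
    gcongr
    exact hx.2
  have hmem : min (a + i * η) b ∈ π.1 := by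
    refine hπ (Finset.mem_union_right _ ?_)
    exact Finset.mem_image.2 ⟨i, Finset.mem_range.2 hi, rfl⟩
  have hle : a + i * η ≤ b := by linarith [hx.2]
  rw [min_eq_left hle] at hmem
  have := (leftPoint_spec π.2.2.1 hx.1).2.2 _ hmem (by linarith)
  linarith

/-- If the oscillation of `f` along the partition `π₀` is at most `δ`, then refining `π₀` changes the
Riemann sum by little: Young's inequality is applied to `f - f ∘ leftPoint π₀`, the variation of
which for a larger exponent `a'` is small by interpolation. -/
theorem enorm_riemannSum_refine_le {a a' b : ℝ} (ha : 1 ≤ a) (haa : a ≤ a') (hb : 0 < b)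
    (hab : 1 < 1 / a' + 1 / b) {s t : ℝ} {π₀ π : IntervalPartition s t} (hπ : π₀ ≤ π) {δ : ℝ≥0∞}
    (hδ : ∀ x ∈ Icc s t, edist (f x) (f (leftPoint π₀.1 x)) ≤ δ) :
    ‖riemannSum f X π.1 - riemannSum f X π₀.1‖ₑ ≤ zetaSum (1 / a' + 1 / b) *
      ((δ + δ) ^ (1 - a / a') * (rVariation a f (Icc s t) + rVariation a f (Icc s t)) ^ (a / a') *
        rVariation b X (Icc s t)) := by
  have ha0 : 0 < a := by linarith
  have ha'0 : 0 < a' := ha0.trans_le haa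
  have hmI : MapsTo (leftPoint π₀.1) (Icc s t) (Icc s t) := fun x hx =>
    π₀.2.1 (leftPoint_spec π₀.2.2.1 hx.1).1
  have e : riemannSum f X π.1 - riemannSum f X π₀.1 =
      riemannSum (f - f ∘ leftPoint π₀.1) X π.1 := by
    rw [riemannSum_sub_left]
    have := riemannSum_comp_leftPoint (f := f) (X := X) π₀ π.1 π.2.1
    rw [Finset.union_eq_right.2 hπ] at this
    rw [this]
  have h0 : (f - f ∘ leftPoint π₀.1) s = 0 := by simp [leftPoint_eq_self π₀.2.2.1]
  have hz : ‖(0 : E →L[ℝ] F)‖ₑ = 0 := by simp [enorm]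
  have h1 := enorm_riemannSum_le ha'0 hb hab (f - f ∘ leftPoint π₀.1) X π
  rw [h0, hz, zero_add, mul_assoc] at h1
  rw [e]
  refine h1.trans ?_
  have h2 : rVariation a' (f - f ∘ leftPoint π₀.1) (Icc s t) ≤ (δ + δ) ^ (1 - a / a') *
      rVariation a (f - f ∘ leftPoint π₀.1) (Icc s t) ^ (a / a') := by
    refine incVariation_le_of_bounded
      (χ := fun x y => edist ((f - f ∘ leftPoint π₀.1) x) ((f - f ∘ leftPoint π₀.1) y))
      ha0 haa fun x hx y hy _ => ?_
    rw [edist_eq_enorm_sub]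
    refine enorm_sub_le.trans (add_le_add ?_ ?_)
    · simpa [edist_eq_enorm_sub] using hδ x hx
    · simpa [edist_eq_enorm_sub] using hδ y hy
  have h3 : rVariation a (f - f ∘ leftPoint π₀.1) (Icc s t) ≤
      rVariation a f (Icc s t) + rVariation a f (Icc s t) :=
    (rVariation_sub_le ha).trans (add_le_add le_rfl
      (rVariation_comp_le ha0 (monotoneOn_leftPoint π₀.2.2.1) hmI))
  have h4 := ENNReal.rpow_le_rpow h3 (z := a / a') (by positivity)
  exact mul_le_mul' le_rfl (mul_le_mul' (h2.trans (mul_le_mul' le_rfl h4)) le_rfl)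

/-- Existence of the Young integral of a continuous path. -/
theorem exists_hasYoungIntegral [CompleteSpace F] {a b : ℝ} (ha : 1 ≤ a) (hb : 0 < b)
    (hab : 1 < 1 / a + 1 / b) {s t : ℝ} (hst : s ≤ t) (hf : ContinuousOn f (Icc s t))
    (hfa : rVariation a f (Icc s t) ≠ ∞) (hX : rVariation b X (Icc s t) ≠ ∞) :
    ∃ I : F, HasYoungIntegral f X s t I := by
  have ha0 : 0 < a := by linarith
  -- a larger exponent leaves room for the interpolation
  obtain ⟨a', haa, hab'⟩ : ∃ a', a < a' ∧ 1 < 1 / a' + 1 / b := by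
    have hc : ContinuousAt (fun z : ℝ => 1 / z + 1 / b) a := by
      refine ContinuousAt.add ?_ continuousAt_const
      exact continuousAt_const.div continuousAt_id ha0.ne'
    have h1 : ∀ᶠ z in 𝓝[>] a, 1 < 1 / z + 1 / b :=
      (hc.eventually (lt_mem_nhds hab)).filter_mono nhdsWithin_le_nhds
    obtain ⟨z, hz, hz'⟩ := (h1.and self_mem_nhdsWithin).exists
    exact ⟨z, hz', hz⟩
  have ha'0 : 0 < a' := ha0.trans haa
  have : Nonempty (IntervalPartition s t) := ⟨IntervalPartition.trivial hst⟩
  refine cauchySeq_tendsto_of_complete (β := IntervalPartition s t) ?_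
  rw [EMetric.cauchySeq_iff']
  intro ε hε
  obtain ⟨δ, hδ, hδ0⟩ : ∃ δ : ℝ≥0∞, zetaSum (1 / a' + 1 / b) * ((δ + δ) ^ (1 - a / a') *
      (rVariation a f (Icc s t) + rVariation a f (Icc s t)) ^ (a / a') *
        rVariation b X (Icc s t)) < ε ∧ 0 < δ := by
    generalize rVariation b X (Icc s t) = v at hX
    generalize rVariation a f (Icc s t) = w at hfa
    have hx : 0 < 1 - a / a' := sub_pos.2 ((div_lt_one ha'0).2 haa)
    have hK : (w + w) ^ (a / a') ≠ ∞ :=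
      ENNReal.rpow_ne_top_of_nonneg (by positivity) (ENNReal.add_ne_top.2 ⟨hfa, hfa⟩)
    have h1 : Tendsto (fun δ : ℝ≥0∞ => (δ + δ) ^ (1 - a / a')) (𝓝 0) (𝓝 0) := by
      have : Tendsto (fun δ : ℝ≥0∞ => δ + δ) (𝓝 0) (𝓝 0) := by
        simpa using (tendsto_id (x := 𝓝 (0 : ℝ≥0∞))).add (tendsto_id (x := 𝓝 (0 : ℝ≥0∞)))
      have h2 := this.ennrpow_const (1 - a / a')
      rwa [ENNReal.zero_rpow_of_pos hx] at h2
    have h2 := ENNReal.Tendsto.mul_const h1 (Or.inr hK)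
    have h3 := ENNReal.Tendsto.mul_const h2 (Or.inr hX)
    have h4 := ENNReal.Tendsto.const_mul (a := (zetaSum (1 / a' + 1 / b) : ℝ≥0∞)) h3
      (Or.inr ENNReal.coe_ne_top)
    simp only [zero_mul, mul_zero] at h4
    exact (((h4.eventually (gt_mem_nhds hε)).filter_mono nhdsWithin_le_nhds).and
      (self_mem_nhdsWithin (s := Ioi (0 : ℝ≥0∞)))).exists
  have huc : UniformContinuousOn f (Icc s t) := isCompact_Icc.uniformContinuousOn_of_continuous hf
  rw [EMetric.uniformContinuousOn_iff] at huc
  obtain ⟨η, hη, hfη⟩ := huc δ hδ0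
  obtain ⟨η', hη'0, hη'⟩ : ∃ η' : ℝ, 0 < η' ∧ ENNReal.ofReal η' < η := by
    obtain ⟨c, hc0, hc⟩ := ENNReal.lt_iff_exists_nnreal_btwn.1 hη
    exact ⟨c, by exact_mod_cast hc0, by simpa using hc⟩
  obtain ⟨π₀, hπ₀⟩ := exists_partition_leftPoint hst hη'0
  refine ⟨π₀, fun π hπ => ?_⟩
  rw [edist_eq_enorm_sub]
  refine (enorm_riemannSum_refine_le ha haa.le hb hab' hπ fun x hx => ?_).trans_lt hδ
  have h1 := hπ₀ π₀ le_rfl x hx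
  have h2 := leftPoint_spec π₀.2.2.1 hx.1
  refine (hfη hx (π₀.2.1 h2.1) ?_).le
  rw [edist_dist, Real.dist_eq, abs_of_nonneg (by linarith [h2.2.1])]
  exact (ENNReal.ofReal_le_ofReal h1).trans_lt hη'

end Integral

/-! ### Constants -/

theorem one_le_zetaSum {θ : ℝ} (hθ : 1 < θ) : 1 ≤ zetaSum θ := by
  have := (summable_zetaSum hθ).le_tsum 0 fun _ _ => zero_le
  simpa [zetaSum] using this

theorem one_lt_theta {β : ℝ≥0} {r : ℝ} (hr : 1 ≤ r) (hrβ : r < 1 + β) : 1 < (1 + β) / r :=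
  (one_lt_div (by linarith)).2 hrβ

theorem zetaSum_le_sewConst {β : ℝ≥0} {r : ℝ} (hr : 1 ≤ r) (hrβ : r < 1 + β) :
    zetaSum ((1 + β) / r) ≤ sewConst β r := by
  refine le_mul_of_one_le_left zero_le ?_
  exact NNReal.one_le_rpow one_le_two (by linarith [one_lt_theta hr hrβ])

theorem one_le_sewConst {β : ℝ≥0} {r : ℝ} (hr : 1 ≤ r) (hrβ : r < 1 + β) : 1 ≤ sewConst β r :=
  (one_le_zetaSum (one_lt_theta hr hrβ)).trans (zetaSum_le_sewConst hr hrβ)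

theorem theta_eq {β : ℝ≥0} {r : ℝ} (hr : 1 ≤ r) (hβ : 0 < β) :
    1 / (r / (β : ℝ)) + 1 / r = (1 + β) / r := by
  have : (0 : ℝ) < β := by exact_mod_cast hβ
  have : 0 < r := by linarith
  field_simp
  ring

/-- The coefficient `K` of `gammaTilde`. -/
def youngK (β : ℝ≥0) (r : ℝ) (Φ₀ Φ₁β ε : ℝ≥0) : ℝ≥0 :=
  sewConst β r * 2 ^ ((β : ℝ) + 1) * (Φ₁β / (1 + β)) * Φ₀ ^ (β : ℝ) * ε ^ (β : ℝ)

/-- The coefficient `L` of `gammaTilde`. -/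
def youngL (β : ℝ≥0) (r : ℝ) (Φ₀ ε : ℝ≥0) : ℝ≥0 :=
  sewConst β r * 2 ^ (β : ℝ) * Φ₀ ^ (β : ℝ) * ε ^ (β : ℝ)

theorem youngK_eq (β : ℝ≥0) (r : ℝ) (Φ₀ Φ₁β ε : ℝ≥0) :
    youngK β r Φ₀ Φ₁β ε =
      sewConst β r * (Φ₁β / (1 + β) * (2 * (2 * Φ₀ * ε) ^ (β : ℝ))) := by
  rw [youngK, NNReal.mul_rpow, NNReal.mul_rpow, NNReal.rpow_add two_ne_zero, NNReal.rpow_one]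
  ring

theorem youngL_eq (β : ℝ≥0) (r : ℝ) (Φ₀ ε : ℝ≥0) :
    youngL β r Φ₀ ε = sewConst β r * (2 * Φ₀ * ε) ^ (β : ℝ) := by
  rw [youngL, NNReal.mul_rpow, NNReal.mul_rpow]
  ring

section Small

variable {β : ℝ≥0} {r : ℝ} {Φ₀ Φβ Φ₁ Φ₁β ε : ℝ≥0}

theorem IsSmall.holder_le (h : IsSmall β r Φ₀ Φβ Φ₁ Φ₁β ε) (hΦ₀ : 0 < Φ₀) :
    sewConst β r * (Φβ * (2 * Φ₀ * ε) ^ (β : ℝ)) ≤ Φ₀ := by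
  calc sewConst β r * (Φβ * (2 * Φ₀ * ε) ^ (β : ℝ))
      = 2 ^ (β : ℝ) * sewConst β r * Φβ * ε ^ (β : ℝ) * Φ₀ ^ (β : ℝ) := by
        rw [NNReal.mul_rpow, NNReal.mul_rpow]; ring
    _ ≤ Φ₀ ^ (1 - (β : ℝ)) * Φ₀ ^ (β : ℝ) := by gcongr; exact h.apriori
    _ = Φ₀ := by rw [← NNReal.rpow_add hΦ₀.ne']; simp

theorem IsSmall.youngK_le (h : IsSmall β r Φ₀ Φβ Φ₁ Φ₁β ε) :
    youngK β r Φ₀ Φ₁β ε * ε ≤ 1 / 4 := by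
  calc youngK β r Φ₀ Φ₁β ε * ε
      = 2 * (sewConst β r * 2 ^ (β : ℝ) * Φ₀ ^ (β : ℝ) * (Φ₁β / (1 + β)) *
          ε ^ (1 + (β : ℝ))) := by
        rw [youngK, NNReal.rpow_add two_ne_zero, NNReal.rpow_one, NNReal.rpow_add h.pos.ne',
          NNReal.rpow_one]
        ring
    _ ≤ 2 * (1 / 8) := by gcongr; exact h.picard₂
    _ = 1 / 4 := by rw [← NNReal.coe_inj]; push_cast; norm_num

/-- The contraction rate of the Picard map. -/
theorem IsSmall.rate_le (h : IsSmall β r Φ₀ Φβ Φ₁ Φ₁β ε) (hr : 1 ≤ r) (hrβ : r < 1 + β) :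
    ((sewConst β r + 1) * Φ₁ + youngK β r Φ₀ Φ₁β ε) * ε ≤ 1 / 2 := by
  have h1 := h.picard₁
  have h2 := h.youngK_le
  have h3 : Φ₁ * ε ≤ 1 / 8 := by
    refine le_trans ?_ h1
    rw [mul_assoc]
    exact le_mul_of_one_le_left zero_le (one_le_sewConst hr hrβ)
  calc ((sewConst β r + 1) * Φ₁ + youngK β r Φ₀ Φ₁β ε) * ε
      = sewConst β r * Φ₁ * ε + Φ₁ * ε + youngK β r Φ₀ Φ₁β ε * ε := by ring
    _ ≤ 1 / 8 + 1 / 8 + 1 / 4 := by gcongr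
    _ = 1 / 2 := by rw [← NNReal.coe_inj]; push_cast; norm_num

/-- The a priori estimate in numerical form. -/
theorem IsSmall.le_of_le_add (h : IsSmall β r Φ₀ Φβ Φ₁ Φ₁β ε) (hΦ₀ : 0 < Φ₀) (hβ1 : β ≤ 1) {v : ℝ≥0}
    (hv : v ≤ (Φ₀ + sewConst β r * (Φβ * v ^ (β : ℝ))) * ε) : v ≤ 2 * Φ₀ * ε := by
  by_contra! hlt
  have hM : 0 < 2 * Φ₀ * ε := mul_pos (mul_pos two_pos hΦ₀) h.pos
  have h1 : v ^ (β : ℝ) ≤ v / (2 * Φ₀ * ε) * (2 * Φ₀ * ε) ^ (β : ℝ) := by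
    have e : v = v / (2 * Φ₀ * ε) * (2 * Φ₀ * ε) := (div_mul_cancel₀ v hM.ne').symm
    have h2 : (v / (2 * Φ₀ * ε)) ^ (β : ℝ) ≤ v / (2 * Φ₀ * ε) :=
      (NNReal.rpow_le_rpow_of_exponent_le ((one_le_div hM).2 hlt.le)
        (by exact_mod_cast hβ1)).trans_eq (NNReal.rpow_one _)
    calc v ^ (β : ℝ) = (v / (2 * Φ₀ * ε) * (2 * Φ₀ * ε)) ^ (β : ℝ) := by rw [← e]
      _ = (v / (2 * Φ₀ * ε)) ^ (β : ℝ) * (2 * Φ₀ * ε) ^ (β : ℝ) := NNReal.mul_rpow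
      _ ≤ _ := by gcongr
  have h3 : v ≤ Φ₀ * ε + v / 2 := by
    calc v ≤ (Φ₀ + sewConst β r * (Φβ * v ^ (β : ℝ))) * ε := hv
      _ ≤ (Φ₀ + sewConst β r * (Φβ * (v / (2 * Φ₀ * ε) * (2 * Φ₀ * ε) ^ (β : ℝ)))) * ε := by gcongr
      _ = (Φ₀ + v / (2 * Φ₀ * ε) * (sewConst β r * (Φβ * (2 * Φ₀ * ε) ^ (β : ℝ)))) * ε := by ring
      _ ≤ (Φ₀ + v / (2 * Φ₀ * ε) * Φ₀) * ε := by gcongr; exact h.holder_le hΦ₀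
      _ = Φ₀ * ε + v / 2 := by
        have := h.pos.ne'
        field_simp
  have h3' : (v : ℝ) ≤ Φ₀ * ε + v / 2 := by exact_mod_cast h3
  have hlt' : (2 * Φ₀ * ε : ℝ) < v := by exact_mod_cast hlt
  linarith

end Small

/-! ### The four-point estimate -/

section Nonlinear

variable {F G : Type*} [NormedAddCommGroup F] [NormedSpace ℝ F] [NormedAddCommGroup G]
  [NormedSpace ℝ G]

/-- The second difference of `φ ∈ C^{1,β}_b`, from integrating
`λ ↦ Dφ(z + λ(y - z))(y - z) - Dφ(z' + λ(y' - z'))(y' - z')`, where the factor `1 / (1 + β)` comes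
from `∫₀¹ λ^β dλ`. -/
theorem HolderBound₁.norm_second_difference_le {β Φ₀ Φβ Φ₁ Φ₁β : ℝ≥0} {φ : F → G}
    (hφ : HolderBound₁ β Φ₀ Φβ Φ₁ Φ₁β φ) (hβ1 : β ≤ 1) (y z y' z' : F) :
    ‖(φ y - φ z) - (φ y' - φ z')‖ ≤ Φ₁ * ‖(y - z) - (y' - z')‖ +
      Φ₁β / (1 + β) * (‖y - y'‖ ^ (β : ℝ) + ‖z - z'‖ ^ (β : ℝ)) * ‖y' - z'‖ := by
  have hβ0 : (0 : ℝ) ≤ β := β.2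
  have hβ1' : (β : ℝ) ≤ 1 := by exact_mod_cast hβ1
  have hder : ∀ (v w : F) (x : ℝ), HasDerivAt (fun x : ℝ => φ (v + x • w))
      (fderiv ℝ φ (v + x • w) w) x := by
    intro v w x
    have h1 : HasDerivAt (fun x : ℝ => v + x • w) w x := by
      simpa using ((hasDerivAt_id x).smul_const w).const_add v
    exact (hφ.differentiable _).hasFDerivAt.comp_hasDerivAt x h1
  set g : ℝ → G := fun x => (φ (z + x • (y - z)) - φ (z' + x • (y' - z'))) - (φ z - φ z') with hg
  set g' : ℝ → G := fun x => fderiv ℝ φ (z + x • (y - z)) (y - z) -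
    fderiv ℝ φ (z' + x • (y' - z')) (y' - z') with hg'
  have hgd : ∀ x, HasDerivAt g (g' x) x := fun x =>
    ((hder z (y - z) x).sub (hder z' (y' - z') x)).sub_const _
  set A := ‖(y - z) - (y' - z')‖
  set a := ‖y - y'‖ ^ (β : ℝ)
  set b := ‖z - z'‖ ^ (β : ℝ)
  set c := ‖y' - z'‖
  -- `B` is the explicit primitive of the bound `B'` for the derivative of `g`
  set B : ℝ → ℝ := fun x => Φ₁ * A * x + Φ₁β / (1 + β) * c *
    (b * (1 - (1 - x) ^ ((β : ℝ) + 1)) + a * x ^ ((β : ℝ) + 1))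
  set B' : ℝ → ℝ := fun x => Φ₁ * A + Φ₁β * c * (b * (1 - x) ^ (β : ℝ) + a * x ^ (β : ℝ))
  have hBd : ∀ x, HasDerivAt B (B' x) x := by
    intro x
    have h1 : HasDerivAt (fun x : ℝ => x ^ ((β : ℝ) + 1)) (((β : ℝ) + 1) * x ^ (β : ℝ)) x := by
      have := Real.hasDerivAt_rpow_const (x := x) (p := (β : ℝ) + 1) (Or.inr (by linarith))
      simpa using this
    have h2 : HasDerivAt (fun x : ℝ => (1 - x) ^ ((β : ℝ) + 1))
        (-(((β : ℝ) + 1) * (1 - x) ^ (β : ℝ))) x := by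
      have h0 : HasDerivAt (fun x : ℝ => 1 - x) (-1) x := by
        simpa using (hasDerivAt_id x).const_sub 1
      have := h0.rpow_const (p := (β : ℝ) + 1) (Or.inr (by linarith))
      refine this.congr_deriv ?_
      rw [add_sub_cancel_right]
      ring
    have h3 := ((hasDerivAt_id x).const_mul (Φ₁ * A)).add
      ((((h2.const_sub 1).const_mul b).add (h1.const_mul a)).const_mul (Φ₁β / (1 + β) * c))
    refine h3.congr_deriv ?_
    have : (1 + (β : ℝ)) ≠ 0 := by positivity
    simp only [B']
    field_simp
    ring
  have hbound : ∀ x ∈ Ico (0 : ℝ) 1, ‖g' x‖ ≤ B' x := by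
    intro x hx
    have hx1 : 0 ≤ 1 - x := by linarith [hx.2]
    have e : g' x = fderiv ℝ φ (z + x • (y - z)) ((y - z) - (y' - z')) +
        (fderiv ℝ φ (z + x • (y - z)) - fderiv ℝ φ (z' + x • (y' - z'))) (y' - z') := by
      simp only [hg', map_sub, sub_apply]
      abel
    rw [e]
    refine (norm_add_le _ _).trans (add_le_add ?_ ?_)
    · exact (ContinuousLinearMap.le_opNorm _ _).trans
        (mul_le_mul_of_nonneg_right (hφ.fderiv_sup_le _) (norm_nonneg _))
    · refine (ContinuousLinearMap.le_opNorm _ _).trans ?_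
      have h1 : ‖fderiv ℝ φ (z + x • (y - z)) - fderiv ℝ φ (z' + x • (y' - z'))‖ ≤
          Φ₁β * ‖(z + x • (y - z)) - (z' + x • (y' - z'))‖ ^ (β : ℝ) := by
        rw [← dist_eq_norm, ← dist_eq_norm]
        exact hφ.fderiv_holder.dist_le _ _
      have h2 : ‖(z + x • (y - z)) - (z' + x • (y' - z'))‖ ^ (β : ℝ) ≤
          b * (1 - x) ^ (β : ℝ) + a * x ^ (β : ℝ) := by
        have e2 : (z + x • (y - z)) - (z' + x • (y' - z')) =
            (1 - x) • (z - z') + x • (y - y') := by module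
        have h3 : ‖(z + x • (y - z)) - (z' + x • (y' - z'))‖ ≤
            (1 - x) * ‖z - z'‖ + x * ‖y - y'‖ := by
          rw [e2]
          refine (norm_add_le _ _).trans ?_
          rw [norm_smul, norm_smul, Real.norm_of_nonneg hx1, Real.norm_of_nonneg hx.1]
        refine (Real.rpow_le_rpow (norm_nonneg _) h3 hβ0).trans ?_
        refine (Real.rpow_add_le_add_rpow (by positivity) (mul_nonneg hx.1 (norm_nonneg _)) hβ0
          hβ1').trans (le_of_eq ?_)
        rw [Real.mul_rpow hx1 (norm_nonneg _), Real.mul_rpow hx.1 (norm_nonneg _)]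
        ring
      calc _ ≤ Φ₁β * (b * (1 - x) ^ (β : ℝ) + a * x ^ (β : ℝ)) * c := by
            gcongr
            exact h1.trans (by gcongr)
        _ = _ := by ring
  have hB0 : ‖g 0‖ ≤ B 0 := by
    have e1 : ((β : ℝ) + 1) ≠ 0 := by positivity
    simp [g, B, Real.zero_rpow e1]
  have key := image_norm_le_of_norm_deriv_right_le_deriv_boundary
    (fun x _ => (hgd x).continuousAt.continuousWithinAt)
    (fun x _ => (hgd x).hasDerivWithinAt) hB0 hBd hbound (right_mem_Icc.2 zero_le_one)
  have e1 : ((β : ℝ) + 1) ≠ 0 := by positivity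
  have e2 : g 1 = (φ y - φ z) - (φ y' - φ z') := by
    simp only [hg, one_smul, add_sub_cancel]
    abel
  rw [e2] at key
  refine key.trans (le_of_eq ?_)
  simp only [B, sub_self, Real.zero_rpow e1, Real.one_rpow]
  ring

theorem HolderBound₁.edist_sub_le {β Φ₀ Φβ Φ₁ Φ₁β : ℝ≥0} {φ : F → G}
    (hφ : HolderBound₁ β Φ₀ Φβ Φ₁ Φ₁β φ) (hβ1 : β ≤ 1) (y z y' z' : F) :
    edist (φ y - φ z) (φ y' - φ z') ≤ Φ₁ * edist (y - z) (y' - z') +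
      (Φ₁β / (1 + β) : ℝ≥0) * (edist y y' ^ (β : ℝ) + edist z z' ^ (β : ℝ)) * edist y' z' := by
  have h : ‖(φ y - φ z) - (φ y' - φ z')‖₊ ≤ Φ₁ * ‖(y - z) - (y' - z')‖₊ +
      Φ₁β / (1 + β) * (‖y - y'‖₊ ^ (β : ℝ) + ‖z - z'‖₊ ^ (β : ℝ)) * ‖y' - z'‖₊ := by
    rw [← NNReal.coe_le_coe]
    push_cast
    exact hφ.norm_second_difference_le hβ1 y z y' z'
  simp only [edist_eq_enorm_sub, enorm_eq_nnnorm]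
  rw [← ENNReal.coe_rpow_of_nonneg _ β.coe_nonneg, ← ENNReal.coe_rpow_of_nonneg _ β.coe_nonneg]
  exact_mod_cast h

theorem HolderBound₁.edist_le {β Φ₀ Φβ Φ₁ Φ₁β : ℝ≥0} {φ : F → G}
    (hφ : HolderBound₁ β Φ₀ Φβ Φ₁ Φ₁β φ) (y z : F) : edist (φ y) (φ z) ≤ Φ₁ * edist y z :=
  lipschitzWith_of_nnnorm_fderiv_le hφ.differentiable (fun x => hφ.fderiv_sup_le x) y z

/-- The second difference bound in terms of variations: the exponent `r / β` is the one for which the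
`β`-th powers of increments of paths of finite `r`-variation are summable. -/
theorem HolderBound₁.rVariation_comp_sub_comp_le {β Φ₀ Φβ Φ₁ Φ₁β : ℝ≥0} {φ : F → G}
    (hφ : HolderBound₁ β Φ₀ Φβ Φ₁ Φ₁β φ) (hβ : 0 < β) (hβ1 : β ≤ 1) {r : ℝ} (hr : 1 ≤ r)
    {Y Z : ℝ → F} {I : Set ℝ} {S : ℝ≥0∞} (hS : ∀ t ∈ I, edist (Y t) (Z t) ≤ S) :
    rVariation (r / β) (φ ∘ Y - φ ∘ Z) I ≤ Φ₁ * rVariation r (Y - Z) I +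
      (Φ₁β / (1 + β) : ℝ≥0) *
        (rVariation r Y I ^ (β : ℝ) + rVariation r Z I ^ (β : ℝ)) * S := by
  have hβ0 : (0 : ℝ) < β := by exact_mod_cast hβ
  have hr0 : 0 < r := by linarith
  have hra : r ≤ r / β := (le_div_iff₀ hβ0).2
    (mul_le_of_le_one_right hr0.le (by exact_mod_cast hβ1))
  have ha1 : 1 ≤ r / β := hr.trans hra
  have ha0 : 0 < r / β := by linarith
  set k : ℝ≥0∞ := ((Φ₁β / (1 + β) : ℝ≥0) : ℝ≥0∞) with hk
  simp only [rVariation_eq_incVariation]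
  have h1 := incVariation_mono (r := r / β) (I := I) (J := I)
    (χ := fun s t => edist ((φ ∘ Y - φ ∘ Z) s) ((φ ∘ Y - φ ∘ Z) t))
    (χ' := fun s t => Φ₁ * edist ((Y - Z) s) ((Y - Z) t) +
      k * S * (edist (Y s) (Y t) ^ (β : ℝ) + edist (Z s) (Z t) ^ (β : ℝ))) ha0 Subset.rfl (by
    intro s hs t _ _
    rw [edist_comm]
    refine (hφ.edist_sub_le hβ1 (Y t) (Z t) (Y s) (Z s)).trans ?_
    rw [edist_comm ((Y - Z) s), edist_comm (Y s) (Y t), edist_comm (Z s) (Z t), mul_right_comm]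
    exact add_le_add le_rfl (mul_le_mul' (mul_le_mul' le_rfl (hS s hs)) le_rfl))
  refine h1.trans ((incVariation_add_le ha1).trans (add_le_add ?_ ?_))
  · refine (incVariation_const_mul_le ha0 _).trans ?_
    gcongr
    exact incVariation_anti hr0 hra
  · refine (incVariation_const_mul_le ha0 _).trans ?_
    rw [mul_right_comm]
    refine mul_le_mul' (mul_le_mul' le_rfl ?_) le_rfl
    refine (incVariation_add_le ha1).trans (add_le_add ?_ ?_)
    · exact incVariation_rpow_le (χ := fun s t => edist (Y s) (Y t)) hr0 hβ0
    · exact incVariation_rpow_le (χ := fun s t => edist (Z s) (Z t)) hr0 hβ0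

end Nonlinear

/-! ### Estimates for indefinite Young integrals -/

/-- `Y_t = y₀ + ∫_0^t f dX` for `t ∈ [0, T]`. Young solutions are the case `f = φ ∘ Y`, and a step of
the Picard iteration is the case `f = φ ∘ Z`. -/
def IsYoungPrimitive {E F : Type*} [NormedAddCommGroup E] [NormedSpace ℝ E]
    [NormedAddCommGroup F] [NormedSpace ℝ F]
    (f : ℝ → E →L[ℝ] F) (X : ℝ → E) (y₀ : F) (T : ℝ) (Y : ℝ → F) : Prop :=
  ∀ t ∈ Icc 0 T, HasYoungIntegral f X 0 t (Y t - y₀)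

theorem edist_le_rVariation_sub {F : Type*} [SeminormedAddCommGroup F] {r : ℝ} (hr : 1 ≤ r)
    {Z Z' : ℝ → F} {τ : ℝ} (hτ : 0 ≤ τ) (h0 : Z 0 = Z' 0) :
    ∀ t ∈ Icc 0 τ, edist (Z t) (Z' t) ≤ rVariation r (Z - Z') (Icc 0 τ) := by
  intro t ht
  have := edist_le_rVariation (f := Z - Z') (r := r) (by linarith) ht
    (⟨le_rfl, hτ⟩ : (0 : ℝ) ∈ Icc 0 τ)
  simpa [h0, edist_eq_enorm_sub] using this

theorem memHolder_sub {X Y : Type*} [PseudoMetricSpace X] [SeminormedAddCommGroup Y] {β : ℝ≥0}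
    {f g : X → Y} (hf : MemHolder β f) (hg : MemHolder β g) : MemHolder β (f - g) := by
  rw [sub_eq_add_neg]
  obtain ⟨C, hC⟩ := hf
  obtain ⟨D, hD⟩ := hg
  exact ⟨C + D, hC.add fun x y => by simpa using hD x y⟩

theorem continuousOn_of_edist_le {E F : Type*} [PseudoEMetricSpace E] [PseudoEMetricSpace F]
    {r : ℝ} {X : ℝ → E} {τ ν : ℝ} (hν : 0 < ν) {A : ℝ≥0} {Φ₀ : ℝ≥0}
    (hXc : ∀ s t, 0 ≤ s → s ≤ t → t ≤ τ → rVariation r X (Icc s t) ≤ A * ENNReal.ofReal (t - s) ^ ν)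
    {Y : ℝ → F} (hY : ∀ s t, 0 ≤ s → s ≤ t → t ≤ τ →
      edist (Y s) (Y t) ≤ 2 * Φ₀ * rVariation r X (Icc s t)) : ContinuousOn Y (Icc 0 τ) := by
  have h1 : ∀ s t, 0 ≤ s → s ≤ t → t ≤ τ →
      edist (Y s) (Y t) ≤ ((2 * Φ₀ * A : ℝ≥0) : ℝ≥0∞) * edist s t ^ ν := by
    intro s t hs hst ht
    refine (hY s t hs hst ht).trans ?_
    rw [edist_comm s t, edist_dist, Real.dist_eq, abs_of_nonneg (by linarith)]
    push_cast
    rw [mul_assoc (2 * (Φ₀ : ℝ≥0∞))]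
    gcongr
    exact hXc s t hs hst ht
  have h2 : HolderOnWith (2 * Φ₀ * A) ν.toNNReal Y (Icc 0 τ) := by
    intro s hs t ht
    rw [Real.coe_toNNReal _ hν.le]
    rcases le_total s t with h | h
    · exact h1 s t hs.1 h ht.2
    · rw [edist_comm, edist_comm s]
      exact h1 t s ht.1 h hs.2
  exact h2.continuousOn (by simpa using hν)

section Primitive

variable {E F : Type*} [NormedAddCommGroup E] [NormedSpace ℝ E] [NormedAddCommGroup F]
  [NormedSpace ℝ F]

theorem IsYoungPrimitive.apply_zero {f : ℝ → E →L[ℝ] F} {X : ℝ → E} {y₀ : F} {T : ℝ} {Y : ℝ → F}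
    (h : IsYoungPrimitive f X y₀ T Y) (hT : 0 ≤ T) : Y 0 = y₀ :=
  sub_eq_zero.1 (hasYoungIntegral_self_iff.1 (h 0 ⟨le_rfl, hT⟩))

theorem isYoungSolution_iff {φ : F → E →L[ℝ] F} {X : ℝ → E} {y₀ : F} {T : ℝ} {Y : ℝ → F} :
    IsYoungSolution φ X y₀ T Y ↔ IsYoungPrimitive (φ ∘ Y) X y₀ T Y := Iff.rfl

theorem enorm_le_of_norm_le {φ : F → E →L[ℝ] F} {Φ₀ : ℝ≥0} (h : ∀ x, ‖φ x‖ ≤ Φ₀) (x : F) :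
    ‖φ x‖ₑ ≤ Φ₀ := by
  rw [enorm_eq_nnnorm, ENNReal.coe_le_coe]
  exact h x

variable {β : ℝ≥0} {r : ℝ} (hβ : 0 < β) (hr : 1 ≤ r) (hrβ : r < 1 + β)

include hβ hr hrβ

/-- Local form of the estimate for indefinite integrals. -/
theorem IsYoungPrimitive.edist_le {φ : F → E →L[ℝ] F} {Φ₀ Φβ : ℝ≥0} (hφ : HolderBound₀ β Φ₀ Φβ φ)
    {X : ℝ → E} {y₀ : F} {τ : ℝ} {Y Z : ℝ → F} (h : IsYoungPrimitive (φ ∘ Z) X y₀ τ Y) {s t : ℝ}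
    (hs : 0 ≤ s) (hst : s ≤ t) (ht : t ≤ τ) :
    edist (Y s) (Y t) ≤ (Φ₀ + sewConst β r * (Φβ * rVariation r Z (Icc 0 τ) ^ (β : ℝ))) *
      rVariation r X (Icc s t) := by
  have hr0 : 0 < r := by linarith
  have hβ0 : (0 : ℝ) < β := by exact_mod_cast hβ
  have hθ := one_lt_theta hr hrβ
  rw [← theta_eq hr hβ] at hθ
  have h1 := (h s ⟨hs, hst.trans ht⟩).enorm_sub_le (div_pos hr0 hβ0) hr0 hθ hs hst
    (h t ⟨hs.trans hst, ht⟩)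
  rw [theta_eq hr hβ, sub_sub_sub_cancel_right, ← edist_eq_enorm_sub, edist_comm] at h1
  refine h1.trans ?_
  have h2 : rVariation (r / β) (φ ∘ Z) (Icc s t) ≤ Φβ * rVariation r Z (Icc 0 τ) ^ (β : ℝ) := by
    refine (rVariation_holder_comp_le hφ.holder hβ hr0).trans ?_
    gcongr
    exact rVariation_mono hr0 (Icc_subset_Icc hs ht)
  refine mul_le_mul' (add_le_add (enorm_le_of_norm_le hφ.sup_le _) (mul_le_mul' ?_ h2)) le_rfl
  exact_mod_cast zetaSum_le_sewConst hr hrβ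

section

variable {Φ₀ Φβ Φ₁ Φ₁β ε : ℝ≥0} (hε : IsSmall β r Φ₀ Φβ Φ₁ Φ₁β ε) (hΦ₀ : 0 < Φ₀)

include hε hΦ₀

omit hr hrβ in
theorem IsSmall.coe_holder_le {v : ℝ≥0∞} (hv : v ≤ (2 * Φ₀ * ε : ℝ≥0)) :
    (Φ₀ : ℝ≥0∞) + sewConst β r * (Φβ * v ^ (β : ℝ)) ≤ 2 * Φ₀ := by
  have h1 : (sewConst β r : ℝ≥0∞) * (Φβ * v ^ (β : ℝ)) ≤ Φ₀ := by
    calc (sewConst β r : ℝ≥0∞) * (Φβ * v ^ (β : ℝ))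
        ≤ sewConst β r * (Φβ * ((2 * Φ₀ * ε : ℝ≥0) : ℝ≥0∞) ^ (β : ℝ)) := by gcongr
      _ = ((sewConst β r * (Φβ * (2 * Φ₀ * ε) ^ (β : ℝ)) : ℝ≥0) : ℝ≥0∞) := by
        rw [← ENNReal.coe_rpow_of_nonneg _ β.coe_nonneg]; push_cast; rfl
      _ ≤ Φ₀ := by exact_mod_cast hε.holder_le hΦ₀
  rw [two_mul]
  exact add_le_add le_rfl h1

theorem IsYoungPrimitive.edist_le_of_isSmall {φ : F → E →L[ℝ] F} (hφ : HolderBound₀ β Φ₀ Φβ φ)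
    {X : ℝ → E} {y₀ : F} {τ : ℝ} {Y Z : ℝ → F} (h : IsYoungPrimitive (φ ∘ Z) X y₀ τ Y)
    (hZ : rVariation r Z (Icc 0 τ) ≤ (2 * Φ₀ * ε : ℝ≥0)) {s t : ℝ}
    (hs : 0 ≤ s) (hst : s ≤ t) (ht : t ≤ τ) :
    edist (Y s) (Y t) ≤ 2 * Φ₀ * rVariation r X (Icc s t) :=
  (h.edist_le hβ hr hrβ hφ hs hst ht).trans
    (mul_le_mul' (hε.coe_holder_le hβ hΦ₀ hZ) le_rfl)

theorem IsYoungPrimitive.rVariation_le {φ : F → E →L[ℝ] F} (hφ : HolderBound₀ β Φ₀ Φβ φ)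
    {X : ℝ → E} {y₀ : F} {τ : ℝ} {Y Z : ℝ → F} (h : IsYoungPrimitive (φ ∘ Z) X y₀ τ Y)
    (hZ : rVariation r Z (Icc 0 τ) ≤ (2 * Φ₀ * ε : ℝ≥0)) (hX : rVariation r X (Icc 0 τ) ≤ ε) :
    rVariation r Y (Icc 0 τ) ≤ (2 * Φ₀ * ε : ℝ≥0) := by
  have := rVariation_le_of_edist_le (I := Icc 0 τ) (g := X) (f := X) (c := 2 * Φ₀) (d := 0) hr
    (fun s hs t ht hst =>
      (h.edist_le_of_isSmall hβ hr hrβ hε hΦ₀ hφ hZ hs.1 hst ht.2).trans (by simp))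
  refine this.trans ?_
  push_cast
  rw [zero_mul, add_zero]
  gcongr

/-- A priori estimate: solutions of finite variation have small variation. -/
theorem IsYoungSolution.rVariation_le {φ : F → E →L[ℝ] F} (hφ : HolderBound₀ β Φ₀ Φβ φ)
    (hβ1 : β ≤ 1) {X : ℝ → E} {y₀ : F} {τ : ℝ} {Y : ℝ → F} (h : IsYoungSolution φ X y₀ τ Y)
    (hY : rVariation r Y (Icc 0 τ) ≠ ∞) (hX : rVariation r X (Icc 0 τ) ≤ ε) :
    rVariation r Y (Icc 0 τ) ≤ (2 * Φ₀ * ε : ℝ≥0) := by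
  rw [isYoungSolution_iff] at h
  have := rVariation_le_of_edist_le (I := Icc 0 τ) (g := X) (f := X)
    (c := Φ₀ + sewConst β r * (Φβ * rVariation r Y (Icc 0 τ) ^ (β : ℝ))) (d := 0) hr
    (fun s hs t ht hst =>
      (h.edist_le hβ hr hrβ hφ hs.1 hst ht.2).trans (by simp))
  rw [zero_mul, add_zero] at this
  lift rVariation r Y (Icc 0 τ) to ℝ≥0 using hY with v
  rw [ENNReal.coe_le_coe]
  refine hε.le_of_le_add hΦ₀ hβ1 ?_
  have h2 := this.trans (mul_le_mul' le_rfl hX)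
  rw [← ENNReal.coe_rpow_of_nonneg _ β.coe_nonneg] at h2
  exact_mod_cast h2

/-- Comparison of two indefinite integrals: the basic estimate behind the contraction property of
the Picard map and the stability of solutions. -/
theorem IsYoungPrimitive.edist_sub_le (hβ1 : β ≤ 1) {φ φ' : F → E →L[ℝ] F}
    (hφ : HolderBound₁ β Φ₀ Φβ Φ₁ Φ₁β φ) (hφ' : HolderBound₀ β Φ₀ Φβ φ')
    {X X' : ℝ → E} {y₀ y₀' : F} {τ : ℝ} {Y Y' Z Z' : ℝ → F}
    (h : IsYoungPrimitive (φ ∘ Z) X y₀ τ Y) (h' : IsYoungPrimitive (φ' ∘ Z') X' y₀' τ Y')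
    (hZ : rVariation r Z (Icc 0 τ) ≤ (2 * Φ₀ * ε : ℝ≥0))
    (hZ' : rVariation r Z' (Icc 0 τ) ≤ (2 * Φ₀ * ε : ℝ≥0)) {S : ℝ≥0∞}
    (hS : ∀ t ∈ Icc 0 τ, edist (Z t) (Z' t) ≤ S) {s t : ℝ}
    (hs : 0 ≤ s) (hst : s ≤ t) (ht : t ≤ τ) :
    edist ((Y - Y') s) ((Y - Y') t) ≤
      (Φ₁ * S + eSupNorm (φ - φ') + (sewConst β r * Φ₁ * rVariation r (Z - Z') (Icc 0 τ) +
        youngK β r Φ₀ Φ₁β ε * S + youngL β r Φ₀ ε * eHolderNorm β (φ - φ'))) *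
          rVariation r X (Icc s t) + 2 * Φ₀ * rVariation r (X - X') (Icc s t) := by
  have hr0 : 0 < r := by linarith
  have hβ0 : (0 : ℝ) < β := by exact_mod_cast hβ
  have hra : r ≤ r / β := (le_div_iff₀ hβ0).2
    (mul_le_of_le_one_right hr0.le (by exact_mod_cast hβ1))
  have hθ := one_lt_theta hr hrβ
  rw [← theta_eq hr hβ] at hθ
  have hsub : Icc s t ⊆ Icc 0 τ := Icc_subset_Icc hs ht
  have hζ : (zetaSum ((1 + β) / r) : ℝ≥0∞) ≤ sewConst β r := by
    exact_mod_cast zetaSum_le_sewConst hr hrβ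
  have h1 := (h s ⟨hs, hst.trans ht⟩).enorm_sub_sub_le (div_pos hr0 hβ0) hr0 hθ hs hst
    (h t ⟨hs.trans hst, ht⟩) (h' s ⟨hs, hst.trans ht⟩) (h' t ⟨hs.trans hst, ht⟩)
  rw [theta_eq hr hβ, sub_sub_sub_cancel_right, sub_sub_sub_cancel_right, sub_sub_sub_comm,
    ← edist_eq_enorm_sub, edist_comm] at h1
  refine h1.trans (add_le_add (mul_le_mul' ?_ le_rfl) (mul_le_mul' ?_ le_rfl))
  · refine add_le_add ?_ ?_
    · have e : (φ ∘ Z) s - (φ' ∘ Z') s = (φ (Z s) - φ (Z' s)) + (φ - φ') (Z' s) := by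
        simp
      rw [e]
      have htri : ∀ v w : E →L[ℝ] F, ‖v + w‖ₑ ≤ ‖v‖ₑ + ‖w‖ₑ := fun v w => by
        simp only [enorm_eq_nnnorm]
        exact_mod_cast nnnorm_add_le v w
      refine (htri _ _).trans (add_le_add ?_ ?_)
      swap
      · exact le_iSup (fun x => ‖(φ - φ') x‖ₑ) (Z' s)
      rw [← edist_eq_enorm_sub]
      refine (hφ.edist_le _ _).trans ?_
      gcongr
      exact hS s ⟨hs, hst.trans ht⟩
    · have e : φ ∘ Z - φ' ∘ Z' = (φ ∘ Z - φ ∘ Z') + (φ - φ') ∘ Z' := by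
        ext; simp
      have h2 := hφ.rVariation_comp_sub_comp_le hβ hβ1 hr (Y := Z) (Z := Z') (I := Icc s t)
        (S := S) (fun x hx => hS x (hsub hx))
      have hmem : MemHolder β (φ - φ') :=
        memHolder_sub ⟨Φβ, hφ.holder⟩ ⟨Φβ, hφ'.holder⟩
      have h3 := rVariation_holder_comp_le (I := Icc s t) hmem.holderWith hβ hr0 (f := Z')
      rw [hmem.coe_nnHolderNorm_eq_eHolderNorm] at h3
      have hv : ∀ {W : ℝ → F}, rVariation r W (Icc 0 τ) ≤ (2 * Φ₀ * ε : ℝ≥0) →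
          rVariation r W (Icc s t) ^ (β : ℝ) ≤ (((2 * Φ₀ * ε) ^ (β : ℝ) : ℝ≥0) : ℝ≥0∞) := by
        intro W hW
        rw [ENNReal.coe_rpow_of_nonneg _ β.coe_nonneg]
        exact ENNReal.rpow_le_rpow ((rVariation_mono hr0 hsub).trans hW) hβ0.le
      set m : ℝ≥0 := (2 * Φ₀ * ε) ^ (β : ℝ) with hm
      calc (zetaSum ((1 + β) / r) : ℝ≥0∞) * rVariation (r / β) (φ ∘ Z - φ' ∘ Z') (Icc s t)
          ≤ sewConst β r * ((Φ₁ * rVariation r (Z - Z') (Icc 0 τ) +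
            (Φ₁β / (1 + β) : ℝ≥0) * (m + m) * S) + eHolderNorm β (φ - φ') * m) := by
            refine mul_le_mul' hζ ?_
            rw [e]
            refine (rVariation_add_le (hr.trans hra)).trans (add_le_add (h2.trans ?_) (h3.trans ?_))
            · refine add_le_add (mul_le_mul' le_rfl (rVariation_mono hr0 hsub)) ?_
              exact mul_le_mul' (mul_le_mul' le_rfl (add_le_add (hv hZ) (hv hZ'))) le_rfl
            · exact mul_le_mul' le_rfl (hv hZ')
        _ = _ := by
            rw [youngK_eq, youngL_eq, ← hm]
            push_cast
            ring
  · refine le_trans ?_ (hε.coe_holder_le hβ hΦ₀ hZ')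
    refine add_le_add (enorm_le_of_norm_le hφ'.sup_le _) (mul_le_mul' hζ ?_)
    refine (rVariation_holder_comp_le hφ'.holder hβ hr0).trans ?_
    gcongr
    exact rVariation_mono hr0 hsub

/-- The Picard map halves the distance in variation. -/
theorem IsYoungPrimitive.rVariation_sub_le (hβ1 : β ≤ 1) {φ : F → E →L[ℝ] F}
    (hφ : HolderBound₁ β Φ₀ Φβ Φ₁ Φ₁β φ) {X : ℝ → E} {y₀ : F} {τ : ℝ} (hτ : 0 ≤ τ)
    {Y Y' Z Z' : ℝ → F} (h : IsYoungPrimitive (φ ∘ Z) X y₀ τ Y)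
    (h' : IsYoungPrimitive (φ ∘ Z') X y₀ τ Y')
    (hZ : rVariation r Z (Icc 0 τ) ≤ (2 * Φ₀ * ε : ℝ≥0))
    (hZ' : rVariation r Z' (Icc 0 τ) ≤ (2 * Φ₀ * ε : ℝ≥0)) (h0 : Z 0 = Z' 0)
    (hX : rVariation r X (Icc 0 τ) ≤ ε) :
    rVariation r (Y - Y') (Icc 0 τ) ≤ 2⁻¹ * rVariation r (Z - Z') (Icc 0 τ) := by
  have hS := edist_le_rVariation_sub hr hτ h0
  have h1 := rVariation_le_of_edist_le (I := Icc 0 τ) hr (fun s hs t ht hst =>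
    h.edist_sub_le hβ hr hrβ hε hΦ₀ hβ1 hφ hφ.toHolderBound₀ h' hZ hZ' hS hs.1 hst ht.2)
  have hsup : eSupNorm (φ - φ) = 0 := by
    simp [eSupNorm, enorm]
  have hX0 : rVariation r (X - X) (Icc 0 τ) = 0 := by
    have hr0 : 0 < r := by linarith
    rw [rVariation_eq_incVariation, ← nonpos_iff_eq_zero, incVariation_le_iff hr0]
    simp [hr0]
  have hhol : eHolderNorm β (φ - φ) = 0 := by simp
  rw [hsup, hX0, hhol, mul_zero, add_zero, mul_zero, add_zero, add_zero] at h1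
  refine h1.trans ((mul_le_mul' le_rfl hX).trans ?_)
  set D := rVariation r (Z - Z') (Icc 0 τ)
  calc ((Φ₁ : ℝ≥0∞) * D + (sewConst β r * Φ₁ * D + youngK β r Φ₀ Φ₁β ε * D)) * ε
      = ((((sewConst β r + 1) * Φ₁ + youngK β r Φ₀ Φ₁β ε) * ε : ℝ≥0) : ℝ≥0∞) * D := by
        push_cast; ring
    _ ≤ ((1 / 2 : ℝ≥0) : ℝ≥0∞) * D := by
        gcongr
        exact hε.rate_le hr hrβ
    _ = _ := by simp

/-- Uniqueness of solutions of finite variation. -/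
theorem IsYoungSolution.eqOn (hβ1 : β ≤ 1) {φ : F → E →L[ℝ] F}
    (hφ : HolderBound₁ β Φ₀ Φβ Φ₁ Φ₁β φ) {X : ℝ → E} {y₀ : F} {τ : ℝ} (hτ : 0 ≤ τ)
    {Y Z : ℝ → F} (h : IsYoungSolution φ X y₀ τ Y) (h' : IsYoungSolution φ X y₀ τ Z)
    (hY : rVariation r Y (Icc 0 τ) ≠ ∞) (hZ : rVariation r Z (Icc 0 τ) ≠ ∞)
    (hX : rVariation r X (Icc 0 τ) ≤ ε) : EqOn Y Z (Icc 0 τ) := by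
  have hY' := h.rVariation_le hβ hr hrβ hε hΦ₀ hφ.toHolderBound₀ hβ1 hY hX
  have hZ' := h'.rVariation_le hβ hr hrβ hε hΦ₀ hφ.toHolderBound₀ hβ1 hZ hX
  rw [isYoungSolution_iff] at h h'
  have h0 : Y 0 = Z 0 := by rw [h.apply_zero hτ, h'.apply_zero hτ]
  have hD := h.rVariation_sub_le hβ hr hrβ hε hΦ₀ hβ1 hφ hτ h' hY' hZ' h0 hX
  have hDt : rVariation r (Y - Z) (Icc 0 τ) ≠ ∞ :=
    ((rVariation_sub_le hr).trans_lt (ENNReal.add_lt_top.2 ⟨hY.lt_top, hZ.lt_top⟩)).ne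
  have hD0 : rVariation r (Y - Z) (Icc 0 τ) = 0 := by
    lift rVariation r (Y - Z) (Icc 0 τ) to ℝ≥0 using hDt with D
    have : D ≤ 2⁻¹ * D := by
      have e : ((2⁻¹ * D : ℝ≥0) : ℝ≥0∞) = 2⁻¹ * (D : ℝ≥0∞) := by
        rw [ENNReal.coe_mul, ENNReal.coe_inv two_ne_zero]; rfl
      rw [← e] at hD
      exact_mod_cast hD
    have h2 : (D : ℝ) ≤ 2⁻¹ * D := by exact_mod_cast this
    have : D = 0 := by
      rw [← NNReal.coe_eq_zero]
      linarith [D.coe_nonneg]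
    simp [this]
  intro t ht
  have := edist_le_rVariation_sub hr hτ h0 t ht
  rw [hD0, nonpos_iff_eq_zero] at this
  exact edist_eq_zero.1 this

omit hε hΦ₀ in
/-- One step of the Picard iteration. -/
theorem exists_isYoungPrimitive [CompleteSpace F] (hβ1 : β ≤ 1) {φ : F → E →L[ℝ] F}
    (hφ : HolderBound₀ β Φ₀ Φβ φ) {X : ℝ → E} {τ : ℝ}
    (hX : rVariation r X (Icc 0 τ) ≤ ε) (y₀ : F) {Z : ℝ → F} (hZc : ContinuousOn Z (Icc 0 τ))
    (hZ : rVariation r Z (Icc 0 τ) ≤ (2 * Φ₀ * ε : ℝ≥0)) :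
    ∃ Y, IsYoungPrimitive (φ ∘ Z) X y₀ τ Y := by
  have hr0 : 0 < r := by linarith
  have hβ0 : (0 : ℝ) < β := by exact_mod_cast hβ
  have hra : r ≤ r / β := (le_div_iff₀ hβ0).2
    (mul_le_of_le_one_right hr0.le (by exact_mod_cast hβ1))
  have hθ := one_lt_theta hr hrβ
  rw [← theta_eq hr hβ] at hθ
  have key : ∀ t, ∃ I : F, t ∈ Icc 0 τ → HasYoungIntegral (φ ∘ Z) X 0 t I := by
    intro t
    by_cases ht : t ∈ Icc 0 τ
    · have hsub : Icc 0 t ⊆ Icc 0 τ := Icc_subset_Icc_right ht.2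
      obtain ⟨I, hI⟩ := exists_hasYoungIntegral (f := φ ∘ Z) (X := X) (hr.trans hra) hr0 hθ ht.1
        ((hφ.holder.continuous hβ).comp_continuousOn (hZc.mono hsub)) (by
          refine ne_top_of_le_ne_top ?_ (rVariation_holder_comp_le hφ.holder hβ hr0)
          refine ENNReal.mul_ne_top ENNReal.coe_ne_top
            (ENNReal.rpow_ne_top_of_nonneg hβ0.le ?_)
          exact ne_top_of_le_ne_top ENNReal.coe_ne_top ((rVariation_mono hr0 hsub).trans hZ))
        (ne_top_of_le_ne_top ENNReal.coe_ne_top ((rVariation_mono hr0 hsub).trans hX))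
      exact ⟨I, fun _ => hI⟩
    · exact ⟨0, fun h => absurd h ht⟩
  choose I hI using key
  refine ⟨fun t => y₀ + I t, fun t ht => ?_⟩
  simpa using hI t ht

/-- Existence of solutions, by Picard iteration. -/
theorem exists_isYoungSolution [CompleteSpace F] (hβ1 : β ≤ 1) {φ : F → E →L[ℝ] F}
    (hφ : HolderBound₁ β Φ₀ Φβ Φ₁ Φ₁β φ) {X : ℝ → E} {τ ν : ℝ} (hτ : 0 ≤ τ) (hν : 0 < ν) {A : ℝ≥0}
    (hXc : ∀ s t, 0 ≤ s → s ≤ t → t ≤ τ → rVariation r X (Icc s t) ≤ A * ENNReal.ofReal (t - s) ^ ν)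
    (hX : rVariation r X (Icc 0 τ) ≤ ε) (y₀ : F) :
    ∃ Y, IsYoungSolution φ X y₀ τ Y ∧ rVariation r Y (Icc 0 τ) ≤ (2 * Φ₀ * ε : ℝ≥0) := by
  have hr0 : 0 < r := by linarith
  -- the Picard map `Ψ` acts on the set `P` of continuous paths from `y₀` with variation at most
  -- `2 Φ₀ ε`
  let P : Type _ := {Z : ℝ → F // ContinuousOn Z (Icc 0 τ) ∧ Z 0 = y₀ ∧
    rVariation r Z (Icc 0 τ) ≤ (2 * Φ₀ * ε : ℝ≥0)}
  have step : ∀ Z : P, ∃ Y : P, IsYoungPrimitive (φ ∘ Z.1) X y₀ τ Y.1 := by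
    rintro ⟨Z, hZc, hZ0, hZ⟩
    obtain ⟨Y, hY⟩ := exists_isYoungPrimitive hβ hr hrβ hβ1 hφ.toHolderBound₀ hX y₀ hZc hZ
    refine ⟨⟨Y, ?_, hY.apply_zero hτ, ?_⟩, hY⟩
    · exact continuousOn_of_edist_le hν hXc fun s t hs hst ht =>
        hY.edist_le_of_isSmall hβ hr hrβ hε hΦ₀ hφ.toHolderBound₀ hZ hs hst ht
    · exact hY.rVariation_le hβ hr hrβ hε hΦ₀ hφ.toHolderBound₀ hZ hX
  choose Ψ hΨ using step
  have hΨlip : ∀ Z Z' : P, rVariation r ((Ψ Z).1 - (Ψ Z').1) (Icc 0 τ) ≤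
      2⁻¹ * rVariation r (Z.1 - Z'.1) (Icc 0 τ) := fun Z Z' =>
    (hΨ Z).rVariation_sub_le hβ hr hrβ hε hΦ₀ hβ1 hφ hτ (hΨ Z') Z.2.2.2 Z'.2.2.2
      (by rw [Z.2.2.1, Z'.2.2.1]) hX
  let z₀ : P := ⟨fun _ => y₀, continuousOn_const, rfl, by
    rw [rVariation_eq_incVariation, incVariation_le_iff hr0]
    simp [hr0]⟩
  set M : ℝ≥0∞ := ((2 * Φ₀ * ε : ℝ≥0) : ℝ≥0∞) + (2 * Φ₀ * ε : ℝ≥0) with hM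
  have hMt : M ≠ ∞ := ENNReal.add_ne_top.2 ⟨ENNReal.coe_ne_top, ENNReal.coe_ne_top⟩
  have hit : ∀ n k, rVariation r ((Ψ^[n + k] z₀).1 - (Ψ^[n] z₀).1) (Icc 0 τ) ≤ 2⁻¹ ^ n * M := by
    intro n
    induction n with
    | zero =>
      intro k
      rw [pow_zero, one_mul]
      exact (rVariation_sub_le hr).trans (add_le_add (Ψ^[0 + k] z₀).2.2.2 (Ψ^[0] z₀).2.2.2)
    | succ n ih =>
      intro k
      rw [add_right_comm, Function.iterate_succ_apply', Function.iterate_succ_apply']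
      refine (hΨlip _ _).trans ((mul_le_mul' le_rfl (ih k)).trans (le_of_eq ?_))
      ring
  have hgeo : Tendsto (fun n : ℕ => (2⁻¹ : ℝ≥0∞) ^ n * M) atTop (𝓝 0) := by
    have := ENNReal.Tendsto.mul_const (ENNReal.tendsto_pow_atTop_nhds_zero_of_lt_one
      (by simp : (2⁻¹ : ℝ≥0∞) < 1)) (Or.inr hMt)
    rwa [zero_mul] at this
  have hpt : ∀ t ∈ Icc 0 τ, ∀ n k, edist ((Ψ^[n + k] z₀).1 t) ((Ψ^[n] z₀).1 t) ≤ 2⁻¹ ^ n * M := by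
    intro t ht n k
    exact (edist_le_rVariation_sub hr hτ
      (by rw [(Ψ^[n + k] z₀).2.2.1, (Ψ^[n] z₀).2.2.1]) t ht).trans (hit n k)
  have hlim : ∀ t, ∃ y, t ∈ Icc 0 τ → Tendsto (fun n => (Ψ^[n] z₀).1 t) atTop (𝓝 y) := by
    intro t
    by_cases ht : t ∈ Icc 0 τ
    · have : CauchySeq fun n => (Ψ^[n] z₀).1 t := by
        rw [EMetric.cauchySeq_iff']
        intro δ hδ
        obtain ⟨N, hN⟩ := (hgeo.eventually (gt_mem_nhds hδ)).exists
        refine ⟨N, fun n hn => ?_⟩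
        obtain ⟨k, rfl⟩ := Nat.exists_eq_add_of_le hn
        exact (hpt t ht N k).trans_lt hN
      obtain ⟨y, hy⟩ := cauchySeq_tendsto_of_complete this
      exact ⟨y, fun _ => hy⟩
    · exact ⟨0, fun h => absurd h ht⟩
  choose Y hY using hlim
  -- by lower semicontinuity of the variation, the pointwise limit lies in `P`, and the iterates
  -- converge to it in variation
  have hYV : rVariation r Y (Icc 0 τ) ≤ (2 * Φ₀ * ε : ℝ≥0) :=
    rVariation_le_of_tendsto hr0 hY (Eventually.of_forall fun n => (Ψ^[n] z₀).2.2.2)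
  have hYn : ∀ n, rVariation r (Y - (Ψ^[n] z₀).1) (Icc 0 τ) ≤ 2⁻¹ ^ n * M := by
    intro n
    refine rVariation_le_of_tendsto (f := fun k => (Ψ^[n + k] z₀).1 - (Ψ^[n] z₀).1) (l := atTop)
      hr0 (fun t ht => ?_) (Eventually.of_forall fun k => hit n k)
    have := (hY t ht).comp (tendsto_add_atTop_nat n)
    simp only [Function.comp_def, add_comm _ n] at this
    exact this.sub_const _
  have hY0 : Y 0 = y₀ := by
    refine tendsto_nhds_unique (hY 0 ⟨le_rfl, hτ⟩) ?_
    simp only [(Ψ^[_] z₀).2.2.1]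
    exact tendsto_const_nhds
  have hYc : ContinuousOn Y (Icc 0 τ) := by
    refine continuousOn_of_edist_le (Φ₀ := Φ₀) hν hXc fun s t hs hst ht => ?_
    refine le_of_tendsto (((hY s ⟨hs, hst.trans ht⟩).edist (hY t ⟨hs.trans hst, ht⟩))) ?_
    filter_upwards [eventually_ge_atTop 1] with n hn
    obtain ⟨m, rfl⟩ := Nat.exists_eq_add_of_le' hn
    rw [Function.iterate_succ_apply']
    exact (hΨ _).edist_le_of_isSmall hβ hr hrβ hε hΦ₀ hφ.toHolderBound₀ (Ψ^[m] z₀).2.2.2 hs hst ht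
  let y : P := ⟨Y, hYc, hY0, hYV⟩
  have hfix : EqOn (Ψ y).1 Y (Icc 0 τ) := by
    intro t ht
    refine tendsto_nhds_unique ?_ ((tendsto_add_atTop_iff_nat 1).2 (hY t ht))
    rw [tendsto_iff_edist_tendsto_0]
    refine tendsto_of_tendsto_of_tendsto_of_le_of_le tendsto_const_nhds hgeo (fun _ => zero_le)
      fun n => ?_
    dsimp only
    rw [Function.iterate_succ_apply', edist_comm]
    refine (edist_le_rVariation_sub hr hτ
      (by rw [(Ψ y).2.2.1, (Ψ (Ψ^[n] z₀)).2.2.1]) t ht).trans ((hΨlip _ _).trans ?_)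
    refine (mul_le_of_le_one_left zero_le (by simp)).trans (hYn n)
  refine ⟨Y, fun t ht => ?_, hYV⟩
  rw [← hfix ht]
  exact hΨ y t ht

/-- Stability of solutions with respect to the data, in terms of variations. The bound is local in
`[s, t]`, up to the global quantity `γ̃`. -/
theorem IsYoungSolution.edist_sub_le (hβ1 : β ≤ 1) {φ φ' : F → E →L[ℝ] F}
    (hφ : HolderBound₁ β Φ₀ Φβ Φ₁ Φ₁β φ) (hφ' : HolderBound₀ β Φ₀ Φβ φ')
    {X X' : ℝ → E} {y₀ y₀' : F} {τ : ℝ} (hτ : 0 ≤ τ) {Y Y' : ℝ → F}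
    (h : IsYoungSolution φ X y₀ τ Y) (h' : IsYoungSolution φ' X' y₀' τ Y')
    (hY : rVariation r Y (Icc 0 τ) ≠ ∞) (hY' : rVariation r Y' (Icc 0 τ) ≠ ∞)
    (hX : rVariation r X (Icc 0 τ) ≤ ε) (hX' : rVariation r X' (Icc 0 τ) ≤ ε) {s t : ℝ}
    (hs : 0 ≤ s) (hst : s ≤ t) (ht : t ≤ τ) :
    edist ((Y - Y') s) ((Y - Y') t) ≤
      4 * gammaTilde β r Φ₀ Φ₁ Φ₁β ε (rVariation r (X - X') (Icc 0 τ)) ‖y₀ - y₀'‖ₑ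
        (eHolderNorm β (φ - φ')) (eSupNorm (φ - φ')) * rVariation r X (Icc s t) +
      2 * Φ₀ * rVariation r (X - X') (Icc s t) := by
  have hVY := h.rVariation_le hβ hr hrβ hε hΦ₀ hφ.toHolderBound₀ hβ1 hY hX
  have hVY' := h'.rVariation_le hβ hr hrβ hε hΦ₀ hφ' hβ1 hY' hX'
  rw [isYoungSolution_iff] at h h'
  set D := rVariation r (Y - Y') (Icc 0 τ) with hD
  have hDt : D ≠ ∞ :=
    ((rVariation_sub_le hr).trans_lt (ENNReal.add_lt_top.2 ⟨hY.lt_top, hY'.lt_top⟩)).ne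
  set y := ‖y₀ - y₀'‖ₑ with hy
  have hS : ∀ t ∈ Icc 0 τ, edist (Y t) (Y' t) ≤ y + D := by
    intro t ht
    have h1 := edist_le_rVariation (f := Y - Y') (r := r) (by linarith)
      ht (⟨le_rfl, hτ⟩ : (0 : ℝ) ∈ Icc 0 τ)
    rw [edist_eq_enorm_sub]
    have e : Y t - Y' t = (y₀ - y₀') + ((Y - Y') t - (Y - Y') 0) := by
      simp [h.apply_zero hτ, h'.apply_zero hτ]
    rw [e]
    refine (enorm_add_le _ _).trans (add_le_add le_rfl ?_)
    rwa [← edist_eq_enorm_sub]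
  have hloc := fun (s t : ℝ) (hs : 0 ≤ s) (hst : s ≤ t) (ht : t ≤ τ) =>
    h.edist_sub_le hβ hr hrβ hε hΦ₀ hβ1 hφ hφ' h' hVY hVY' hS hs hst ht
  have hglob := rVariation_le_of_edist_le (I := Icc 0 τ) hr
    fun s hs t ht hst => hloc s t hs.1 hst ht.2
  refine (hloc s t hs hst ht).trans (add_le_add (mul_le_mul' ?_ le_rfl) le_rfl)
  set a := eHolderNorm β (φ - φ')
  set b := eSupNorm (φ - φ')
  set v := rVariation r (X - X') (Icc 0 τ)
  set K := youngK β r Φ₀ Φ₁β ε with hK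
  set L := youngL β r Φ₀ ε with hL
  set p : ℝ≥0 := (sewConst β r + 1) * Φ₁ + K with hp
  set Q : ℝ≥0∞ := (K + Φ₁ : ℝ≥0) * y + L * a + b with hQ
  have hbr : (Φ₁ : ℝ≥0∞) * (y + D) + b + (sewConst β r * Φ₁ * D + K * (y + D) + L * a) =
      p * D + Q := by
    rw [hp, hQ]; push_cast; ring
  have hγ : gammaTilde β r Φ₀ Φ₁ Φ₁β ε v y a b = p * Φ₀ * v + Q := by
    simp only [gammaTilde, hp, hQ, hK, hL, youngK, youngL, add_assoc]
  rw [hbr] at hglob ⊢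
  rw [hγ]
  have hpε : (p : ℝ≥0∞) * ε ≤ 2⁻¹ := by
    have := hε.rate_le hr hrβ
    rw [← hK, ← hp] at this
    have : ((p * ε : ℝ≥0) : ℝ≥0∞) ≤ ((1 / 2 : ℝ≥0) : ℝ≥0∞) := by exact_mod_cast this
    simpa using this
  -- absorb the variation of the difference into the left-hand side
  have hD1 : D ≤ 2⁻¹ * D + (ε * Q + 2 * Φ₀ * v) := by
    calc D ≤ (p * D + Q) * rVariation r X (Icc 0 τ) + 2 * Φ₀ * v := hglob
      _ ≤ (p * D + Q) * ε + 2 * Φ₀ * v := by gcongr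
      _ = (p * ε) * D + (ε * Q + 2 * Φ₀ * v) := by ring
      _ ≤ _ := by gcongr
  have hD2 : D ≤ 2 * (ε * Q + 2 * Φ₀ * v) := by
    have e : D = 2⁻¹ * D + 2⁻¹ * D := by
      rw [← add_mul, ENNReal.inv_two_add_inv_two, one_mul]
    have hfin : 2⁻¹ * D ≠ ∞ := ENNReal.mul_ne_top (by simp) hDt
    have h3 : 2⁻¹ * D ≤ ε * Q + 2 * Φ₀ * v := by
      refine (ENNReal.add_le_add_iff_left hfin).1 ?_
      rwa [← e]
    calc D = 2 * (2⁻¹ * D) := by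
          rw [← mul_assoc, ENNReal.mul_inv_cancel two_ne_zero ENNReal.ofNat_ne_top, one_mul]
      _ ≤ _ := by gcongr
  calc (p : ℝ≥0∞) * D + Q ≤ p * (2 * (ε * Q + 2 * Φ₀ * v)) + Q := by gcongr
    _ = 2 * (p * ε) * Q + Q + 4 * (p * Φ₀ * v) := by ring
    _ ≤ 2 * 2⁻¹ * Q + Q + 4 * (p * Φ₀ * v) := by gcongr
    _ = 2 * Q + 4 * (p * Φ₀ * v) := by
      rw [ENNReal.mul_inv_cancel two_ne_zero ENNReal.ofNat_ne_top]; ring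
    _ ≤ 4 * Q + 4 * (p * Φ₀ * v) := by gcongr; norm_num
    _ = 4 * (p * Φ₀ * v + Q) := by ring

end

end Primitive

/-! ### Dyadic bound of the variation -/

section Dyadic

variable {E : Type*} [NormedAddCommGroup E] {r : ℝ}

/-- If `N` is monotone with values in `{0, …, M - 1}`, it leaves, and enters, each value at most once
along an increasing sequence. -/
theorem incVariation_jump_le (hr : 0 < r) {N : ℝ → ℕ} {I : Set ℝ} (hN : MonotoneOn N I) {M : ℕ}
    (hM : ∀ x ∈ I, N x < M) (H : ℕ → ℝ≥0∞) :
    incVariation r (fun s t => if N s = N t then 0 else H (N s)) I ≤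
        (∑ n ∈ Finset.range M, H n ^ r) ^ (1 / r) ∧
      incVariation r (fun s t => if N s = N t then 0 else H (N t)) I ≤
        (∑ n ∈ Finset.range M, H n ^ r) ^ (1 / r) := by
  have key : ∀ (m : ℕ) (u : ℕ → ℝ) (w : ℕ → ℕ), Monotone u → (∀ i, u i ∈ I) →
      (∀ i, w i < M) → (∀ i j, i < j → N (u i) ≠ N (u (i + 1)) → N (u j) ≠ N (u (j + 1)) →
        w i ≠ w j) →
      ∑ i ∈ Finset.range m, (if N (u i) = N (u (i + 1)) then 0 else H (w i)) ^ r ≤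
        ∑ n ∈ Finset.range M, H n ^ r := by
    intro m u w hu hI hw hinj
    have e : ∀ i, (if N (u i) = N (u (i + 1)) then 0 else H (w i)) ^ r =
        if N (u i) ≠ N (u (i + 1)) then H (w i) ^ r else 0 := by
      intro i
      by_cases h : N (u i) = N (u (i + 1)) <;> simp [h, hr]
    simp_rw [e]
    rw [← Finset.sum_filter]
    have hinj' : Set.InjOn w ((Finset.range m).filter fun i => N (u i) ≠ N (u (i + 1))) := by
      intro i hi j hj hij
      have hi' := (Finset.mem_filter.1 (Finset.mem_coe.1 hi)).2
      have hj' := (Finset.mem_filter.1 (Finset.mem_coe.1 hj)).2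
      rcases lt_trichotomy i j with h | h | h
      · exact absurd hij (hinj i j h hi' hj')
      · exact h
      · exact absurd hij.symm (hinj j i h hj' hi')
    rw [← Finset.sum_image (f := fun n => H n ^ r) hinj']
    refine Finset.sum_le_sum_of_subset fun n hn => ?_
    obtain ⟨i, -, rfl⟩ := Finset.mem_image.1 hn
    exact Finset.mem_range.2 (hw i)
  have hNu : ∀ u : ℕ → ℝ, Monotone u → (∀ i, u i ∈ I) → Monotone fun i => N (u i) :=
    fun u hu hI i j hij => hN (hI i) (hI j) (hu hij)
  constructor
  · rw [incVariation_le_iff hr]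
    intro m u hu hI
    rw [← ENNReal.rpow_mul, one_div_mul_cancel hr.ne', ENNReal.rpow_one]
    refine key m u (fun i => N (u i)) hu hI (fun i => hM _ (hI i)) fun i j hij hi _ => ?_
    have h1 : N (u i) ≤ N (u (i + 1)) := hNu u hu hI (Nat.le_succ i)
    have h2 : N (u (i + 1)) ≤ N (u j) := hNu u hu hI hij
    omega
  · rw [incVariation_le_iff hr]
    intro m u hu hI
    rw [← ENNReal.rpow_mul, one_div_mul_cancel hr.ne', ENNReal.rpow_one]
    refine key m u (fun i => N (u (i + 1))) hu hI (fun i => hM _ (hI _)) fun i j hij _ hj => ?_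
    have h1 : N (u j) ≤ N (u (j + 1)) := hNu u hu hI (Nat.le_succ j)
    have h2 : N (u (i + 1)) ≤ N (u j) := hNu u hu hI hij
    omega

/-- The variation of a step function is bounded by the `ℓ^r` norm of its values. -/
theorem rVariation_step_le (hr : 1 ≤ r) {N : ℝ → ℕ} {I : Set ℝ} (hN : MonotoneOn N I) {M : ℕ}
    (hM : ∀ x ∈ I, N x < M) (H : ℕ → E) :
    rVariation r (H ∘ N) I ≤ 2 * (∑ n ∈ Finset.range M, ‖H n‖ₑ ^ r) ^ (1 / r) := by
  have hr0 : 0 < r := by linarith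
  obtain ⟨h1, h2⟩ := incVariation_jump_le hr0 hN hM (fun n => ‖H n‖ₑ)
  rw [two_mul]
  refine le_trans ?_ ((incVariation_add_le hr).trans (add_le_add h1 h2))
  rw [rVariation_eq_incVariation]
  refine incVariation_mono hr0 Subset.rfl fun s _ t _ _ => ?_
  by_cases h : N s = N t
  · simp [h]
  · simp only [h, if_false, Function.comp]
    rw [edist_eq_enorm_sub]
    exact enorm_sub_le

/-- The `ℓ^r` norm of the increments of `f` between the dyadic points of level `j` of
`[s, s + h]`. -/
def dyadicSum (r : ℝ) (f : ℝ → E) (h : ℝ) (j : ℕ) (s : ℝ) : ℝ≥0∞ :=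
  (∑ n ∈ Finset.range (2 ^ j), edist (f (s + n * (h / 2 ^ j))) (f (s + (n + 1) * (h / 2 ^ j))) ^ r)
    ^ (1 / r)

/-- The variation of a continuous path is controlled by its dyadic increments: the path is the
limit of the step functions which it induces on the dyadic grids, and the difference of two
successive ones is a step function the values of which are dyadic increments. -/
theorem rVariation_le_tsum_dyadicSum (hr : 1 ≤ r) {f : ℝ → E} {s h : ℝ} (hh : 0 < h)
    (hf : ContinuousOn f (Icc s (s + h))) :
    rVariation r f (Icc s (s + h)) ≤ ∑' j, 2 * dyadicSum r f h j s := by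
  have hr0 : 0 < r := by linarith
  set k : ℕ → ℝ := fun j => h / 2 ^ j with hk
  have hk0 : ∀ j, 0 < k j := fun j => by positivity
  set N : ℕ → ℝ → ℕ := fun j x => ⌊(x - s) / k j⌋₊ with hNdef
  have hNle : ∀ j, ∀ x ∈ Icc s (s + h), N j x < 2 ^ j + 1 := by
    intro j x hx
    refine Nat.lt_succ_of_le (Nat.floor_le_of_le ?_)
    rw [div_le_iff₀ (hk0 j)]
    simp only [hk]
    push_cast
    rw [mul_div_cancel₀ _ (by positivity)]
    linarith [hx.2]
  have hNmono : ∀ j, MonotoneOn (N j) (Icc s (s + h)) := by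
    intro j x _ y _ hxy
    have := hk0 j
    simp only [hNdef]
    gcongr
  have hNhalf : ∀ j x, N (j + 1) x / 2 = N j x := by
    intro j x
    simp only [hNdef]
    rw [← Nat.floor_div_natCast]
    congr 1
    simp only [hk]
    push_cast
    field_simp
    ring
  -- the step functions, the first one being constant
  set S : ℕ → ℝ → E := fun j x => f (s + ((N j x / 2 : ℕ) : ℝ) * (2 * k j)) with hS
  have hS' : ∀ j x, S (j + 1) x = f (s + N j x * k j) := by
    intro j x
    simp only [hS, hNhalf]
    congr 3
    simp only [hk]
    field_simp
    rw [pow_succ']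
  set H : ℕ → ℕ → E := fun j n => f (s + n * k j) - f (s + ((n / 2 : ℕ) : ℝ) * (2 * k j)) with hH
  have hdiff : ∀ j, S (j + 1) - S j = H j ∘ N j := by
    intro j
    ext x
    rw [Pi.sub_apply, hS']
    rfl
  have hHsum : ∀ j, ∑ n ∈ Finset.range (2 ^ j + 1), ‖H j n‖ₑ ^ r ≤
      ∑ n ∈ Finset.range (2 ^ j), edist (f (s + n * k j)) (f (s + (n + 1) * k j)) ^ r := by
    intro j
    rw [Finset.sum_range_succ']
    have h0 : ‖H j 0‖ₑ ^ r = 0 := by simp [hH, hr0]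
    rw [h0, add_zero]
    gcongr with n _
    rcases Nat.even_or_odd' n with ⟨m, rfl | rfl⟩
    · have e : (2 * m + 1) / 2 = m := by omega
      simp only [hH, e]
      rw [edist_comm, edist_eq_enorm_sub]
      push_cast
      refine le_of_eq ?_
      congr 3
      ring_nf
    · have e : (2 * m + 1 + 1) / 2 = m + 1 := by omega
      simp only [hH, e]
      have e2 : s + ((2 * m + 1 + 1 : ℕ) : ℝ) * k j = s + ((m + 1 : ℕ) : ℝ) * (2 * k j) := by
        push_cast; ring
      rw [e2, sub_self]
      simp
  have hV : ∀ j, rVariation r (S (j + 1) - S j) (Icc s (s + h)) ≤ 2 * dyadicSum r f h j s := by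
    intro j
    rw [hdiff]
    refine (rVariation_step_le hr (hNmono j) (hNle j) (H j)).trans ?_
    unfold dyadicSum
    gcongr
    exact hHsum j
  have hS0 : EqOn (S 0) (fun _ => f s) (Icc s (s + h)) := by
    intro x hx
    have := hNle 0 x hx
    have e : N 0 x / 2 = 0 := by omega
    simp [hS, e]
  have hSV : ∀ n, rVariation r (S n) (Icc s (s + h)) ≤ ∑' j, 2 * dyadicSum r f h j s := by
    intro n
    have e : S n = S 0 + ∑ j ∈ Finset.range n, (S (j + 1) - S j) := by
      rw [Finset.sum_range_sub]; abel
    rw [e]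
    refine (rVariation_add_le hr).trans ?_
    have h0 : rVariation r (S 0) (Icc s (s + h)) = 0 := by
      rw [rVariation_congr hS0, rVariation_eq_incVariation, ← nonpos_iff_eq_zero,
        incVariation_le_iff hr0]
      simp [hr0]
    rw [h0, zero_add]
    refine (rVariation_sum_le hr n).trans ?_
    exact (Finset.sum_le_sum fun j _ => hV j).trans (ENNReal.sum_le_tsum _)
  refine rVariation_le_of_tendsto (f := fun n => S (n + 1)) (l := atTop) hr0 (fun x hx => ?_)
    (Eventually.of_forall fun n => hSV (n + 1))
  simp only [hS']
  have hkt : Tendsto k atTop (𝓝 0) := by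
    have := (tendsto_pow_atTop_nhds_zero_of_lt_one (r := (1 / 2 : ℝ)) (by norm_num)
      (by norm_num)).const_mul h
    rw [mul_zero] at this
    refine this.congr fun j => ?_
    simp only [hk]
    rw [one_div, inv_pow]
    rfl
  have hxs : 0 ≤ x - s := by linarith [hx.1]
  have hlo : ∀ j, N j x * k j ≤ x - s := by
    intro j
    rw [← le_div_iff₀ (hk0 j)]
    exact Nat.floor_le (div_nonneg hxs (hk0 j).le)
  have hup : ∀ j, x - s < (N j x + 1) * k j := by
    intro j
    rw [← div_lt_iff₀ (hk0 j)]
    exact Nat.lt_floor_add_one _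
  have hpt : Tendsto (fun j => s + N j x * k j) atTop (𝓝 x) := by
    have h1 : Tendsto (fun j => x - k j) atTop (𝓝 x) := by
      simpa using hkt.const_sub x
    refine tendsto_of_tendsto_of_tendsto_of_le_of_le h1 tendsto_const_nhds
      (fun j => ?_) (fun j => ?_)
    · have := hup j
      simp only
      linarith
    · have := hlo j
      simp only
      linarith
  refine (hf x hx).tendsto.comp (tendsto_nhdsWithin_iff.2 ⟨hpt, Eventually.of_forall fun j => ?_⟩)
  have h1 := hlo j
  have h2 : 0 ≤ N j x * k j := mul_nonneg (Nat.cast_nonneg _) (hk0 j).le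
  exact ⟨by linarith, by linarith [hx.2]⟩

end Dyadic

/-! ### `L^p` norms of functions with values in `[0, ∞]` -/

section Lp

variable {Ω : Type*} [MeasurableSpace Ω] {μ : Measure Ω} {p : ℝ≥0∞}

theorem eLpNorm_eq_lintegral_rpow (hp0 : p ≠ 0) (hp : p ≠ ∞) (f : Ω → ℝ≥0∞) :
    eLpNorm f p μ = (∫⁻ x, f x ^ p.toReal ∂μ) ^ (1 / p.toReal) := by
  rw [eLpNorm_eq_lintegral_rpow_enorm_toReal hp0 hp]
  simp

theorem eLpNorm_le_iff_lintegral (hp0 : p ≠ 0) (hp : p ≠ ∞) {f : Ω → ℝ≥0∞} {C : ℝ≥0∞} :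
    eLpNorm f p μ ≤ C ↔ ∫⁻ x, f x ^ p.toReal ∂μ ≤ C ^ p.toReal := by
  rw [eLpNorm_eq_lintegral_rpow hp0 hp, one_div,
    ENNReal.rpow_inv_le_iff (ENNReal.toReal_pos hp0 hp)]

theorem eLpNorm_top_le_iff {f : Ω → ℝ≥0∞} {C : ℝ≥0∞} :
    eLpNorm f ∞ μ ≤ C ↔ ∀ᵐ x ∂μ, f x ≤ C := by
  rw [eLpNorm_exponent_top]
  constructor
  · intro h
    filter_upwards [enorm_ae_le_eLpNormEssSup f μ] with x hx
    exact (by simpa using hx : f x ≤ eLpNormEssSup f μ).trans h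
  · intro h
    exact essSup_le_of_ae_le _ (h.mono fun x hx => by simpa using hx)

theorem eLpNorm_mono_ennreal_ae {f g : Ω → ℝ≥0∞} (h : ∀ᵐ x ∂μ, f x ≤ g x) :
    eLpNorm f p μ ≤ eLpNorm g p μ :=
  eLpNorm_mono_enorm_ae (by simpa using h)

theorem eLpNorm_const_mul_ennreal {f : Ω → ℝ≥0∞} (hf : AEMeasurable f μ) (c : ℝ≥0∞) :
    eLpNorm (fun x => c * f x) p μ = c * eLpNorm f p μ := by
  by_cases hp0 : p = 0
  · simp [hp0]
  by_cases hp : p = ∞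
  · subst hp
    simp only [eLpNorm_exponent_top, eLpNormEssSup, enorm_eq_self]
    exact ENNReal.essSup_const_mul
  · rw [eLpNorm_eq_lintegral_rpow hp0 hp, eLpNorm_eq_lintegral_rpow hp0 hp]
    have hq := ENNReal.toReal_pos hp0 hp
    simp_rw [ENNReal.mul_rpow_of_nonneg _ _ hq.le]
    rw [lintegral_const_mul'' _ (hf.pow_const _), ENNReal.mul_rpow_of_nonneg _ _ (by positivity),
      ← ENNReal.rpow_mul, mul_one_div_cancel hq.ne', ENNReal.rpow_one]

/-- Minkowski's inequality for series. -/
theorem eLpNorm_tsum_le_tsum (hp : 1 ≤ p) {f : ℕ → Ω → ℝ≥0∞} (hf : ∀ j, AEMeasurable (f j) μ) :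
    eLpNorm (fun x => ∑' j, f j x) p μ ≤ ∑' j, eLpNorm (f j) p μ := by
  have hp0 : p ≠ 0 := (zero_lt_one.trans_le hp).ne'
  by_cases hpt : p = ∞
  · subst hpt
    rw [eLpNorm_top_le_iff]
    have h : ∀ᵐ x ∂μ, ∀ j, f j x ≤ eLpNorm (f j) ∞ μ := ae_all_iff.2 fun j =>
      eLpNorm_top_le_iff.1 le_rfl
    filter_upwards [h] with x hx
    exact ENNReal.tsum_le_tsum hx
  rw [eLpNorm_le_iff_lintegral hp0 hpt]
  have hP := ENNReal.toReal_pos hp0 hpt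
  have e : ∀ x, (∑' j, f j x) ^ p.toReal = ⨆ n, (∑ j ∈ Finset.range n, f j x) ^ p.toReal := by
    intro x
    rw [ENNReal.tsum_eq_iSup_nat]
    exact (ENNReal.orderIsoRpow p.toReal hP).map_iSup _
  simp_rw [e]
  rw [lintegral_iSup']
  · refine iSup_le fun n => ?_
    have h1 := eLpNorm_sum_le (s := Finset.range n) (f := f) (p := p) (μ := μ)
      (fun j _ => (hf j).aestronglyMeasurable) hp
    have h2 := h1.trans (ENNReal.sum_le_tsum (f := fun j => eLpNorm (f j) p μ) (Finset.range n))
    rw [eLpNorm_le_iff_lintegral hp0 hpt] at h2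
    simpa using h2
  · intro n
    exact (Finset.aemeasurable_fun_sum _ fun j _ => hf j).pow_const _
  · refine Eventually.of_forall fun x n m hnm => ?_
    exact ENNReal.rpow_le_rpow (Finset.sum_le_sum_of_subset (Finset.range_mono hnm)) hP.le

/-- Chebyshev's inequality in terms of `eLpNorm`, including `p = ∞`. -/
theorem mul_measure_rpow_le_eLpNorm (hp0 : p ≠ 0) {f : Ω → ℝ≥0∞} {A : Set Ω} (hA : MeasurableSet A)
    (hA0 : μ A ≠ 0) {c : ℝ≥0∞} (hc : ∀ x ∈ A, c ≤ f x) :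
    c * μ A ^ (1 / p.toReal) ≤ eLpNorm f p μ := by
  have h1 : eLpNorm (fun _ => c) p (μ.restrict A) = c * μ A ^ (1 / p.toReal) := by
    rw [eLpNorm_const c hp0 (by rwa [Ne, Measure.restrict_eq_zero])]
    simp
  rw [← h1]
  refine le_trans ?_ (eLpNorm_mono_measure f (Measure.restrict_le_self (s := A)))
  refine eLpNorm_mono_ennreal_ae ?_
  filter_upwards [ae_restrict_mem hA] with x hx using hc x hx

end Lp

/-! ### The Besov modulus of the variation -/

section Modulus

variable {E : Type*} [NormedAddCommGroup E] {p : ℝ≥0∞} {r T : ℝ}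

/-- The Besov modulus of a path. -/
def pathModulus (p : ℝ≥0∞) (T : ℝ) (f : ℝ → E) (t : ℝ) : ℝ≥0∞ :=
  besovModulus p T (fun s t => edist (f s) (f t)) t

theorem besovModulus_mono (p : ℝ≥0∞) (T : ℝ) (χ : ℝ → ℝ → ℝ≥0∞) :
    Monotone (besovModulus p T χ) := fun _ _ hst =>
  biSup_mono fun _ hh => ⟨hh.1, hh.2.trans hst⟩

theorem aemeasurable_edist_shift {f : ℝ → E} (hf : ContinuousOn f (Icc 0 T)) {x y h : ℝ}
    (hx : 0 ≤ x) (hy : 0 ≤ y) (hxh : x ≤ h) (hyh : y ≤ h) :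
    AEMeasurable (fun s => edist (f (s + x)) (f (s + y))) (volume.restrict (Ioc 0 (T - h))) := by
  have hc : ∀ z, 0 ≤ z → z ≤ h → ContinuousOn (fun s => f (s + z)) (Ioc 0 (T - h)) := by
    intro z hz hzh
    refine hf.comp (by fun_prop) fun s hs => ?_
    have h1 := hs.1
    have h2 := hs.2
    constructor <;> linarith
  have h1 : ContinuousOn (fun s => (f (s + x), f (s + y))) (Ioc 0 (T - h)) :=
    (hc x hx hxh).prodMk (hc y hy hyh)
  have h2 : ContinuousOn (fun s => edist (f (s + x)) (f (s + y))) (Ioc 0 (T - h)) :=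
    continuous_edist.comp_continuousOn h1
  exact h2.aemeasurable measurableSet_Ioc

/-- The increments of length `k` over the intervals `[s + x, s + x + k]` inside `[s, s + h]`, by
translation invariance of the Lebesgue measure. -/
theorem eLpNorm_edist_shift_le {f : ℝ → E} (hf : ContinuousOn f (Icc 0 T)) {x k h : ℝ}
    (hx : 0 ≤ x) (hk : 0 < k) (hxk : x + k ≤ h) :
    eLpNorm (fun s => edist (f (s + x)) (f (s + (x + k)))) p (volume.restrict (Ioc 0 (T - h))) ≤
      pathModulus p T f k := by
  have hmp : MeasurePreserving (fun s : ℝ => s + x) (volume.restrict (Ioc 0 (T - h)))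
      (volume.restrict (Ioc x (T - h + x))) := by
    have := (measurePreserving_add_right (volume : Measure ℝ) x).restrict_preimage
      (measurableSet_Ioc (a := x) (b := T - h + x))
    simpa using this
  have hsub : Ioc x (T - h + x) ⊆ Ioc 0 (T - k) := fun s hs =>
    ⟨by linarith [hs.1], by linarith [hs.2]⟩
  have hmeas : AEMeasurable (fun s => edist (f s) (f (s + k))) (volume.restrict (Ioc 0 (T - k))) := by
    simpa using aemeasurable_edist_shift hf (le_refl 0) hk.le hk.le le_rfl
  have h1 := eLpNorm_comp_measurePreserving (p := p)
    (hmeas.mono_measure (Measure.restrict_mono hsub le_rfl)).aestronglyMeasurable hmp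
  have e : (fun s => edist (f (s + x)) (f (s + (x + k)))) =
      (fun s => edist (f s) (f (s + k))) ∘ fun s => s + x := by
    ext s; simp only [Function.comp, add_assoc]
  rw [e, h1]
  refine (eLpNorm_mono_measure _ (Measure.restrict_mono hsub le_rfl)).trans ?_
  exact le_iSup₂ (f := fun h (_ : h ∈ Ioc 0 k) =>
    eLpNorm (fun s => edist (f s) (f (s + h))) p (volume.restrict (Ioc 0 (T - h)))) k ⟨hk, le_rfl⟩

theorem aemeasurable_dyadicSum {f : ℝ → E} (hf : ContinuousOn f (Icc 0 T)) {h : ℝ} (hh : 0 < h)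
    (j : ℕ) : AEMeasurable (dyadicSum r f h j) (volume.restrict (Ioc 0 (T - h))) := by
  refine AEMeasurable.pow_const (Finset.aemeasurable_fun_sum _ fun n hn => ?_) _
  have hn' : (n : ℝ) + 1 ≤ 2 ^ j := by exact_mod_cast Finset.mem_range.1 hn
  have hk : (n + 1 : ℝ) * (h / 2 ^ j) ≤ h := by
    rw [← mul_div_assoc, div_le_iff₀ (by positivity)]
    nlinarith
  have hk0 : 0 < h / 2 ^ j := by positivity
  exact (aemeasurable_edist_shift hf (by positivity) (by positivity)
    (by nlinarith) hk).pow_const _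

/-- There are `2 ^ j` increments, each with `L^p` norm at most the modulus; as `r ≤ p`, Hölder's
inequality for finite sums bounds their `ℓ^r` norm by their `ℓ^p` norm. -/
theorem eLpNorm_dyadicSum_le {f : ℝ → E} (hf : ContinuousOn f (Icc 0 T)) (hr : 1 ≤ r)
    (hrp : ENNReal.ofReal r ≤ p) {h : ℝ} (hh : 0 < h) (j : ℕ) :
    eLpNorm (dyadicSum r f h j) p (volume.restrict (Ioc 0 (T - h))) ≤
      ((2 : ℝ≥0∞) ^ j) ^ (1 / r) * pathModulus p T f (h / 2 ^ j) := by
  have hr0 : 0 < r := by linarith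
  have hp0 : p ≠ 0 := ((ENNReal.ofReal_pos.2 hr0).trans_le hrp).ne'
  set k := h / 2 ^ j with hk
  have hk0 : 0 < k := by positivity
  set W := pathModulus p T f k
  set d : ℕ → ℝ → ℝ≥0∞ := fun n s => edist (f (s + n * k)) (f (s + (n + 1) * k)) with hd
  have hnk : ∀ n ∈ Finset.range (2 ^ j), (n : ℝ) * k + k ≤ h := by
    intro n hn
    have hn' : (n : ℝ) + 1 ≤ 2 ^ j := by exact_mod_cast Finset.mem_range.1 hn
    have : (n + 1 : ℝ) * k ≤ h := by
      rw [hk, ← mul_div_assoc, div_le_iff₀ (by positivity)]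
      nlinarith
    linarith
  have hdW : ∀ n ∈ Finset.range (2 ^ j),
      eLpNorm (d n) p (volume.restrict (Ioc 0 (T - h))) ≤ W := by
    intro n hn
    have := eLpNorm_edist_shift_le (p := p) hf (x := n * k) (by positivity) hk0 (hnk n hn)
    simpa only [hd, add_mul, one_mul] using this
  have hdm : ∀ n ∈ Finset.range (2 ^ j), AEMeasurable (d n) (volume.restrict (Ioc 0 (T - h))) := by
    intro n hn
    have h1 := hnk n hn
    exact aemeasurable_edist_shift hf (by positivity) (by positivity) (by linarith) (by linarith)
  have hcard : ((Finset.range (2 ^ j)).card : ℝ≥0∞) = 2 ^ j := by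
    rw [Finset.card_range]; push_cast; rfl
  by_cases hpt : p = ∞
  · subst hpt
    rw [eLpNorm_top_le_iff]
    have h1 : ∀ᵐ s ∂(volume.restrict (Ioc 0 (T - h))), ∀ n ∈ Finset.range (2 ^ j), d n s ≤ W := by
      rw [Filter.eventually_all_finset]
      exact fun n hn => eLpNorm_top_le_iff.1 (hdW n hn)
    filter_upwards [h1] with s hs
    have h2 : ∑ n ∈ Finset.range (2 ^ j), d n s ^ r ≤ 2 ^ j * W ^ r := by
      rw [← hcard, ← nsmul_eq_mul, ← Finset.sum_const]
      refine Finset.sum_le_sum fun n hn => ?_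
      exact ENNReal.rpow_le_rpow (hs n hn) hr0.le
    refine (ENNReal.rpow_le_rpow h2 (by positivity : (0 : ℝ) ≤ 1 / r)).trans (le_of_eq ?_)
    rw [ENNReal.mul_rpow_of_nonneg _ _ (by positivity), ← ENNReal.rpow_mul,
      mul_one_div_cancel hr0.ne', ENNReal.rpow_one]
  · set P := p.toReal with hP
    have hP0 : 0 < P := ENNReal.toReal_pos hp0 hpt
    have hrP : r ≤ P := by
      have := ENNReal.toReal_mono hpt hrp
      rwa [ENNReal.toReal_ofReal hr0.le] at this
    have h1P : 1 ≤ P / r := (one_le_div hr0).2 hrP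
    rw [eLpNorm_le_iff_lintegral hp0 hpt]
    have hpow : ∀ s, dyadicSum r f h j s ^ P ≤
        ((2 : ℝ≥0∞) ^ j) ^ (P / r - 1) * ∑ n ∈ Finset.range (2 ^ j), d n s ^ P := by
      intro s
      have h2 := ENNReal.rpow_sum_le_const_mul_sum_rpow (Finset.range (2 ^ j))
        (fun n => d n s ^ r) h1P
      rw [hcard] at h2
      simp_rw [← ENNReal.rpow_mul, mul_div_cancel₀ P hr0.ne'] at h2
      refine le_trans (le_of_eq ?_) h2
      rw [dyadicSum, ← ENNReal.rpow_mul, one_div_mul_eq_div]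
    calc ∫⁻ s in Ioc 0 (T - h), dyadicSum r f h j s ^ P
        ≤ ∫⁻ s in Ioc 0 (T - h),
            ((2 : ℝ≥0∞) ^ j) ^ (P / r - 1) * ∑ n ∈ Finset.range (2 ^ j), d n s ^ P :=
          lintegral_mono hpow
      _ = ((2 : ℝ≥0∞) ^ j) ^ (P / r - 1) *
            ∑ n ∈ Finset.range (2 ^ j), ∫⁻ s in Ioc 0 (T - h), d n s ^ P := by
          rw [lintegral_const_mul'', lintegral_finsetSum']
          · exact fun n hn => (hdm n hn).pow_const _
          · exact Finset.aemeasurable_fun_sum _ fun n hn => (hdm n hn).pow_const _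
      _ ≤ ((2 : ℝ≥0∞) ^ j) ^ (P / r - 1) * ∑ _n ∈ Finset.range (2 ^ j), W ^ P := by
          gcongr with n hn
          exact (eLpNorm_le_iff_lintegral hp0 hpt).1 (hdW n hn)
      _ = (((2 : ℝ≥0∞) ^ j) ^ (1 / r) * W) ^ P := by
          rw [Finset.sum_const, nsmul_eq_mul, hcard, ← mul_assoc,
            ENNReal.mul_rpow_of_nonneg _ _ hP0.le, ← ENNReal.rpow_mul]
          congr 1
          have e : 1 / r * P = (P / r - 1) + 1 := by ring
          rw [e, ENNReal.rpow_add_of_nonneg _ _ (by linarith) zero_le_one, ENNReal.rpow_one]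

/-- The Besov modulus of a two-parameter function that is dominated by the variations of two paths,
in terms of the Besov moduli of these paths. -/
theorem besovModulus_le_tsum {X Z : ℝ → E} (hX : ContinuousOn X (Icc 0 T))
    (hZ : ContinuousOn Z (Icc 0 T)) (hr : 1 ≤ r) (hrp : ENNReal.ofReal r ≤ p) {a b : ℝ≥0∞}
    {χ : ℝ → ℝ → ℝ≥0∞} (hχ : ∀ s t, 0 ≤ s → s ≤ t → t ≤ T →
      χ s t ≤ a * rVariation r X (Icc s t) + b * rVariation r Z (Icc s t)) (t : ℝ) :
    besovModulus p T χ t ≤ ∑' j : ℕ, 2 * ((2 : ℝ≥0∞) ^ j) ^ (1 / r) *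
      (a * pathModulus p T X (t / 2 ^ j) + b * pathModulus p T Z (t / 2 ^ j)) := by
  have hp1 : 1 ≤ p := by
    refine le_trans ?_ hrp
    rw [← ENNReal.ofReal_one]
    exact ENNReal.ofReal_le_ofReal hr
  refine iSup₂_le fun h hh => ?_
  have hh0 : 0 < h := hh.1
  have h1 : ∀ᵐ s ∂(volume.restrict (Ioc 0 (T - h))), χ s (s + h) ≤
      ∑' j : ℕ, (2 * a * dyadicSum r X h j s + 2 * b * dyadicSum r Z h j s) := by
    filter_upwards [ae_restrict_mem measurableSet_Ioc] with s hs
    have hsT : s + h ≤ T := by linarith [hs.2]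
    have hsub : Icc s (s + h) ⊆ Icc 0 T := Icc_subset_Icc hs.1.le hsT
    refine (hχ s (s + h) hs.1.le (by linarith) hsT).trans ?_
    rw [ENNReal.tsum_add]
    refine add_le_add ?_ ?_
    · simp_rw [mul_comm 2 a, mul_assoc]
      rw [ENNReal.tsum_mul_left]
      gcongr
      exact rVariation_le_tsum_dyadicSum hr hh0 (hX.mono hsub)
    · simp_rw [mul_comm 2 b, mul_assoc]
      rw [ENNReal.tsum_mul_left]
      gcongr
      exact rVariation_le_tsum_dyadicSum hr hh0 (hZ.mono hsub)
  have hmX := fun j => aemeasurable_dyadicSum (r := r) hX hh0 j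
  have hmZ := fun j => aemeasurable_dyadicSum (r := r) hZ hh0 j
  refine (eLpNorm_mono_ennreal_ae h1).trans ((eLpNorm_tsum_le_tsum hp1 fun j =>
    ((hmX j).const_mul _).add ((hmZ j).const_mul _)).trans ?_)
  refine ENNReal.tsum_le_tsum fun j => ?_
  refine (eLpNorm_add_le ((hmX j).const_mul _).aestronglyMeasurable
    ((hmZ j).const_mul _).aestronglyMeasurable hp1).trans ?_
  rw [eLpNorm_const_mul_ennreal (hmX j), eLpNorm_const_mul_ennreal (hmZ j)]
  have hle : h / 2 ^ j ≤ t / 2 ^ j := by gcongr; exact hh.2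
  have h2 : ∀ Y : ℝ → E, pathModulus p T Y (h / 2 ^ j) ≤ pathModulus p T Y (t / 2 ^ j) :=
    fun Y => besovModulus_mono _ _ _ hle
  calc 2 * a * eLpNorm (dyadicSum r X h j) p (volume.restrict (Ioc 0 (T - h))) +
        2 * b * eLpNorm (dyadicSum r Z h j) p (volume.restrict (Ioc 0 (T - h)))
      ≤ 2 * a * (((2 : ℝ≥0∞) ^ j) ^ (1 / r) * pathModulus p T X (t / 2 ^ j)) +
        2 * b * (((2 : ℝ≥0∞) ^ j) ^ (1 / r) * pathModulus p T Z (t / 2 ^ j)) := by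
        gcongr
        · exact (eLpNorm_dyadicSum_le hX hr hrp hh0 j).trans (mul_le_mul' le_rfl (h2 X))
        · exact (eLpNorm_dyadicSum_le hZ hr hrp hh0 j).trans (mul_le_mul' le_rfl (h2 Z))
    _ = _ := by ring

end Modulus

/-! ### A Hardy inequality for the measure `dt / t` -/

theorem lintegral_dtOverT (T : ℝ) {f : ℝ → ℝ≥0∞} (hf : Measurable f) :
    ∫⁻ t, f t ∂(dtOverT T) = ∫⁻ t in Ioc 0 T, ENNReal.ofReal t⁻¹ * f t := by
  unfold dtOverT
  rw [lintegral_withDensity_eq_lintegral_mul _ (by fun_prop) hf]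
  rfl

/-- Scale invariance of `dt / t`. -/
theorem lintegral_dtOverT_div_le {T c : ℝ} (hc : 1 ≤ c) {f : ℝ → ℝ≥0∞} (hf : Measurable f) :
    ∫⁻ t, f (t / c) ∂(dtOverT T) ≤ ∫⁻ t, f t ∂(dtOverT T) := by
  have hc0 : 0 < c := by linarith
  have hfc : Measurable fun t => f (t / c) := hf.comp (measurable_id.div_const c)
  rw [lintegral_dtOverT T hf, lintegral_dtOverT T hfc]
  have himg : (fun t => c * t) '' Ioc 0 (T / c) = Ioc 0 T := by
    rw [image_mul_left_Ioc hc0, mul_zero, mul_div_cancel₀ _ hc0.ne']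
  rw [← himg, lintegral_image_eq_lintegral_abs_deriv_mul (f' := fun _ => c) measurableSet_Ioc
    (fun t _ => by simpa using ((hasDerivAt_id t).const_mul c).hasDerivWithinAt)
    (mul_right_injective₀ hc0.ne').injOn]
  rw [himg]
  calc ∫⁻ t in Ioc 0 (T / c), ENNReal.ofReal |c| * (ENNReal.ofReal (c * t)⁻¹ * f (c * t / c))
      = ∫⁻ t in Ioc 0 (T / c), ENNReal.ofReal t⁻¹ * f t := by
        refine setLIntegral_congr_fun measurableSet_Ioc fun t ht => ?_
        rw [mul_div_cancel_left₀ _ hc0.ne', ← mul_assoc, ← ENNReal.ofReal_mul (abs_nonneg c),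
          abs_of_pos hc0, mul_inv, mul_inv_cancel_left₀ hc0.ne']
    _ ≤ ∫⁻ t in Ioc 0 T, ENNReal.ofReal t⁻¹ * f t := by
        by_cases hT : 0 ≤ T
        · exact lintegral_mono_set (Ioc_subset_Ioc_right (div_le_self hT hc))
        · rw [Ioc_eq_empty (by rw [not_lt]; exact div_nonpos_of_nonpos_of_nonneg (by linarith) hc0.le)]
          simp

theorem ae_dtOverT_div {T c : ℝ} (hc : 1 ≤ c) {f : ℝ → ℝ≥0∞} (hf : Measurable f) {M : ℝ≥0∞}
    (h : ∀ᵐ t ∂(dtOverT T), f t ≤ M) : ∀ᵐ t ∂(dtOverT T), f (t / c) ≤ M := by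
  have hm : Measurable ({t | M < f t}.indicator (1 : ℝ → ℝ≥0∞)) :=
    measurable_one.indicator (measurableSet_lt measurable_const hf)
  have h0 : ∫⁻ t, {t | M < f t}.indicator (1 : ℝ → ℝ≥0∞) t ∂(dtOverT T) = 0 := by
    rw [lintegral_eq_zero_iff hm]
    filter_upwards [h] with t ht
    simp [ht]
  have h1 := le_antisymm ((lintegral_dtOverT_div_le hc hm).trans_eq h0) zero_le
  have hmc : Measurable fun t => {t | M < f t}.indicator (1 : ℝ → ℝ≥0∞) (t / c) :=
    hm.comp (measurable_id.div_const c)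
  rw [lintegral_eq_zero_iff hmc] at h1
  filter_upwards [h1] with t ht
  by_contra! hlt
  simp [hlt] at ht

/-- The constant of the Hardy inequality: the product of the `ℓ^1` norm and the `ℓ^q` norm of the
sequence `μ ^ j`. -/
def hardyConst (q μ : ℝ≥0∞) : ℝ≥0∞ :=
  (∑' j : ℕ, μ ^ j) *
    if q = ∞ then 1 else (∑' j : ℕ, (μ ^ q.toReal) ^ j) ^ (1 / q.toReal)

theorem hardyConst_ne_top {q μ : ℝ≥0∞} (hq : q ≠ 0) (hμ : μ < 1) : hardyConst q μ ≠ ∞ := by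
  have h : ∀ x : ℝ≥0∞, x < 1 → ∑' j : ℕ, x ^ j ≠ ∞ := by
    intro x hx
    rw [ENNReal.tsum_geometric, Ne, ENNReal.inv_eq_top, tsub_eq_zero_iff_le, not_le]
    exact hx
  refine ENNReal.mul_ne_top (h μ hμ) ?_
  split_ifs with hqt
  · exact ENNReal.one_ne_top
  · have hQ := ENNReal.toReal_pos hq hqt
    exact ENNReal.rpow_ne_top_of_nonneg (by positivity) (h _ (ENNReal.rpow_lt_one hμ hQ))

/-- A Hardy inequality in dyadic form, for all exponents `q ∈ (0, ∞]`. Half of the decay of the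
weights `μ ^ (2 j)` is used to replace the sum by a supremum, the `q`-th power of which is at most
the sum of the `q`-th powers. -/
theorem eLpNorm_tsum_dyadic_le {q μ : ℝ≥0∞} (hq : q ≠ 0) (hμ : μ ≤ 1) (T : ℝ) {G : ℝ → ℝ≥0∞}
    (hG : Measurable G) :
    eLpNorm (fun t => ∑' j : ℕ, (μ ^ 2) ^ j * G (t / 2 ^ j)) q (dtOverT T) ≤
      hardyConst q μ * eLpNorm G q (dtOverT T) := by
  have h2 : ∀ j : ℕ, (1 : ℝ) ≤ 2 ^ j := fun j => one_le_pow₀ one_le_two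
  have hsup : ∀ t, ∑' j : ℕ, (μ ^ 2) ^ j * G (t / 2 ^ j) ≤
      (∑' j : ℕ, μ ^ j) * ⨆ j : ℕ, μ ^ j * G (t / 2 ^ j) := by
    intro t
    rw [← ENNReal.tsum_mul_right]
    refine ENNReal.tsum_le_tsum fun j => ?_
    rw [← pow_mul, mul_comm 2 j, mul_two, pow_add, mul_assoc]
    gcongr
    exact le_iSup (fun j : ℕ => μ ^ j * G (t / 2 ^ j)) j
  by_cases hqt : q = ∞
  · subst hqt
    simp only [hardyConst, if_true, mul_one]
    rw [eLpNorm_top_le_iff]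
    have h3 : ∀ᵐ t ∂(dtOverT T), ∀ j : ℕ, G (t / 2 ^ j) ≤ eLpNorm G ∞ (dtOverT T) :=
      ae_all_iff.2 fun j => ae_dtOverT_div (h2 j) hG (eLpNorm_top_le_iff.1 le_rfl)
    filter_upwards [h3] with t ht
    refine (hsup t).trans (mul_le_mul' le_rfl (iSup_le fun j => ?_))
    exact (mul_le_of_le_one_left zero_le (pow_le_one₀ zero_le hμ)).trans (ht j)
  · set Q := q.toReal with hQdef
    have hQ : 0 < Q := ENNReal.toReal_pos hq hqt
    simp only [hardyConst, if_neg hqt]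
    rw [eLpNorm_le_iff_lintegral hq hqt, ← hQdef]
    have hpow : ∀ t, (∑' j : ℕ, (μ ^ 2) ^ j * G (t / 2 ^ j)) ^ Q ≤
        (∑' j : ℕ, μ ^ j) ^ Q * ∑' j : ℕ, (μ ^ Q) ^ j * G (t / 2 ^ j) ^ Q := by
      intro t
      refine (ENNReal.rpow_le_rpow (hsup t) hQ.le).trans ?_
      rw [ENNReal.mul_rpow_of_nonneg _ _ hQ.le]
      gcongr
      have e : (⨆ j : ℕ, μ ^ j * G (t / 2 ^ j)) ^ Q = ⨆ j : ℕ, (μ ^ j * G (t / 2 ^ j)) ^ Q :=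
        (ENNReal.orderIsoRpow Q hQ).map_iSup _
      rw [e]
      refine iSup_le fun j => ?_
      rw [ENNReal.mul_rpow_of_nonneg _ _ hQ.le]
      refine le_trans (le_of_eq ?_) (ENNReal.le_tsum j)
      congr 1
      rw [← ENNReal.rpow_natCast, ← ENNReal.rpow_mul, mul_comm, ENNReal.rpow_mul,
        ENNReal.rpow_natCast]
    have hGj : ∀ j : ℕ, Measurable fun t : ℝ => G (t / 2 ^ j) := fun j =>
      hG.comp (measurable_id.div_const _)
    calc ∫⁻ t, (∑' j : ℕ, (μ ^ 2) ^ j * G (t / 2 ^ j)) ^ Q ∂(dtOverT T)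
        ≤ ∫⁻ t, (∑' j : ℕ, μ ^ j) ^ Q * ∑' j : ℕ, (μ ^ Q) ^ j * G (t / 2 ^ j) ^ Q ∂(dtOverT T) :=
          lintegral_mono hpow
      _ = (∑' j : ℕ, μ ^ j) ^ Q *
            ∑' j : ℕ, (μ ^ Q) ^ j * ∫⁻ t, G (t / 2 ^ j) ^ Q ∂(dtOverT T) := by
          rw [lintegral_const_mul _ (Measurable.tsum fun j =>
            ((hGj j).pow_const Q).const_mul _), lintegral_tsum fun j =>
            (((hGj j).pow_const Q).const_mul _).aemeasurable]
          congr 2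
          ext j
          rw [lintegral_const_mul _ ((hGj j).pow_const Q)]
      _ ≤ (∑' j : ℕ, μ ^ j) ^ Q *
            ∑' j : ℕ, (μ ^ Q) ^ j * ∫⁻ t, G t ^ Q ∂(dtOverT T) := by
          refine mul_le_mul' le_rfl (ENNReal.tsum_le_tsum fun j => mul_le_mul' le_rfl ?_)
          exact lintegral_dtOverT_div_le (f := fun t => G t ^ Q) (h2 j) (hG.pow_const Q)
      _ = _ := by
          rw [ENNReal.tsum_mul_right, ENNReal.mul_rpow_of_nonneg _ _ hQ.le,
            ENNReal.mul_rpow_of_nonneg _ _ hQ.le, ← ENNReal.rpow_mul,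
            one_div_mul_cancel hQ.ne', ENNReal.rpow_one, eLpNorm_eq_lintegral_rpow hq hqt,
            ← ENNReal.rpow_mul, ← hQdef, one_div_mul_cancel hQ.ne', ENNReal.rpow_one, mul_assoc]

/-! ### Besov norms of functions dominated by variations -/

section Norm

variable {E : Type*} [NormedAddCommGroup E] {p q : ℝ≥0∞} {r α T : ℝ}

theorem measurable_besovModulus (p : ℝ≥0∞) (T : ℝ) (χ : ℝ → ℝ → ℝ≥0∞) :
    Measurable (besovModulus p T χ) := (besovModulus_mono p T χ).measurable

theorem measurable_besovModulus_div (p : ℝ≥0∞) (T α : ℝ) (χ : ℝ → ℝ → ℝ≥0∞) :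
    Measurable fun t => besovModulus p T χ t / ENNReal.ofReal (t ^ α) :=
  (measurable_besovModulus p T χ).div (by fun_prop)

theorem ae_dtOverT_mem (T : ℝ) : ∀ᵐ t ∂(dtOverT T), t ∈ Ioc 0 T :=
  (withDensity_absolutelyContinuous _ _).ae_le (ae_restrict_mem measurableSet_Ioc)

/-- The square root `2^{(1 / r - α) / 2}` of the ratio of the dyadic weights. -/
def dyadicRatio (α r : ℝ) : ℝ≥0∞ := 2 ^ ((1 / r - α) / 2)

theorem dyadicRatio_lt_one (h : 1 / r < α) : dyadicRatio α r < 1 :=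
  ENNReal.rpow_lt_one_of_one_lt_of_neg ENNReal.one_lt_two (by linarith)

theorem dyadicRatio_sq (α r : ℝ) : dyadicRatio α r ^ 2 = 2 ^ (1 / r) / 2 ^ α := by
  rw [dyadicRatio, ← ENNReal.rpow_natCast, ← ENNReal.rpow_mul,
    div_eq_mul_inv ((2 : ℝ≥0∞) ^ (1 / r)), ← ENNReal.rpow_neg,
    ← ENNReal.rpow_add _ _ two_ne_zero ENNReal.ofNat_ne_top]
  congr 1
  push_cast
  ring

/-- The constant in the comparison of the Besov norm of the variation with that of the path. The
factor `LpAddConst` is the constant of the quasi-triangle inequality in `L^q`, as `q < 1` is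
allowed. -/
def besovVariationConst (α r : ℝ) (q : ℝ≥0∞) : ℝ≥0∞ :=
  2 * hardyConst q (dyadicRatio α r) * ENNReal.LpAddConst q

theorem besovVariationConst_ne_top (hq : q ≠ 0) (h : 1 / r < α) :
    besovVariationConst α r q ≠ ∞ :=
  ENNReal.mul_ne_top (ENNReal.mul_ne_top ENNReal.ofNat_ne_top
    (hardyConst_ne_top hq (dyadicRatio_lt_one h))) (ENNReal.LpAddConst_lt_top q).ne

/-- The Besov norm of a two-parameter function that is dominated by the variations of two paths. -/
theorem besovNorm₂_le {X Z : ℝ → E} (hX : ContinuousOn X (Icc 0 T))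
    (hZ : ContinuousOn Z (Icc 0 T)) (hr : 1 ≤ r) (hrp : ENNReal.ofReal r ≤ p) (hq : q ≠ 0)
    (hα : 1 / r < α) {a b : ℝ≥0∞}
    {χ : ℝ → ℝ → ℝ≥0∞} (hχ : ∀ s t, 0 ≤ s → s ≤ t → t ≤ T →
      χ s t ≤ a * rVariation r X (Icc s t) + b * rVariation r Z (Icc s t)) :
    besovNorm₂ α p q T χ ≤ besovVariationConst α r q *
      (a * besovNorm α p q T X + b * besovNorm α p q T Z) := by
  set G : (ℝ → E) → ℝ → ℝ≥0∞ := fun Y t => pathModulus p T Y t / ENNReal.ofReal (t ^ α) with hG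
  have hGm : ∀ Y, Measurable (G Y) := fun Y => measurable_besovModulus_div p T α _
  have hpt : ∀ᵐ t ∂(dtOverT T), besovModulus p T χ t / ENNReal.ofReal (t ^ α) ≤
      2 * ∑' j : ℕ, (dyadicRatio α r ^ 2) ^ j *
        (fun t => a * G X t + b * G Z t) (t / 2 ^ j) := by
    filter_upwards [ae_dtOverT_mem T] with t ht
    rw [← ENNReal.tsum_mul_left]
    have h1 := besovModulus_le_tsum hX hZ hr hrp hχ t
    refine (ENNReal.div_le_div_right h1 _).trans ?_
    rw [div_eq_mul_inv, ← ENNReal.tsum_mul_right]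
    refine ENNReal.tsum_le_tsum fun j => le_of_eq ?_
    have ht0 := ht.1
    have e1 : (ENNReal.ofReal (t ^ α))⁻¹ =
        ((2 : ℝ≥0∞) ^ α)⁻¹ ^ j * (ENNReal.ofReal ((t / 2 ^ j) ^ α))⁻¹ := by
      have h2 : t ^ α = (2 ^ α) ^ j * (t / 2 ^ j) ^ α := by
        rw [Real.div_rpow ht0.le (by positivity), ← Real.rpow_natCast, ← Real.rpow_natCast,
          ← Real.rpow_mul zero_le_two, ← Real.rpow_mul zero_le_two, mul_comm α]
        field_simp
      rw [h2, ENNReal.ofReal_mul (by positivity), ENNReal.ofReal_pow (by positivity),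
        ← ENNReal.ofReal_rpow_of_pos two_pos, ENNReal.ofReal_ofNat, ← ENNReal.inv_pow]
      refine ENNReal.mul_inv (Or.inr ENNReal.ofReal_ne_top) (Or.inl ?_)
      exact ENNReal.pow_ne_top (ENNReal.rpow_ne_top_of_ne_zero two_ne_zero ENNReal.ofNat_ne_top)
    have e2 : ((2 : ℝ≥0∞) ^ j) ^ (1 / r) = ((2 : ℝ≥0∞) ^ (1 / r)) ^ j := by
      rw [← ENNReal.rpow_natCast, ← ENNReal.rpow_natCast, ← ENNReal.rpow_mul, ← ENNReal.rpow_mul,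
        mul_comm]
    rw [e1, e2, dyadicRatio_sq, div_eq_mul_inv ((2 : ℝ≥0∞) ^ (1 / r)), mul_pow]
    simp only [hG]
    rw [div_eq_mul_inv (pathModulus p T X (t / 2 ^ j)),
      div_eq_mul_inv (pathModulus p T Z (t / 2 ^ j))]
    ring
  have hsm : Measurable fun t => a * G X t + b * G Z t :=
    ((hGm X).const_mul a).add ((hGm Z).const_mul b)
  have hadd : eLpNorm (fun t => a * G X t + b * G Z t) q (dtOverT T) ≤
      ENNReal.LpAddConst q * (a * besovNorm α p q T X + b * besovNorm α p q T Z) := by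
    refine (eLpNorm_add_le' ((hGm X).const_mul a).aestronglyMeasurable
      ((hGm Z).const_mul b).aestronglyMeasurable q).trans (le_of_eq ?_)
    rw [eLpNorm_const_mul_ennreal (hGm X).aemeasurable,
      eLpNorm_const_mul_ennreal (hGm Z).aemeasurable]
    rfl
  refine (eLpNorm_mono_ennreal_ae hpt).trans ?_
  have hm : Measurable fun t => ∑' j : ℕ, (dyadicRatio α r ^ 2) ^ j *
      (fun t => a * G X t + b * G Z t) (t / 2 ^ j) := Measurable.tsum fun j =>
    (hsm.comp (measurable_id.div_const _)).const_mul _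
  rw [eLpNorm_const_mul_ennreal hm.aemeasurable]
  refine (mul_le_mul' le_rfl (eLpNorm_tsum_dyadic_le hq (dyadicRatio_lt_one hα).le T hsm)).trans ?_
  refine (mul_le_mul' le_rfl (mul_le_mul' le_rfl hadd)).trans (le_of_eq ?_)
  rw [besovVariationConst]
  ring

theorem besovNorm_mono {τ : ℝ} (hτ : τ ≤ T) (f : ℝ → E) :
    besovNorm α p q τ f ≤ besovNorm α p q T f := by
  have hdt : dtOverT τ ≤ dtOverT T := by
    refine Measure.le_iff.2 fun s hs => ?_
    unfold dtOverT
    rw [withDensity_apply _ hs, withDensity_apply _ hs]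
    refine lintegral_mono' (Measure.restrict_mono_measure
      (Measure.restrict_mono (Ioc_subset_Ioc_right hτ) le_rfl) _) le_rfl
  refine (eLpNorm_mono_measure _ hdt).trans (eLpNorm_mono_ennreal_ae (Eventually.of_forall
    fun t => ?_))
  refine ENNReal.div_le_div_right (iSup₂_mono fun h _ => ?_) _
  exact eLpNorm_mono_measure _ (Measure.restrict_mono (Ioc_subset_Ioc_right (by linarith)) le_rfl)

end Norm

/-! ### Embedding of Besov spaces into spaces of finite variation -/

section Embedding

variable {E : Type*} [NormedAddCommGroup E] {p q : ℝ≥0∞} {r α ν T : ℝ}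

theorem half_le_dtOverT_Ioc {t : ℝ} (ht : 0 < t) (htT : 2 * t ≤ T) :
    2⁻¹ ≤ dtOverT T (Ioc t (2 * t)) := by
  unfold dtOverT
  rw [withDensity_apply _ measurableSet_Ioc, Measure.restrict_restrict measurableSet_Ioc,
    inter_eq_self_of_subset_left (Ioc_subset_Ioc ht.le htT)]
  calc (2⁻¹ : ℝ≥0∞) = ENNReal.ofReal (2 * t)⁻¹ * volume (Ioc t (2 * t)) := by
        rw [Real.volume_Ioc, ← ENNReal.ofReal_mul (by positivity)]
        have : (2 * t)⁻¹ * (2 * t - t) = 2⁻¹ := by field_simp; ring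
        rw [this, ENNReal.ofReal_inv_of_pos two_pos, ENNReal.ofReal_ofNat]
    _ = ∫⁻ _ in Ioc t (2 * t), ENNReal.ofReal (2 * t)⁻¹ := by rw [setLIntegral_const]
    _ ≤ ∫⁻ s in Ioc t (2 * t), ENNReal.ofReal s⁻¹ := by
        refine setLIntegral_mono (by fun_prop) fun s hs => ?_
        exact ENNReal.ofReal_le_ofReal (inv_anti₀ (ht.trans hs.1) hs.2)

/-- By monotonicity of the modulus, the Besov norm controls it pointwise. -/
theorem pathModulus_le_besovNorm (hq : q ≠ 0) (hα : 0 ≤ α) (X : ℝ → E) {t : ℝ} (ht : 0 < t)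
    (htT : 2 * t ≤ T) :
    pathModulus p T X t ≤
      2 ^ (1 / q.toReal) * ENNReal.ofReal ((2 * t) ^ α) * besovNorm α p q T X := by
  have hA := half_le_dtOverT_Ioc ht htT
  have hA0 : dtOverT T (Ioc t (2 * t)) ≠ 0 := by
    intro h
    rw [h] at hA
    simp at hA
  have h2t : 0 < (2 * t) ^ α := by positivity
  have h1 := mul_measure_rpow_le_eLpNorm (μ := dtOverT T) (p := q) hq measurableSet_Ioc hA0
    (f := fun s => pathModulus p T X s / ENNReal.ofReal (s ^ α))
    (c := pathModulus p T X t / ENNReal.ofReal ((2 * t) ^ α)) fun s hs =>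
      ENNReal.div_le_div (besovModulus_mono _ _ _ hs.1.le)
        (ENNReal.ofReal_le_ofReal (Real.rpow_le_rpow (ht.trans hs.1).le hs.2 hα))
  have h2 : pathModulus p T X t / ENNReal.ofReal ((2 * t) ^ α) * 2⁻¹ ^ (1 / q.toReal) ≤
      besovNorm α p q T X :=
    (mul_le_mul' le_rfl (ENNReal.rpow_le_rpow hA (by positivity))).trans h1
  have h3 : (2 : ℝ≥0∞) ^ (1 / q.toReal) * 2⁻¹ ^ (1 / q.toReal) = 1 := by
    rw [← ENNReal.mul_rpow_of_nonneg _ _ (by positivity),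
      ENNReal.mul_inv_cancel two_ne_zero ENNReal.ofNat_ne_top, ENNReal.one_rpow]
  have h4 : ENNReal.ofReal ((2 * t) ^ α) *
      (pathModulus p T X t / ENNReal.ofReal ((2 * t) ^ α)) = pathModulus p T X t :=
    ENNReal.mul_div_cancel (ENNReal.ofReal_pos.2 h2t).ne' ENNReal.ofReal_ne_top
  calc pathModulus p T X t
      = (ENNReal.ofReal ((2 * t) ^ α) * (pathModulus p T X t / ENNReal.ofReal ((2 * t) ^ α))) *
          (2 ^ (1 / q.toReal) * 2⁻¹ ^ (1 / q.toReal)) := by rw [h3, h4, mul_one]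
    _ = 2 ^ (1 / q.toReal) * ENNReal.ofReal ((2 * t) ^ α) *
          (pathModulus p T X t / ENNReal.ofReal ((2 * t) ^ α) * 2⁻¹ ^ (1 / q.toReal)) := by ring
    _ ≤ _ := mul_le_mul' le_rfl h2

/-- The constant in the embedding for intervals away from the end points. For `p = ∞` or `q = ∞`,
`1 / p.toReal` and `1 / q.toReal` are `0`, as they should be. -/
def interiorEmbeddingConst (α r : ℝ) (p q : ℝ≥0∞) : ℝ≥0∞ :=
  2 * 2 ^ (1 / q.toReal) * (∑' j : ℕ, (dyadicRatio α r ^ 2) ^ j) * 3 ^ α * 2 ^ (1 / p.toReal)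

theorem tsum_pow_ne_top {x : ℝ≥0∞} (hx : x < 1) : ∑' j : ℕ, x ^ j ≠ ∞ := by
  rw [ENNReal.tsum_geometric, Ne, ENNReal.inv_eq_top, tsub_eq_zero_iff_le, not_le]
  exact hx

theorem interiorEmbeddingConst_ne_top (hα : 1 / r < α) :
    interiorEmbeddingConst α r p q ≠ ∞ := by
  have h2 : ∀ x : ℝ, (2 : ℝ≥0∞) ^ x ≠ ∞ := fun x =>
    ENNReal.rpow_ne_top_of_ne_zero two_ne_zero ENNReal.ofNat_ne_top
  have h3 : (3 : ℝ≥0∞) ^ α ≠ ∞ := ENNReal.rpow_ne_top_of_ne_zero (by norm_num) ENNReal.ofNat_ne_top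
  have h4 : dyadicRatio α r ^ 2 < 1 := pow_lt_one₀ zero_le (dyadicRatio_lt_one hα) two_ne_zero
  exact ENNReal.mul_ne_top (ENNReal.mul_ne_top (ENNReal.mul_ne_top
    (ENNReal.mul_ne_top ENNReal.ofNat_ne_top (h2 _)) (tsum_pow_ne_top h4)) h3) (h2 _)

/-- On an interval of length `l` with distance at least `l / 2` to the end points, the variation is
estimated by averaging over the intervals of length `3 l / 2` around it. -/
theorem rVariation_le_besovNorm_of_interior {X : ℝ → E} (hX : ContinuousOn X (Icc 0 T))
    (hr : 1 ≤ r) (hrp : ENNReal.ofReal r ≤ p) (hq : q ≠ 0) (hα : 1 / r < α) {a b : ℝ}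
    (hab : a < b) (ha : (b - a) / 2 ≤ a) (hb : b + (b - a) / 2 ≤ T) (hl : 3 * (b - a) ≤ T) :
    rVariation r X (Icc a b) ≤ interiorEmbeddingConst α r p q * besovNorm α p q T X *
      ENNReal.ofReal (b - a) ^ (α - 1 / p.toReal) := by
  have hr0 : 0 < r := by linarith
  have hp0 : p ≠ 0 := ((ENNReal.ofReal_pos.2 hr0).trans_le hrp).ne'
  have hα0 : 0 ≤ α := (by positivity : (0 : ℝ) ≤ 1 / r).trans hα.le
  set l := b - a with hldef
  have hl0 : 0 < l := by rw [hldef]; linarith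
  set h := 3 * l / 2 with hh
  have hh0 : 0 < h := by positivity
  set χ : ℝ → ℝ → ℝ≥0∞ := fun s t => rVariation r X (Icc s t)
  set N := besovNorm α p q T X
  have hvol : volume.restrict (Ioc 0 (T - h)) (Ioc (a - l / 2) a) = ENNReal.ofReal (l / 2) := by
    rw [Measure.restrict_apply measurableSet_Ioc, inter_eq_self_of_subset_left
      (Ioc_subset_Ioc (by linarith) (by linarith)), Real.volume_Ioc]
    congr 1; ring
  have h1 := mul_measure_rpow_le_eLpNorm (μ := volume.restrict (Ioc 0 (T - h))) (p := p) hp0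
    measurableSet_Ioc (A := Ioc (a - l / 2) a)
    (by rw [hvol]; exact (ENNReal.ofReal_pos.2 (by positivity)).ne')
    (f := fun s => χ s (s + h)) (c := rVariation r X (Icc a b)) fun s hs =>
      rVariation_mono hr0 (Icc_subset_Icc hs.2 (by linarith [hs.1]))
  rw [hvol] at h1
  have h2 : rVariation r X (Icc a b) * ENNReal.ofReal (l / 2) ^ (1 / p.toReal) ≤
      besovModulus p T χ h :=
    h1.trans (le_iSup₂ (f := fun h' (_ : h' ∈ Ioc 0 h) =>
      eLpNorm (fun s => χ s (s + h')) p (volume.restrict (Ioc 0 (T - h')))) h ⟨hh0, le_rfl⟩)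
  have h3 := besovModulus_le_tsum (p := p) (a := 1) (b := 0) (χ := χ) hX hX hr hrp
    (fun s t _ _ _ => by simp [χ]) h
  have h4 : ∀ j : ℕ, 2 * ((2 : ℝ≥0∞) ^ j) ^ (1 / r) *
      (1 * pathModulus p T X (h / 2 ^ j) + 0 * pathModulus p T X (h / 2 ^ j)) ≤
      2 * 2 ^ (1 / q.toReal) * ENNReal.ofReal ((3 * l) ^ α) * N * (dyadicRatio α r ^ 2) ^ j := by
    intro j
    have hj : (1 : ℝ) ≤ 2 ^ j := one_le_pow₀ one_le_two
    have h5 : 2 * (h / 2 ^ j) ≤ T := by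
      have : h / 2 ^ j ≤ h := div_le_self hh0.le hj
      linarith
    have h6 := pathModulus_le_besovNorm (p := p) hq hα0 X (by positivity : 0 < h / 2 ^ j) h5
    have e1 : ENNReal.ofReal ((2 * (h / 2 ^ j)) ^ α) =
        ENNReal.ofReal ((3 * l) ^ α) * ((2 : ℝ≥0∞) ^ α)⁻¹ ^ j := by
      have h7 : (2 * (h / 2 ^ j)) ^ α = (3 * l) ^ α * ((2 ^ α)⁻¹) ^ j := by
        have : 2 * (h / 2 ^ j) = 3 * l / 2 ^ j := by rw [hh]; field_simp
        rw [this, Real.div_rpow (by positivity) (by positivity), inv_pow, ← Real.rpow_natCast,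
          ← Real.rpow_natCast, ← Real.rpow_mul zero_le_two, ← Real.rpow_mul zero_le_two,
          mul_comm α, div_eq_mul_inv]
      rw [h7, ENNReal.ofReal_mul (by positivity), ENNReal.ofReal_pow (by positivity),
        ENNReal.ofReal_inv_of_pos (by positivity), ← ENNReal.ofReal_rpow_of_pos two_pos,
        ENNReal.ofReal_ofNat]
    have e2 : ((2 : ℝ≥0∞) ^ j) ^ (1 / r) = ((2 : ℝ≥0∞) ^ (1 / r)) ^ j := by
      rw [← ENNReal.rpow_natCast, ← ENNReal.rpow_natCast, ← ENNReal.rpow_mul, ← ENNReal.rpow_mul,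
        mul_comm]
    rw [one_mul, zero_mul, add_zero]
    refine (mul_le_mul' le_rfl h6).trans (le_of_eq ?_)
    rw [e1, e2, dyadicRatio_sq, div_eq_mul_inv ((2 : ℝ≥0∞) ^ (1 / r)), mul_pow]
    ring
  have h5 := h2.trans (h3.trans (ENNReal.tsum_le_tsum h4))
  rw [ENNReal.tsum_mul_left] at h5
  have hne : ENNReal.ofReal l ≠ 0 := (ENNReal.ofReal_pos.2 hl0).ne'
  have e3 : ENNReal.ofReal (l / 2) ^ (1 / p.toReal) *
      (2 ^ (1 / p.toReal) * ENNReal.ofReal l ^ (- (1 / p.toReal))) = 1 := by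
    rw [← mul_assoc, ← ENNReal.mul_rpow_of_nonneg _ _ (by positivity)]
    have : ENNReal.ofReal (l / 2) * 2 = ENNReal.ofReal l := by
      rw [← ENNReal.ofReal_ofNat 2, ← ENNReal.ofReal_mul (by positivity)]
      congr 1; ring
    rw [this, ← ENNReal.rpow_add _ _ hne ENNReal.ofReal_ne_top, add_neg_cancel, ENNReal.rpow_zero]
  have e4 : ENNReal.ofReal ((3 * l) ^ α) = 3 ^ α * ENNReal.ofReal l ^ α := by
    rw [← ENNReal.ofReal_rpow_of_pos (by positivity), ENNReal.ofReal_mul (by norm_num),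
      ENNReal.mul_rpow_of_nonneg _ _ hα0, ENNReal.ofReal_ofNat]
  calc rVariation r X (Icc a b)
      = rVariation r X (Icc a b) * ENNReal.ofReal (l / 2) ^ (1 / p.toReal) *
          (2 ^ (1 / p.toReal) * ENNReal.ofReal l ^ (- (1 / p.toReal))) := by
        rw [mul_assoc, e3, mul_one]
    _ ≤ _ := mul_le_mul' h5 le_rfl
    _ = _ := by
        rw [e4, sub_eq_add_neg α, ENNReal.rpow_add _ _ hne ENNReal.ofReal_ne_top,
          interiorEmbeddingConst]
        ring

/-- For a continuous path, the variation is determined in the interior. -/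
theorem rVariation_Icc_le_of_forall_interior (hr : 0 < r) {f : ℝ → E} {u v : ℝ}
    (hf : ContinuousOn f (Icc u v)) {δ : ℕ → ℝ} (hδ0 : ∀ n, 0 ≤ δ n)
    (hδuv : ∀ n, 2 * δ n ≤ v - u) (hδ : Tendsto δ atTop (𝓝 0)) {C : ℝ≥0∞}
    (hC : ∀ n, rVariation r f (Icc (u + δ n) (v - δ n)) ≤ C) : rVariation r f (Icc u v) ≤ C := by
  set m : ℕ → ℝ → ℝ := fun n t => max (u + δ n) (min (v - δ n) t) with hm
  have hmaps : ∀ n t, m n t ∈ Icc (u + δ n) (v - δ n) := fun n t =>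
    ⟨le_max_left _ _, max_le (by linarith [hδuv n]) (min_le_left _ _)⟩
  refine rVariation_le_of_tendsto (l := atTop) (f := fun n => f ∘ m n) hr (fun t ht => ?_)
    (Eventually.of_forall fun n => ?_)
  · have h1 : Tendsto (fun n => m n t) atTop (𝓝 t) := by
      have h2 : Tendsto (fun n => m n t) atTop (𝓝 (max (u + 0) (min (v - 0) t))) :=
        (tendsto_const_nhds.add hδ).max ((tendsto_const_nhds.sub hδ).min tendsto_const_nhds)
      rwa [add_zero, sub_zero, min_eq_right ht.2, max_eq_right ht.1] at h2
    refine (hf t ht).tendsto.comp (tendsto_nhdsWithin_iff.2 ⟨h1, Eventually.of_forall fun n => ?_⟩)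
    exact Icc_subset_Icc (by linarith [hδ0 n]) (by linarith [hδ0 n]) (hmaps n t)
  · refine (rVariation_comp_le hr ?_ fun t _ => hmaps n t).trans (hC n)
    intro s _ t _ hst
    exact max_le_max le_rfl (min_le_min le_rfl hst)

/-- A Whitney decomposition of `[u, v]`: a bound for the variation on intervals with distance to the
end points at least half their length implies one for the whole interval. -/
theorem rVariation_le_of_interior (hr : 1 ≤ r) (hν : 0 < ν) {f : ℝ → E} {u v : ℝ} (huv : u < v)
    (hf : ContinuousOn f (Icc u v)) {A : ℝ≥0∞}
    (hA : ∀ a b, a < b → u + (b - a) / 2 ≤ a → b + (b - a) / 2 ≤ v → 3 * (b - a) ≤ v - u →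
      rVariation r f (Icc a b) ≤ A * ENNReal.ofReal (b - a) ^ ν) :
    rVariation r f (Icc u v) ≤
      2 * (∑' k : ℕ, ((2 : ℝ≥0∞) ^ (-ν)) ^ k) * A * ENNReal.ofReal (v - u) ^ ν := by
  have hL : 0 < (v - u) / 3 := by linarith
  -- the middle third, followed by intervals towards the end points, each half as long as the last
  set δ : ℕ → ℝ := fun n => (v - u) / 3 / 2 ^ n with hδdef
  have hδpos : ∀ n, 0 < δ n := fun n => by positivity
  have hδle : ∀ n, δ n ≤ (v - u) / 3 := fun n => div_le_self hL.le (one_le_pow₀ one_le_two)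
  have hδs : ∀ n, δ (n + 1) = δ n / 2 := fun n => by
    simp only [hδdef, pow_succ]
    field_simp
  have hδ : Tendsto δ atTop (𝓝 0) := by
    have := (tendsto_pow_atTop_nhds_zero_of_lt_one (r := (2⁻¹ : ℝ)) (by norm_num)
      (by norm_num)).const_mul ((v - u) / 3)
    simpa [hδdef, div_eq_mul_inv] using this
  have hfin : ∀ n, rVariation r f (Icc (u + δ n) (v - δ n)) ≤
      ∑ k ∈ Finset.range (n + 1), 2 * A * ENNReal.ofReal (δ k) ^ ν := by
    intro n
    induction n with
    | zero =>
      have h0 : δ 0 = (v - u) / 3 := by simp [hδdef]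
      rw [zero_add, Finset.sum_range_one]
      have h1 := hA (u + δ 0) (v - δ 0) (by linarith) (by linarith) (by linarith) (by linarith)
      have h2 : v - δ 0 - (u + δ 0) = δ 0 := by rw [h0]; ring
      rw [h2] at h1
      refine h1.trans (mul_le_mul' (le_mul_of_one_le_left zero_le one_le_two) le_rfl)
    | succ n ih =>
      have hp := hδpos n
      have hl := hδle n
      have hs := hδs n
      have h1 := hA (u + δ (n + 1)) (u + δ n) (by linarith) (by linarith) (by linarith)
        (by linarith)
      have h2 := hA (v - δ n) (v - δ (n + 1)) (by linarith) (by linarith) (by linarith)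
        (by linarith)
      have e1 : u + δ n - (u + δ (n + 1)) = δ (n + 1) := by rw [hs]; ring
      have e2 : v - δ (n + 1) - (v - δ n) = δ (n + 1) := by rw [hs]; ring
      rw [e1] at h1
      rw [e2] at h2
      have h3 := rVariation_Icc_le_add (f := f) hr
        (by linarith : u + δ (n + 1) ≤ u + δ n) (by linarith : u + δ n ≤ v - δ (n + 1))
      have h4 := rVariation_Icc_le_add (f := f) hr
        (by linarith : u + δ n ≤ v - δ n) (by linarith : v - δ n ≤ v - δ (n + 1))
      rw [Finset.sum_range_succ]
      calc rVariation r f (Icc (u + δ (n + 1)) (v - δ (n + 1)))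
          ≤ A * ENNReal.ofReal (δ (n + 1)) ^ ν +
              (∑ k ∈ Finset.range (n + 1), 2 * A * ENNReal.ofReal (δ k) ^ ν +
                A * ENNReal.ofReal (δ (n + 1)) ^ ν) :=
            h3.trans (add_le_add h1 (h4.trans (add_le_add ih h2)))
        _ = _ := by ring
  have hterm : ∀ k, ENNReal.ofReal (δ k) ^ ν ≤
      ENNReal.ofReal (v - u) ^ ν * ((2 : ℝ≥0∞) ^ (-ν)) ^ k := by
    intro k
    have e : ENNReal.ofReal (δ k) = ENNReal.ofReal ((v - u) / 3) * 2⁻¹ ^ k := by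
      simp only [hδdef]
      rw [div_eq_mul_inv, ENNReal.ofReal_mul hL.le, ← inv_pow, ENNReal.ofReal_pow (by norm_num),
        ENNReal.ofReal_inv_of_pos two_pos, ENNReal.ofReal_ofNat]
    rw [e, ENNReal.mul_rpow_of_nonneg _ _ hν.le]
    refine mul_le_mul' (ENNReal.rpow_le_rpow (ENNReal.ofReal_le_ofReal (by linarith)) hν.le)
      (le_of_eq ?_)
    rw [ENNReal.rpow_neg, ← ENNReal.inv_rpow, ← ENNReal.rpow_natCast, ← ENNReal.rpow_natCast,
      ← ENNReal.rpow_mul, ← ENNReal.rpow_mul, mul_comm]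
  refine rVariation_Icc_le_of_forall_interior (by linarith) hf (fun n => (hδpos n).le)
    (fun n => by linarith [hδle n]) hδ fun n => (hfin n).trans ?_
  refine (ENNReal.sum_le_tsum _).trans ?_
  refine (ENNReal.tsum_le_tsum fun k => mul_le_mul' le_rfl (hterm k)).trans (le_of_eq ?_)
  rw [ENNReal.tsum_mul_left, ENNReal.tsum_mul_left]
  ring

/-- The constant of the embedding `B^α_{p,q} ⊆ V^r`. -/
def embeddingConst (α r : ℝ) (p q : ℝ≥0∞) : ℝ≥0∞ :=
  2 * (∑' k : ℕ, ((2 : ℝ≥0∞) ^ (-(α - 1 / p.toReal))) ^ k) * interiorEmbeddingConst α r p q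

theorem sub_one_div_toReal_pos (hr : 1 ≤ r) (hrp : ENNReal.ofReal r ≤ p) (hα : 1 / r < α) :
    0 < α - 1 / p.toReal := by
  have hr0 : 0 < r := by linarith
  by_cases hp : p = ∞
  · subst hp
    simpa using (by positivity : (0 : ℝ) < 1 / r).trans hα
  · have h1 := ENNReal.toReal_mono hp hrp
    rw [ENNReal.toReal_ofReal hr0.le] at h1
    have := one_div_le_one_div_of_le hr0 h1
    linarith

theorem embeddingConst_ne_top (hr : 1 ≤ r) (hrp : ENNReal.ofReal r ≤ p) (hα : 1 / r < α) :
    embeddingConst α r p q ≠ ∞ :=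
  ENNReal.mul_ne_top (ENNReal.mul_ne_top ENNReal.ofNat_ne_top
    (tsum_pow_ne_top (ENNReal.rpow_lt_one_of_one_lt_of_neg ENNReal.one_lt_two
      (neg_lt_zero.2 (sub_one_div_toReal_pos hr hrp hα)))))
    (interiorEmbeddingConst_ne_top hα)

/-- The embedding of Besov spaces into spaces of finite variation, with Hölder control. -/
theorem rVariation_le_besovNorm {X : ℝ → E} (hX : ContinuousOn X (Icc 0 T)) (hr : 1 ≤ r)
    (hrp : ENNReal.ofReal r ≤ p) (hq : q ≠ 0) (hα : 1 / r < α) {u v : ℝ} (hu : 0 ≤ u)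
    (huv : u ≤ v) (hv : v ≤ T) :
    rVariation r X (Icc u v) ≤ embeddingConst α r p q * besovNorm α p q T X *
      ENNReal.ofReal (v - u) ^ (α - 1 / p.toReal) := by
  rcases huv.eq_or_lt with rfl | huv
  · refine (rVariation_le_of_tendsto (l := pure ()) (f := fun _ _ => X u) (by linarith)
      (fun t ht => ?_) (C := 0) ?_).trans zero_le
    · rw [Icc_self, mem_singleton_iff] at ht
      rw [ht]
      exact tendsto_const_nhds
    · simp [rVariation, ENNReal.zero_rpow_of_pos (by linarith : 0 < r),
        ENNReal.zero_rpow_of_pos (by positivity : 0 < r⁻¹)]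
  · refine (rVariation_le_of_interior (A := interiorEmbeddingConst α r p q * besovNorm α p q T X) hr
      (sub_one_div_toReal_pos hr hrp hα) huv (hX.mono (Icc_subset_Icc hu hv)) ?_).trans
      (le_of_eq ?_)
    · intro a b hab ha hb hl
      exact rVariation_le_besovNorm_of_interior hX hr hrp hq hα hab (by linarith) (by linarith)
        (by linarith)
    · rw [embeddingConst]
      ring

end Embedding

/-! ### Young equations driven by Besov paths -/

section Besov

variable {E F : Type*} [NormedAddCommGroup E] [NormedAddCommGroup F]
  {p q : ℝ≥0∞} {r α T : ℝ}

theorem MemBesov.mono {τ : ℝ} {X : ℝ → E} (h : MemBesov α p q T X) (hτ : τ ≤ T) :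
    MemBesov α p q τ X :=
  ⟨h.continuousOn.mono (Icc_subset_Icc_right hτ), (besovNorm_mono hτ X).trans_lt h.2⟩

section

variable (hr : 1 ≤ r) (hrp : ENNReal.ofReal r ≤ p) (hq : q ≠ 0) (hα : 1 / r < α)

include hr hrp hq hα

theorem MemBesov.exists_rVariation_le {X : ℝ → E} (h : MemBesov α p q T X) :
    ∃ A : ℝ≥0, ∀ s t, 0 ≤ s → s ≤ t → t ≤ T →
      rVariation r X (Icc s t) ≤ A * ENNReal.ofReal (t - s) ^ (α - 1 / p.toReal) := by
  have hA : embeddingConst α r p q * besovNorm α p q T X ≠ ∞ :=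
    ENNReal.mul_ne_top (embeddingConst_ne_top hr hrp hα) h.2.ne
  refine ⟨(embeddingConst α r p q * besovNorm α p q T X).toNNReal, fun s t hs hst ht => ?_⟩
  rw [ENNReal.coe_toNNReal hA]
  exact rVariation_le_besovNorm h.1 hr hrp hq hα hs hst ht

theorem MemBesov.rVariation_ne_top (hT : 0 ≤ T) {X : ℝ → E} (h : MemBesov α p q T X) :
    rVariation r X (Icc 0 T) ≠ ∞ := by
  obtain ⟨A, hA⟩ := h.exists_rVariation_le hr hrp hq hα
  refine ((hA 0 T le_rfl hT le_rfl).trans_lt (ENNReal.mul_lt_top ENNReal.coe_lt_top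
    (ENNReal.rpow_lt_top_of_nonneg (sub_one_div_toReal_pos hr hrp hα).le ?_))).ne
  exact ENNReal.ofReal_ne_top

theorem MemBesov.exists_rVariation_lt (hT : 0 < T) {X : ℝ → E} (h : MemBesov α p q T X)
    {ε : ℝ≥0∞} (hε : 0 < ε) : ∃ τ ∈ Ioc 0 T, rVariation r X (Icc 0 τ) < ε := by
  obtain ⟨A, hA⟩ := h.exists_rVariation_le hr hrp hq hα
  set ν := α - 1 / p.toReal
  have hν : 0 < ν := sub_one_div_toReal_pos hr hrp hα
  have hc : Continuous fun τ : ℝ => (A : ℝ≥0∞) * ENNReal.ofReal (τ - 0) ^ ν :=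
    (ENNReal.continuous_const_mul ENNReal.coe_ne_top).comp
      (ENNReal.continuous_rpow_const.comp (ENNReal.continuous_ofReal.comp (by fun_prop)))
  have h0 : Tendsto (fun τ : ℝ => (A : ℝ≥0∞) * ENNReal.ofReal (τ - 0) ^ ν) (𝓝[>] 0) (𝓝 0) := by
    have := (hc.tendsto 0).mono_left (nhdsWithin_le_nhds (s := Ioi 0))
    simpa [ENNReal.zero_rpow_of_pos hν] using this
  obtain ⟨τ, hτ, hlt⟩ := ((eventually_mem_set.2 (Ioc_mem_nhdsGT hT)).and (h0.eventually_lt_const hε)).exists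
  exact ⟨τ, hτ, (hA 0 τ le_rfl hτ.1.le hτ.2).trans_lt hlt⟩

/-- A path whose increments are dominated by the variation of a Besov path is a Besov path. -/
theorem MemBesov.of_edist_le {X : ℝ → E} (h : MemBesov α p q T X) {Φ₀ : ℝ≥0} {Y : ℝ → F}
    (hY : ∀ s t, 0 ≤ s → s ≤ t → t ≤ T →
      edist (Y s) (Y t) ≤ 2 * Φ₀ * rVariation r X (Icc s t)) : MemBesov α p q T Y := by
  obtain ⟨A, hA⟩ := h.exists_rVariation_le hr hrp hq hα
  refine ⟨continuousOn_of_edist_le (sub_one_div_toReal_pos hr hrp hα) hA hY, ?_⟩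
  have h1 := besovNorm₂_le (p := p) (χ := fun s t => edist (Y s) (Y t)) (a := 2 * Φ₀) (b := 0)
    h.1 h.1 hr hrp hq hα fun s t hs hst ht => (hY s t hs hst ht).trans (by simp)
  refine h1.trans_lt (ENNReal.mul_lt_top (besovVariationConst_ne_top hq hα).lt_top ?_)
  rw [zero_mul, add_zero]
  exact ENNReal.mul_lt_top (ENNReal.mul_lt_top ENNReal.ofNat_lt_top ENNReal.coe_lt_top) h.2

end

theorem gammaTilde_mono (β : ℝ≥0) (r : ℝ) (Φ₀ Φ₁ Φ₁β ε : ℝ≥0) {x x' : ℝ≥0∞} (y a b : ℝ≥0∞)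
    (hx : x ≤ x') :
    gammaTilde β r Φ₀ Φ₁ Φ₁β ε x y a b ≤ gammaTilde β r Φ₀ Φ₁ Φ₁β ε x' y a b := by
  simp only [gammaTilde]
  gcongr

/-- The variation of `ΔX` is at most a constant times its Besov norm; this constant can be taken out
of `γ̃`. -/
theorem gammaTilde_mul_le (β : ℝ≥0) (r : ℝ) (Φ₀ Φ₁ Φ₁β ε : ℝ≥0) {c : ℝ≥0∞} (x y a b : ℝ≥0∞)
    (hc : 1 ≤ c) :
    gammaTilde β r Φ₀ Φ₁ Φ₁β ε (c * x) y a b ≤ c * gammaTilde β r Φ₀ Φ₁ Φ₁β ε x y a b := by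
  have h : ∀ z : ℝ≥0∞, z ≤ c * z := fun z => le_mul_of_one_le_left zero_le hc
  unfold gammaTilde
  rw [mul_add, mul_add, mul_add]
  refine add_le_add (add_le_add (add_le_add (le_of_eq ?_) (h _)) (h _)) (h _)
  ring

/-- The constant of the stability estimate. The last factor turns the variation of `ΔX` in `γ̃` into
its Besov norm. -/
def stabilityConst (α r : ℝ) (p q : ℝ≥0∞) (T : ℝ) : ℝ≥0∞ :=
  besovVariationConst α r q * 4 *
    (1 + embeddingConst α r p q * ENNReal.ofReal T ^ (α - 1 / p.toReal))

theorem stabilityConst_ne_top (hr : 1 ≤ r) (hrp : ENNReal.ofReal r ≤ p) (hq : q ≠ 0)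
    (hα : 1 / r < α) : stabilityConst α r p q T ≠ ∞ := by
  refine ENNReal.mul_ne_top (ENNReal.mul_ne_top (besovVariationConst_ne_top hq hα)
    ENNReal.ofNat_ne_top) (ENNReal.add_ne_top.2 ⟨ENNReal.one_ne_top,
      ENNReal.mul_ne_top (embeddingConst_ne_top hr hrp hα) ?_⟩)
  exact ENNReal.rpow_ne_top_of_nonneg (sub_one_div_toReal_pos hr hrp hα).le ENNReal.ofReal_ne_top

variable [NormedSpace ℝ E] [NormedSpace ℝ F] {β Φ₀ Φβ Φ₁ Φ₁β ε : ℝ≥0}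
  (hβ : 0 < β) (hβ1 : β ≤ 1) (hr : 1 ≤ r) (hrβ : r < 1 + β) (hrp : ENNReal.ofReal r ≤ p)
  (hq : q ≠ 0) (hα : 1 / r < α) (hε : IsSmall β r Φ₀ Φβ Φ₁ Φ₁β ε) (hΦ₀ : 0 < Φ₀)

include hβ hβ1 hr hrβ hrp hq hα hε hΦ₀

/-- Well-posedness on an interval on which the driving path has `r`-variation at most `ε`. -/
theorem existsUnique_memBesov_isYoungSolution [CompleteSpace F] {φ : F → E →L[ℝ] F} {X : ℝ → E}
    (hφ : HolderBound₁ β Φ₀ Φβ Φ₁ Φ₁β φ) {τ : ℝ} (hτ : 0 ≤ τ) (hXB : MemBesov α p q τ X)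
    (hX : rVariation r X (Icc 0 τ) ≤ ε) (y₀ : F) :
    ∃ Y : ℝ → F, MemBesov α p q τ Y ∧ rVariation r Y (Icc 0 τ) < ∞ ∧ IsYoungSolution φ X y₀ τ Y ∧
      ∀ Z : ℝ → F, (MemBesov α p q τ Z ∨ rVariation r Z (Icc 0 τ) < ∞) →
        IsYoungSolution φ X y₀ τ Z → EqOn Z Y (Icc 0 τ) := by
  obtain ⟨A, hA⟩ := hXB.exists_rVariation_le hr hrp hq hα
  obtain ⟨Y, hY, hVY⟩ := exists_isYoungSolution hβ hr hrβ hε hΦ₀ hβ1 hφ hτ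
    (sub_one_div_toReal_pos hr hrp hα) hA hX y₀
  have hVt : rVariation r Y (Icc 0 τ) < ∞ := hVY.trans_lt ENNReal.coe_lt_top
  refine ⟨Y, ?_, hVt, hY, fun Z hZ hZs => ?_⟩
  · refine hXB.of_edist_le (Φ₀ := Φ₀) hr hrp hq hα fun s t hs hst ht => ?_
    exact (isYoungSolution_iff.1 hY).edist_le_of_isSmall hβ hr hrβ hε hΦ₀ hφ.toHolderBound₀ hVY
      hs hst ht
  · have hZt : rVariation r Z (Icc 0 τ) ≠ ∞ :=
      hZ.elim (fun h => h.rVariation_ne_top hr hrp hq hα hτ) fun h => h.ne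
    exact hZs.eqOn hβ hr hrβ hε hΦ₀ hβ1 hφ hτ hY hZt hVt.ne hX

/-- Stability in the Besov norm, from the local estimate in variation. -/
theorem IsYoungSolution.besovNorm_sub_le {φ φ' : F → E →L[ℝ] F} {X X' : ℝ → E} {y₀ y₀' : F}
    {Y Y' : ℝ → F} (hφ : HolderBound₁ β Φ₀ Φβ Φ₁ Φ₁β φ) (hφ' : HolderBound₀ β Φ₀ Φβ φ') {τ : ℝ}
    (hτ : 0 ≤ τ) (hτT : τ ≤ T) (hXB : MemBesov α p q τ X) (hXB' : MemBesov α p q τ X')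
    (hX : rVariation r X (Icc 0 τ) ≤ ε) (hX' : rVariation r X' (Icc 0 τ) ≤ ε)
    (hYB : MemBesov α p q τ Y) (hY : IsYoungSolution φ X y₀ τ Y) (hYB' : MemBesov α p q τ Y')
    (hY' : IsYoungSolution φ' X' y₀' τ Y') :
    besovNorm α p q τ (Y - Y') ≤ stabilityConst α r p q T *
      (gammaTilde β r Φ₀ Φ₁ Φ₁β ε (besovNorm α p q τ (X - X')) ‖y₀ - y₀'‖ₑ
          (eHolderNorm β (φ - φ')) (eSupNorm (φ - φ')) * besovNorm α p q τ X +
        2 * Φ₀ * besovNorm α p q τ (X - X')) := by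
  have hD : ContinuousOn (X - X') (Icc 0 τ) := hXB.1.sub hXB'.1
  set ν := α - 1 / p.toReal with hνdef
  have hν : 0 < ν := sub_one_div_toReal_pos hr hrp hα
  set c := 1 + embeddingConst α r p q * ENNReal.ofReal T ^ ν with hc
  have hc1 : 1 ≤ c := le_self_add
  set x := besovNorm α p q τ (X - X')
  set N := besovNorm α p q τ X
  set γ : ℝ≥0∞ → ℝ≥0∞ := fun x => gammaTilde β r Φ₀ Φ₁ Φ₁β ε x ‖y₀ - y₀'‖ₑ
    (eHolderNorm β (φ - φ')) (eSupNorm (φ - φ')) with hγ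
  have hV : rVariation r (X - X') (Icc 0 τ) ≤ c * x := by
    refine (rVariation_le_besovNorm hD hr hrp hq hα le_rfl hτ le_rfl).trans ?_
    calc embeddingConst α r p q * x * ENNReal.ofReal (τ - 0) ^ ν
        ≤ embeddingConst α r p q * x * ENNReal.ofReal T ^ ν := by gcongr; linarith
      _ = embeddingConst α r p q * ENNReal.ofReal T ^ ν * x := by ring
      _ ≤ c * x := mul_le_mul' le_add_self le_rfl
  have hγle : γ (rVariation r (X - X') (Icc 0 τ)) ≤ c * γ x :=
    (gammaTilde_mono _ _ _ _ _ _ _ _ _ hV).trans (gammaTilde_mul_le _ _ _ _ _ _ _ _ _ _ hc1)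
  have h1 := besovNorm₂_le (p := p) (q := q) (α := α)
    (χ := fun s t => edist ((Y - Y') s) ((Y - Y') t))
    (a := 4 * γ (rVariation r (X - X') (Icc 0 τ))) (b := 2 * Φ₀) hXB.1 hD hr hrp hq hα
    fun s t hs hst ht => hY.edist_sub_le hβ hr hrβ hε hΦ₀ hβ1 hφ hφ' hτ hY'
      (hYB.rVariation_ne_top hr hrp hq hα hτ) (hYB'.rVariation_ne_top hr hrp hq hα hτ) hX hX'
      hs hst ht
  refine h1.trans ?_
  calc besovVariationConst α r q * (4 * γ (rVariation r (X - X') (Icc 0 τ)) * N + 2 * Φ₀ * x)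
      ≤ besovVariationConst α r q * (4 * (c * γ x) * N + (4 * c) * (2 * Φ₀ * x)) := by
        have h4 : 1 ≤ 4 * c := one_le_mul_of_one_le_of_one_le (by norm_num) hc1
        exact mul_le_mul' le_rfl (add_le_add (mul_le_mul' (mul_le_mul' le_rfl hγle) le_rfl)
          (le_mul_of_one_le_left zero_le h4))
    _ = stabilityConst α r p q T * (γ x * N + 2 * Φ₀ * x) := by
        rw [stabilityConst, ← hνdef, ← hc]
        ring

end Besov

/-! ### Choice of the parameters -/

/-- There is a variation exponent `r` to which the quantitative theory applies. -/
theorem exists_variation_exponent {α : ℝ} {β : ℝ≥0} {p : ℝ≥0∞} (hβ : 0 < β)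
    (hαβ : 1 / α < 1 + β) (hp : 1 ≤ p) (hαp : ENNReal.ofReal (1 / α) < p) :
    ∃ r : ℝ, 1 ≤ r ∧ 1 / α < r ∧ ENNReal.ofReal r ≤ p ∧ r < 1 + β := by
  have hβ0 : (0 : ℝ) < β := by exact_mod_cast hβ
  rcases lt_or_ge (1 / α) 1 with h | h
  · exact ⟨1, le_rfl, h, by simpa using hp, by linarith⟩
  · obtain ⟨c, hc1, hc2⟩ := exists_between (lt_min hαp
      ((ENNReal.ofReal_lt_ofReal_iff (by positivity)).2 hαβ))
    have hct : c ≠ ∞ := (hc2.trans_le (min_le_right _ _)).ne_top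
    have h1 : 1 / α < c.toReal := (ENNReal.ofReal_lt_iff_lt_toReal (by linarith) hct).1 hc1
    refine ⟨c.toReal, h.trans h1.le, h1, ?_, ?_⟩
    · rw [ENNReal.ofReal_toReal hct]
      exact (hc2.trans_le (min_le_left _ _)).le
    · exact ENNReal.toReal_lt_of_lt_ofReal (hc2.trans_le (min_le_right _ _))

theorem exists_isSmall {β : ℝ≥0} (hβ : 0 < β) (r : ℝ) {Φ₀ : ℝ≥0} (hΦ₀ : 0 < Φ₀) (Φβ Φ₁ Φ₁β : ℝ≥0) :
    ∃ ε, IsSmall β r Φ₀ Φβ Φ₁ Φ₁β ε := by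
  have hβ0 : (0 : ℝ) < β := by exact_mod_cast hβ
  have h : ∀ (c s : ℝ≥0) (x : ℝ), 0 < s → 0 < x → ∀ᶠ ε : ℝ≥0 in 𝓝[>] 0, c * ε ^ x ≤ s := by
    intro c s x hs hx
    have hc : Continuous fun ε : ℝ≥0 => c * ε ^ x :=
      continuous_const.mul (NNReal.continuous_rpow_const hx.le)
    have h0 := (hc.tendsto 0).mono_left (nhdsWithin_le_nhds (s := Ioi 0))
    rw [NNReal.zero_rpow hx.ne', mul_zero] at h0
    exact (h0.eventually_lt_const hs).mono fun _ h => h.le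
  have h8 : (0 : ℝ≥0) < 1 / 8 := by norm_num
  obtain ⟨ε, hpos, h1, h2, h3⟩ := ((eventually_mem_nhdsWithin (a := (0 : ℝ≥0)) (s := Ioi 0)).and
    ((h (2 ^ (β : ℝ) * sewConst β r * Φβ) _ β (NNReal.rpow_pos (p := 1 - (β : ℝ)) hΦ₀) hβ0).and
    ((h (sewConst β r * Φ₁) _ 1 h8 one_pos).and
    (h (sewConst β r * 2 ^ (β : ℝ) * Φ₀ ^ (β : ℝ) * (Φ₁β / (1 + β))) _ (1 + β) h8
      (by positivity))))).exists
  exact ⟨ε, hpos, h1, by simpa using h2, h3⟩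

/-- Bounded Lipschitz functions are Hölder continuous: the Lipschitz bound is used at distances at
most `1` and the bound of the function at larger ones. -/
theorem HolderWith.of_bounded_lipschitz {F G : Type*} [PseudoEMetricSpace F]
    [SeminormedAddCommGroup G] {φ : F → G} {M L β : ℝ≥0} (hβ1 : β ≤ 1) (hM : ∀ x, ‖φ x‖ ≤ M)
    (hL : LipschitzWith L φ) : HolderWith (2 * M + L) β φ := by
  intro x y
  have hβ0 : (β : ℝ) ≤ 1 := by exact_mod_cast hβ1
  push_cast
  rw [add_mul]
  rcases le_total (edist x y) 1 with h | h
  · refine ((hL x y).trans ?_).trans le_add_self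
    gcongr
    simpa using ENNReal.rpow_le_rpow_of_exponent_ge h hβ0
  · refine le_trans ?_ le_self_add
    have h1 : edist (φ x) (φ y) ≤ 2 * M := by
      rw [edist_eq_enorm_sub, two_mul]
      have h2 : ∀ z, ‖φ z‖ₑ ≤ M := fun z => by
        rw [enorm_eq_nnnorm, ENNReal.coe_le_coe]
        exact hM z
      exact enorm_sub_le.trans (add_le_add (h2 x) (h2 y))
    exact h1.trans (le_mul_of_one_le_right zero_le (by simpa using ENNReal.rpow_le_rpow h β.coe_nonneg))

theorem MemC1Holder.exists_holderBound {F G : Type*} [NormedAddCommGroup F] [NormedSpace ℝ F]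
    [NormedAddCommGroup G] [NormedSpace ℝ G] {β : ℝ≥0} (hβ1 : β ≤ 1) {φ : F → G}
    (h : MemC1Holder β φ) :
    ∃ Φ₀ Φβ Φ₁ Φ₁β : ℝ≥0, 0 < Φ₀ ∧ HolderBound₁ β Φ₀ Φβ Φ₁ Φ₁β φ := by
  obtain ⟨hd, ⟨M, hM⟩, ⟨M₁, hM₁⟩, ⟨K, hK⟩⟩ := h
  have hM' : ∀ x, ‖φ x‖ ≤ (M.toNNReal + 1 : ℝ≥0) := fun x => by
    push_cast
    linarith [hM x, Real.le_coe_toNNReal M]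
  have hM₁' : ∀ x, ‖fderiv ℝ φ x‖ ≤ M₁.toNNReal := fun x =>
    (hM₁ x).trans (Real.le_coe_toNNReal M₁)
  have hL : LipschitzWith M₁.toNNReal φ :=
    lipschitzWith_of_nnnorm_fderiv_le hd fun x => hM₁' x
  exact ⟨M.toNNReal + 1, _, M₁.toNNReal, K, by positivity,
    ⟨⟨hM', HolderWith.of_bounded_lipschitz hβ1 hM' hL⟩, hd, hM₁', hK⟩⟩

end

theorem mainTheorem5
    (α : ℝ) (β : ℝ≥0) (p q : ℝ≥0∞) (T : ℝ)
    (hα : 1 / 2 < α) (hβ : 0 < β) (hβ1 : β ≤ 1) (hαβ : 1 / α < 1 + β)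
    (hp : 1 ≤ p) (hαp : ENNReal.ofReal (1 / α) < p) (hq : 0 < q) (hT : 0 < T) :
    -- local existence and uniqueness in the Besov space
    (∀ (n d : ℕ)
      (φ : EuclideanSpace ℝ (Fin d) → EuclideanSpace ℝ (Fin n) →L[ℝ] EuclideanSpace ℝ (Fin d))
      (X : ℝ → EuclideanSpace ℝ (Fin n)),
      MemC1Holder β φ → MemBesov α p q T X →
      ∃ τ ∈ Ioc 0 T, ∀ y₀ : EuclideanSpace ℝ (Fin d),
        ∃ Y : ℝ → EuclideanSpace ℝ (Fin d),
          MemBesov α p q τ Y ∧ IsYoungSolution φ X y₀ τ Y ∧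
          ∀ Z : ℝ → EuclideanSpace ℝ (Fin d),
            MemBesov α p q τ Z → IsYoungSolution φ X y₀ τ Z → EqOn Z Y (Icc 0 τ)) ∧
    -- quantitative version, for every admissible variation exponent `r`
    ∀ r : ℝ, 1 ≤ r → r < 2 → 1 / α < r → ENNReal.ofReal r ≤ p → r < 1 + β →
      ∃ C : ℝ≥0, ∀ (n d : ℕ)
        (φ : EuclideanSpace ℝ (Fin d) → EuclideanSpace ℝ (Fin n) →L[ℝ] EuclideanSpace ℝ (Fin d))
        (X : ℝ → EuclideanSpace ℝ (Fin n)) (Φ₀ Φβ Φ₁ Φ₁β ε : ℝ≥0),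
        0 < Φ₀ → 0 < Φβ → 0 < Φ₁ → 0 < Φ₁β → IsSmall β r Φ₀ Φβ Φ₁ Φ₁β ε →
        HolderBound₁ β Φ₀ Φβ Φ₁ Φ₁β φ → MemBesov α p q T X →
        (∃ τ ∈ Ioc 0 T, rVariation r X (Icc 0 τ) < ε) ∧
        ∀ τ ∈ Ioc 0 T, rVariation r X (Icc 0 τ) < ε →
          (∀ y₀ : EuclideanSpace ℝ (Fin d),
            ∃ Y : ℝ → EuclideanSpace ℝ (Fin d),
              MemBesov α p q τ Y ∧ rVariation r Y (Icc 0 τ) < ∞ ∧ IsYoungSolution φ X y₀ τ Y ∧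
              ∀ Z : ℝ → EuclideanSpace ℝ (Fin d),
                (MemBesov α p q τ Z ∨ rVariation r Z (Icc 0 τ) < ∞) →
                IsYoungSolution φ X y₀ τ Z → EqOn Z Y (Icc 0 τ)) ∧
          ∀ (φ' : EuclideanSpace ℝ (Fin d) →
                EuclideanSpace ℝ (Fin n) →L[ℝ] EuclideanSpace ℝ (Fin d))
            (X' : ℝ → EuclideanSpace ℝ (Fin n)) (y₀ y₀' : EuclideanSpace ℝ (Fin d))
            (Y Y' : ℝ → EuclideanSpace ℝ (Fin d)),
            HolderBound₀ β Φ₀ Φβ φ' → MemBesov α p q T X' → rVariation r X' (Icc 0 τ) < ε →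
            MemBesov α p q τ Y → IsYoungSolution φ X y₀ τ Y →
            MemBesov α p q τ Y' → IsYoungSolution φ' X' y₀' τ Y' →
            besovNorm α p q τ (Y - Y') ≤
              C * (gammaTilde β r Φ₀ Φ₁ Φ₁β ε (besovNorm α p q τ (X - X')) ‖y₀ - y₀'‖ₑ
                    (eHolderNorm β (φ - φ')) (eSupNorm (φ - φ')) * besovNorm α p q τ X
                + 2 * Φ₀ * besovNorm α p q τ (X - X')) := by
  have hα0 : 0 < α := by linarith
  constructor
  · intro n d φ X hφ hX
    obtain ⟨r, hr, hαr, hrp, hrβ⟩ := exists_variation_exponent hβ hαβ hp hαp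
    obtain ⟨Φ₀, Φβ, Φ₁, Φ₁β, hΦ₀, hφ'⟩ := hφ.exists_holderBound hβ1
    obtain ⟨ε, hε⟩ := exists_isSmall hβ r hΦ₀ Φβ Φ₁ Φ₁β
    have hα' : 1 / r < α := (one_div_lt hα0 (by linarith)).1 hαr
    obtain ⟨τ, hτ, hVX⟩ := hX.exists_rVariation_lt hr hrp hq.ne' hα' hT
      (ENNReal.coe_pos.2 hε.pos)
    refine ⟨τ, hτ, fun y₀ => ?_⟩
    obtain ⟨Y, hYB, _, hY, huniq⟩ := existsUnique_memBesov_isYoungSolution hβ hβ1 hr hrβ hrp hq.ne'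
      hα' hε hΦ₀ hφ' hτ.1.le (hX.mono hτ.2) hVX.le y₀
    exact ⟨Y, hYB, hY, fun Z hZ => huniq Z (Or.inl hZ)⟩
  · intro r hr _ hαr hrp hrβ
    have hα' : 1 / r < α := (one_div_lt hα0 (by linarith)).1 hαr
    refine ⟨(stabilityConst α r p q T).toNNReal, ?_⟩
    intro n d φ X Φ₀ Φβ Φ₁ Φ₁β ε hΦ₀ _ _ _ hε hφ hX
    refine ⟨hX.exists_rVariation_lt hr hrp hq.ne' hα' hT (ENNReal.coe_pos.2 hε.pos), ?_⟩
    intro τ hτ hVX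
    refine ⟨fun y₀ => existsUnique_memBesov_isYoungSolution hβ hβ1 hr hrβ hrp hq.ne' hα' hε hΦ₀ hφ
      hτ.1.le (hX.mono hτ.2) hVX.le y₀, ?_⟩
    intro φ' X' y₀ y₀' Y Y' hφ' hX' hVX' hYB hY hYB' hY'
    rw [ENNReal.coe_toNNReal (stabilityConst_ne_top hr hrp hq.ne' hα')]
    exact IsYoungSolution.besovNorm_sub_le hβ hβ1 hr hrβ hrp hq.ne' hα' hε hΦ₀ hφ hφ' hτ.1.le hτ.2
      (hX.mono hτ.2) (hX'.mono hτ.2) hVX.le hVX'.le hYB hY hYB' hY'
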